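/- Let $d\in\mathbb N$, let $E_1,E_2,E_3$ be complex Banach spaces and let $\bullet:E_1\times E_2\to E_3$ be a multiplication, i.e. a continuous bilinear map with $|x_1\bullet x_2|_{E_3}\le |x_1|_{E_1}|x_2|_{E_2}$. Write $\langle x\rangle=(1+|x|^2)^{1/2}$, $\hat f=\mathcal F f$ for the Fourier transform with kernel $e^{-2\pi i x\cdot\xi}$, and $\mathcal S'(\mathbb R^d,E)=\mathcal L(\mathcal S(\mathbb R^d),E)$. For $1\le p,q\le\infty$ and $r,s\in\mathbb R$ let - $L^q_s(\mathbb R^d,E)$ be the space of strongly measurable $u$ with $\|u\|_{L^q_s(E)}=\|\langle\cdot\rangle^s|u|_E\|_{L^q}<\infty$ (and $L^q_s(\mathbb R^d)=L^q_s(\mathbb R^d,\mathbb C)$); - $\mathcal FL^p_r(\mathbb R^d,E)$ be the space of $f\in\mathcal S'(\mathbb R^d,E)$ with $\|f\|_{\mathcal FL^p_r(E)}=\|\mathcal F^{-1}f\|_{L^p_r(E)}<\infty$; - $W^{p,q}_{r,s}(\mathbb R^d,E)$ be the space of $f\in\mathcal S'(\mathbb R^d,E)$ with $$\|f\|_{W^{p,q}_{r,s}}=\Big(\int_{\mathbb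 R^d}\Big(\int_{\mathbb R^d}|V_gf(x,\xi)|_E^p\langle\xi\rangle^{rp}\,d\xi\Big)^{q/p}\langle x\rangle^{sq}\,dx\Big)^{1/q}<\infty$$ (suprema if $p$ or $q$ is $\infty$) for some non-zero window $g\in\mathcal S(\mathbb R^d)$, where $V_gf(x,\xi)=\langle f,\,e^{2\pi i\xi\cdot(\,\cdot\,)}g(\cdot-x)\rangle$ is the short-time Fourier transform; different non-zero windows give equivalent norms. For $f_1\in\mathcal S'(\mathbb R^d,E_1)$, $f_2\in\mathcal S'(\mathbb R^d,E_2)$ the $\bullet$-convolution $f_1*_\bullet f_2$ is the limit in $\mathcal S'(\mathbb R^d,E_3)$, if it exists for all $\chi_1,\chi_2\in C_c^\infty(\mathbb R^d)$ equal to $1$ near $0$ and does not depend on them, of $(\chi_1(\cdot/n)f_1)*_\bullet(\chi_2(\cdot/n)f_2)$ as $n\to\infty$; the $\bullet$-convolution $a*_\bullet b$ of compactly supported distributions is the one with $\mathcal F(a*_\bullet b)=\hat a\bullet\hat b$ (pointwise). The convolution of two complex-valued functions is the usual integral, absolutely convergent almost everywhere. For such spaces, $X*_\bullet Y\hookrightarrow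 Z$ means that there is a constant $C$ such that for all $f\in X$, $g\in Y$ the convolution $f*_\bullet g$ exists, belongs to $Z$, and $\|f*_\bullet g\|_Z\le C\|f\|_X\|g\|_Y$. Let $1\le p_1,p_2,p_3,q_1,q_2,q_3\le\infty$ and $r_1,r_2,r_3,s_1,s_2,s_3\in\mathbb R$ be such that $$\mathcal FL^{p_1}_{r_1}(\mathbb R^d,E_1)*_\bullet\mathcal FL^{p_2}_{r_2}(\mathbb R^d,E_2)\hookrightarrow\mathcal FL^{p_3}_{r_3}(\mathbb R^d,E_3),\qquad L^{q_1}_{s_1}(\mathbb R^d)*L^{q_2}_{s_2}(\mathbb R^d)\hookrightarrow L^{q_3}_{s_3}(\mathbb R^d).$$ Then $$W^{p_1,q_1}_{r_1,s_1}(\mathbb R^d,E_1)*_\bullet W^{p_2,q_2}_{r_2,s_2}(\mathbb R^d,E_2)\hookrightarrow W^{p_3,q_3}_{r_3,s_3}(\mathbb R^d,E_3),$$ the norms of the three $W$-spaces being taken with arbitrary non-zero windows, on which $C$ may depend. -/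

import Mathlib

open MeasureTheory Filter Topology
open scoped SchwartzMap FourierTransform ENNReal NNReal ComplexConjugate

noncomputable section

namespace WienerAmalgam

/-- The Euclidean space `ℝᵈ`. -/
abbrev Rd (d : ℕ) : Type := EuclideanSpace ℝ (Fin d)

/-- The Japanese bracket `⟨x⟩ = (1 + |x|²)^{1/2}`. -/
def japaneseBracket {d : ℕ} (x : Rd d) : ℝ := Real.sqrt (1 + ‖x‖ ^ 2)

/-- The norm of `L^q_s(ℝᵈ)` of the modulus `F` of a function: `‖⟨·⟩^s F‖_{L^q}`, in `[0, ∞]`. -/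
def weightedLpNorm {d : ℕ} (q : ℝ≥0∞) (s : ℝ) (F : Rd d → ℝ≥0∞) : ℝ≥0∞ :=
  eLpNorm (fun x => ENNReal.ofReal (japaneseBracket x ^ s) * F x) q volume

/-- Membership in the weighted Lebesgue–Bochner space `L^q_s(ℝᵈ, E)`. -/
def MemWeightedLp {d : ℕ} {E : Type*} [NormedAddCommGroup E] (q : ℝ≥0∞) (s : ℝ)
    (u : Rd d → E) : Prop :=
  AEStronglyMeasurable u volume ∧ weightedLpNorm q s (fun x => ‖u x‖ₑ) < ∞

/-- The character `y ↦ e^{-2πi y·ξ}`. -/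
def character {d : ℕ} (ξ y : Rd d) : ℂ :=
  Complex.exp (-(2 * Real.pi * Complex.I * ((inner ℝ y ξ : ℝ) : ℂ)))

lemma hasTemperateGrowth_cexp (c : ℝ) :
    Function.HasTemperateGrowth (fun t : ℝ => Complex.exp (((c * t : ℝ) : ℂ) * Complex.I)) := by
  have key : ∀ n : ℕ, iteratedDeriv n (fun t : ℝ => Complex.exp (((c * t : ℝ) : ℂ) * Complex.I)) =
      fun t : ℝ => (c * Complex.I) ^ n * Complex.exp (((c * t : ℝ) : ℂ) * Complex.I) := by
    intro n
    induction n with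
    | zero => simp
    | succ n ih =>
      rw [iteratedDeriv_succ, ih]
      funext t
      have h1 : HasDerivAt (fun t : ℝ => ((c * t : ℝ) : ℂ) * Complex.I) (c * Complex.I) t := by
        have h0 : HasDerivAt (fun t : ℝ => ((c * t : ℝ) : ℂ)) ((c : ℝ) : ℂ) t := by
          have := ((hasDerivAt_id t).const_mul c).ofReal_comp
          simpa using this
        exact h0.mul_const _
      have h2 := (h1.cexp).const_mul ((c * Complex.I) ^ n)
      rw [h2.deriv]
      ring
  refine ⟨?_, ?_⟩
  · have : ContDiff ℝ ((⊤ : ℕ∞) : WithTop ℕ∞)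
        (fun t : ℝ => ((c * t : ℝ) : ℂ) * Complex.I) :=
      (Complex.ofRealCLM.contDiff.comp (contDiff_const.mul contDiff_id)).mul contDiff_const
    exact this.cexp
  · intro n
    refine ⟨0, |c| ^ n, fun t => ?_⟩
    rw [norm_iteratedFDeriv_eq_norm_iteratedDeriv, key n]
    simp [Complex.norm_exp]

lemma hasTemperateGrowth_character {d : ℕ} (ξ : Rd d) :
    Function.HasTemperateGrowth (character ξ) := by
  have h := (hasTemperateGrowth_cexp (-(2 * Real.pi))).comp
    (Function.hasTemperateGrowth_inner_left ξ)
  have e : character ξ = (fun t : ℝ => Complex.exp (((-(2 * Real.pi) * t : ℝ) : ℂ) * Complex.I)) ∘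
      fun y : Rd d => (inner ℝ y ξ : ℝ) := by
    funext y
    simp only [character, Function.comp]
    congr 1
    push_cast
    ring
  rw [e]
  exact h

/-- Multiplication of a Schwartz function by the character `y ↦ e^{-2πi y·ξ}`. -/
def charMul {d : ℕ} (ξ : Rd d) (φ : 𝓢(Rd d, ℂ)) : 𝓢(Rd d, ℂ) :=
  SchwartzMap.smulLeftCLM ℂ (character ξ) φ

lemma charMul_apply {d : ℕ} (ξ : Rd d) (φ : 𝓢(Rd d, ℂ)) (y : Rd d) :
    charMul ξ φ y = character ξ y * φ y := by
  simp [charMul, SchwartzMap.smulLeftCLM_apply_apply (hasTemperateGrowth_character ξ)]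

/-- The pointwise complex conjugate of a Schwartz function. -/
def conjSchwartz {d : ℕ} (φ : 𝓢(Rd d, ℂ)) : 𝓢(Rd d, ℂ) :=
  SchwartzMap.postcompCLM (Complex.conjCLE : ℂ →L[ℝ] ℂ) φ

lemma conjSchwartz_apply {d : ℕ} (φ : 𝓢(Rd d, ℂ)) (y : Rd d) :
    conjSchwartz φ y = conj (φ y) := rfl

/-- The short-time Fourier transform `V_g f(x, ξ) = ⟨f, M_ξ T_x g⟩`. The bracket is conjugate
linear in its second slot, Mathlib's distributions act linearly; so `f` is applied to the
conjugate `y ↦ e^{-2πi y·ξ} conj (g (y - x))` of `M_ξ T_x g`. -/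
def stft {d : ℕ} {E : Type*} [NormedAddCommGroup E] [NormedSpace ℂ E]
    (g : 𝓢(Rd d, ℂ)) (f : 𝓢'(Rd d, E)) (x ξ : Rd d) : E :=
  f (charMul ξ (conjSchwartz (SchwartzMap.compSubConstCLM ℂ x g)))

/-- The norm of `W^{p,q}_{r,s}(ℝᵈ, E)` with window `g`, in `[0, ∞]`:
the `L^q_s`-norm in `x` of the `L^p_r`-norm in `ξ` of `V_g f(x, ξ)`. -/
def amalgamNorm {d : ℕ} {E : Type*} [NormedAddCommGroup E] [NormedSpace ℂ E]
    (p q : ℝ≥0∞) (r s : ℝ) (g : 𝓢(Rd d, ℂ)) (f : 𝓢'(Rd d, E)) : ℝ≥0∞ :=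
  weightedLpNorm q s (fun x => weightedLpNorm p r (fun ξ => ‖stft g f x ξ‖ₑ))

/-- Membership in the Wiener amalgam space `W^{p,q}_{r,s}(ℝᵈ, E)`. -/
def MemAmalgam {d : ℕ} {E : Type*} [NormedAddCommGroup E] [NormedSpace ℂ E]
    (p q : ℝ≥0∞) (r s : ℝ) (f : 𝓢'(Rd d, E)) : Prop :=
  ∃ g : 𝓢(Rd d, ℂ), g ≠ 0 ∧ amalgamNorm p q r s g f < ∞

/-- The tempered distribution `T` is given by the function `u`. -/
def IsGivenBy {d : ℕ} {E : Type*} [NormedAddCommGroup E] [NormedSpace ℂ E]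
    (T : 𝓢'(Rd d, E)) (u : Rd d → E) : Prop :=
  AEStronglyMeasurable u volume ∧
    ∀ φ : 𝓢(Rd d, ℂ), Integrable (fun x => φ x • u x) volume ∧ T φ = ∫ x, φ x • u x

/-- The Fourier–Lebesgue norm `‖f‖_{𝓕L^p_r(E)} = ‖𝓕⁻¹ f‖_{L^p_r(E)}`; it is `∞` if `𝓕⁻¹ f` is not
a function, and otherwise all the functions `u` in the infimum agree almost everywhere. -/
def fourierLebesgueNorm {d : ℕ} {E : Type*} [NormedAddCommGroup E] [NormedSpace ℂ E]
    (p : ℝ≥0∞) (r : ℝ) (f : 𝓢'(Rd d, E)) : ℝ≥0∞ :=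
  ⨅ (u : Rd d → E) (_ : IsGivenBy (𝓕⁻ f) u), weightedLpNorm p r (fun ξ => ‖u ξ‖ₑ)

/-- Membership in the Fourier–Lebesgue space `𝓕L^p_r(ℝᵈ, E)`. -/
def MemFourierLebesgue {d : ℕ} {E : Type*} [NormedAddCommGroup E] [NormedSpace ℂ E]
    (p : ℝ≥0∞) (r : ℝ) (f : 𝓢'(Rd d, E)) : Prop :=
  fourierLebesgueNorm p r f < ∞

/-- A cutoff function: smooth, compactly supported, equal to `1` near the origin. -/
def IsCutoff {d : ℕ} (χ : 𝓢(Rd d, ℂ)) : Prop :=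
  HasCompactSupport χ ∧ ∀ᶠ x in 𝓝 (0 : Rd d), χ x = 1

/-- The dilate `x ↦ χ (x / (n + 1))`. -/
def dilate {d : ℕ} (χ : 𝓢(Rd d, ℂ)) (n : ℕ) : 𝓢(Rd d, ℂ) :=
  SchwartzMap.compCLMOfContinuousLinearEquiv ℂ
    (ContinuousLinearEquiv.smulLeft (Units.mk0 ((n + 1 : ℝ)⁻¹) (by positivity)) :
      Rd d ≃L[ℝ] Rd d) χ

lemma dilate_apply {d : ℕ} (χ : 𝓢(Rd d, ℂ)) (n : ℕ) (x : Rd d) :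
    dilate χ n x = χ ((n + 1 : ℝ)⁻¹ • x) := rfl

/-- For compactly supported `χ`, the Fourier transform of the compactly supported distribution
`χ f`, which is the function `ξ ↦ f (χ e^{-2πi ξ·})`. -/
def fourierOfTruncation {d : ℕ} {E : Type*} [NormedAddCommGroup E] [NormedSpace ℂ E]
    (χ : 𝓢(Rd d, ℂ)) (f : 𝓢'(Rd d, E)) (ξ : Rd d) : E :=
  f (charMul ξ χ)

/-- `h` is the `•`-convolution of the tempered distributions `f₁` and `f₂`: for all cutoff functions
`χ₁`, `χ₂`, the convolutions `(χ₁(·/n) f₁) *_• (χ₂(·/n) f₂)` of the truncated (hence compactly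
supported) distributions converge to `h` in `𝓢'(ℝᵈ, E₃)`. This is written on the Fourier side, where
the convolution of two compactly supported distributions is the pointwise `•`-product of their
Fourier transforms, which are smooth functions of polynomial growth. -/
def IsConvolution {d : ℕ} {E₁ E₂ E₃ : Type*}
    [NormedAddCommGroup E₁] [NormedSpace ℂ E₁] [NormedAddCommGroup E₂] [NormedSpace ℂ E₂]
    [NormedAddCommGroup E₃] [NormedSpace ℂ E₃] (B : E₁ →L[ℂ] E₂ →L[ℂ] E₃)
    (f₁ : 𝓢'(Rd d, E₁)) (f₂ : 𝓢'(Rd d, E₂)) (h : 𝓢'(Rd d, E₃)) : Prop :=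
  ∀ χ₁ χ₂ : 𝓢(Rd d, ℂ), IsCutoff χ₁ → IsCutoff χ₂ → ∀ φ : 𝓢(Rd d, ℂ),
    Tendsto (fun n : ℕ => ∫ ξ, φ ξ • B (fourierOfTruncation (dilate χ₁ n) f₁ ξ)
      (fourierOfTruncation (dilate χ₂ n) f₂ ξ)) atTop (𝓝 ((𝓕 h) φ))

/-- `𝓕L^{p₁}_{r₁}(E₁) *_• 𝓕L^{p₂}_{r₂}(E₂) ↪ 𝓕L^{p₃}_{r₃}(E₃)`. -/
def FourierLebesgueConvEmbeds (d : ℕ) {E₁ E₂ E₃ : Type*}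
    [NormedAddCommGroup E₁] [NormedSpace ℂ E₁] [NormedAddCommGroup E₂] [NormedSpace ℂ E₂]
    [NormedAddCommGroup E₃] [NormedSpace ℂ E₃] (B : E₁ →L[ℂ] E₂ →L[ℂ] E₃)
    (p₁ p₂ p₃ : ℝ≥0∞) (r₁ r₂ r₃ : ℝ) : Prop :=
  ∃ C : ℝ≥0, ∀ (f₁ : 𝓢'(Rd d, E₁)) (f₂ : 𝓢'(Rd d, E₂)),
    MemFourierLebesgue p₁ r₁ f₁ → MemFourierLebesgue p₂ r₂ f₂ →
    ∃ h : 𝓢'(Rd d, E₃), IsConvolution B f₁ f₂ h ∧ MemFourierLebesgue p₃ r₃ h ∧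
      fourierLebesgueNorm p₃ r₃ h ≤
        C * fourierLebesgueNorm p₁ r₁ f₁ * fourierLebesgueNorm p₂ r₂ f₂

/-- `L^{q₁}_{s₁}(ℝᵈ) * L^{q₂}_{s₂}(ℝᵈ) ↪ L^{q₃}_{s₃}(ℝᵈ)`, for complex-valued functions and the
convolution integral, which has to converge absolutely almost everywhere. -/
def LebesgueConvEmbeds (d : ℕ) (q₁ q₂ q₃ : ℝ≥0∞) (s₁ s₂ s₃ : ℝ) : Prop :=
  ∃ C : ℝ≥0, ∀ u v : Rd d → ℂ, MemWeightedLp q₁ s₁ u → MemWeightedLp q₂ s₂ v →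
    (∀ᵐ x, ConvolutionExistsAt u v x (ContinuousLinearMap.mul ℂ ℂ) volume) ∧
    MemWeightedLp q₃ s₃ (convolution u v (ContinuousLinearMap.mul ℂ ℂ) volume) ∧
    weightedLpNorm q₃ s₃ (fun x => ‖convolution u v (ContinuousLinearMap.mul ℂ ℂ) volume x‖ₑ) ≤
      C * weightedLpNorm q₁ s₁ (fun x => ‖u x‖ₑ) * weightedLpNorm q₂ s₂ (fun x => ‖v x‖ₑ)

/-- `W^{p₁,q₁}_{r₁,s₁}(E₁) *_• W^{p₂,q₂}_{r₂,s₂}(E₂) ↪ W^{p₃,q₃}_{r₃,s₃}(E₃)`, the three norms being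
taken with any non-zero windows `g₁`, `g₂`, `g₃`, on which the constant may depend. -/
def AmalgamConvEmbeds (d : ℕ) {E₁ E₂ E₃ : Type*}
    [NormedAddCommGroup E₁] [NormedSpace ℂ E₁] [NormedAddCommGroup E₂] [NormedSpace ℂ E₂]
    [NormedAddCommGroup E₃] [NormedSpace ℂ E₃] (B : E₁ →L[ℂ] E₂ →L[ℂ] E₃)
    (p₁ p₂ p₃ q₁ q₂ q₃ : ℝ≥0∞) (r₁ r₂ r₃ s₁ s₂ s₃ : ℝ) : Prop :=
  ∀ g₁ g₂ g₃ : 𝓢(Rd d, ℂ), g₁ ≠ 0 → g₂ ≠ 0 → g₃ ≠ 0 →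
    ∃ C : ℝ≥0, ∀ (f₁ : 𝓢'(Rd d, E₁)) (f₂ : 𝓢'(Rd d, E₂)),
      MemAmalgam p₁ q₁ r₁ s₁ f₁ → MemAmalgam p₂ q₂ r₂ s₂ f₂ →
      ∃ h : 𝓢'(Rd d, E₃), IsConvolution B f₁ f₂ h ∧ MemAmalgam p₃ q₃ r₃ s₃ h ∧
        amalgamNorm p₃ q₃ r₃ s₃ g₃ h ≤
          C * amalgamNorm p₁ q₁ r₁ s₁ g₁ f₁ * amalgamNorm p₂ q₂ r₂ s₂ g₂ f₂

end WienerAmalgam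

end

open MeasureTheory Filter Topology
open scoped SchwartzMap FourierTransform ENNReal NNReal ComplexConjugate

noncomputable section

namespace WienerAmalgam

/-! ### Minkowski's integral inequality -/

section Minkowski

variable {X Y : Type*} [MeasurableSpace X] [MeasurableSpace Y]

/-! Fix a smooth `ψ` with integral one, supported in a ball of radius 2, and write `T_x` for
translation by `x`. Then `f_i = ∫ (T_x ψ) f_i dx`, so formally `f₁ * f₂` is the double integral of
the pieces `(T_x ψ f₁) * (T_y ψ f₂)`. Put `A_i(x) = ‖T_x ψ f_i‖` in the local Fourier–Lebesgue norm.
All non-zero windows give comparable norms (`exists_windowChange_le`), so the weighted `L^{q_i}`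
norm of `A_i` is controlled by the amalgam norm of `f_i`.

Each piece satisfies two estimates. The local hypothesis, used only for compactly supported factors,
bounds its Fourier–Lebesgue norm by `C A₁(x) A₂(y)`
(`FourierLebesgueConvEmbeds.exists_prodSymbol_le`). Moreover it lives near `x + y`
(`pairing_eq_localized`), so a window centred at `z` sees it only up to a factor `⟨z - x - y⟩^{-N}`
(`exists_enorm_pairing_window_le`). Minkowski's inequality over the pairs `(x, y)` then bounds the
local norm of the convolution at `z` by `C (⟨·⟩^{-N} * A₁ * A₂)(z)`. For large `N` the kernel acts
boundedly on weighted Lebesgue spaces, and the global hypothesis applied to `A₁ * A₂` finishes the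
estimate.

Existence of the convolution is a dominated convergence argument
(`FourierLebesgueConvEmbeds.exists_isConvolution`). Truncating `f_i` by dilated cutoffs changes the
local norms by a factor bounded uniformly in the dilation, so all truncated integrands are dominated
by a multiple of `⟨x + y⟩^{-N} A₁(x) A₂(y)`. Its integral is that of `⟨w⟩^{-N} (A₁ * A₂)(w)`, which
is finite because weighted `L^{q₃}` embeds into `L¹` with weight `⟨·⟩^{-N}`.

The calculations take place on the Fourier side, where a convolution of pieces is the pointwise
product `prodSymbol`. Pulling a vector-valued distribution through an integral of Schwartz functions
is justified by `IsDominated.apply_eq_integral`. -/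

lemma measurable_eLpNorm_left {ν : Measure Y} [SFinite ν] {F : X → Y → ℝ≥0∞}
    (hF : Measurable (Function.uncurry F)) (p : ℝ≥0∞) :
    Measurable fun x => eLpNorm (F x) p ν := by
  rcases eq_or_ne p 0 with rfl | h0
  · simp
  rcases eq_or_ne p ∞ with rfl | ht
  · refine measurable_of_Ioi fun c => ?_
    -- The essential supremum exceeds `c` exactly when the slice of the superlevel set has positive
    -- measure, and slice measures are measurable.
    have : (fun x => eLpNorm (F x) ∞ ν) ⁻¹' Set.Ioi c =
        {x | ν (Prod.mk x ⁻¹' {z : X × Y | c < F z.1 z.2}) ≠ 0} := by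
      ext x
      simp only [Set.mem_preimage, Set.mem_Ioi, Set.mem_ofPred_eq, eLpNorm_exponent_top,
        eLpNormEssSup, enorm_eq_self]
      rw [← not_iff_not, not_lt, not_ne_iff]
      constructor
      · intro h
        have h1 : ∀ᵐ y ∂ν, F x y ≤ c := (ENNReal.ae_le_essSup (F x)).mono fun y hy => hy.trans h
        rw [ae_iff] at h1
        simpa [not_le] using h1
      · intro h
        refine essSup_le_of_ae_le c ?_
        change ∀ᵐ y ∂ν, F x y ≤ c
        rw [ae_iff]
        simpa [not_le] using h
    rw [this]
    have hm : Measurable fun x => ν (Prod.mk x ⁻¹' {z : X × Y | c < F z.1 z.2}) :=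
      measurable_measure_prodMk_left (measurableSet_lt measurable_const hF)
    exact hm (measurableSet_singleton 0).compl
  · simp only [eLpNorm_eq_lintegral_rpow_enorm_toReal h0 ht, enorm_eq_self]
    exact ((hF.pow_const p.toReal).lintegral_prod_right' (ν := ν)).pow_const _

/-- For `1 < p < ∞`, Hölder's inequality is applied to the splitting `F = a^{1/Q} · (F a^{-1/Q})`,
followed by Tonelli. This avoids duality, but it divides by powers of the majorant `a`, hence the
demand that `a` never vanish. -/
lemma eLpNorm_lintegral_le_of_pos {μ : Measure X} {ν : Measure Y} [SFinite μ] [SFinite ν]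
    {F : X → Y → ℝ≥0∞} (hF : Measurable (Function.uncurry F)) {p : ℝ≥0∞} (hp : 1 ≤ p)
    {a : X → ℝ≥0∞} (ha : Measurable a) (hapos : ∀ x, a x ≠ 0)
    (hle : ∀ x, eLpNorm (F x) p ν ≤ a x) :
    eLpNorm (fun y => ∫⁻ x, F x y ∂μ) p ν ≤ ∫⁻ x, a x ∂μ := by
  rcases eq_or_ne (∫⁻ x, a x ∂μ) ∞ with hR | hR
  · rw [hR]; exact le_top
  have hafin : ∀ᵐ x ∂μ, a x ≠ ∞ := (ae_lt_top ha hR).mono fun x hx => hx.ne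
  have hp0 : p ≠ 0 := (zero_lt_one.trans_le hp).ne'
  rcases eq_or_ne p ∞ with rfl | ht
  · rw [eLpNorm_exponent_top]
    refine essSup_le_of_ae_le _ ?_
    have h1 : ∀ᵐ x ∂μ, ∀ᵐ y ∂ν, F x y ≤ a x := Eventually.of_forall fun x => by
      have := hle x
      rw [eLpNorm_exponent_top] at this
      exact (ENNReal.ae_le_essSup (F x)).mono fun y hy => hy.trans this
    have h2 : ∀ᵐ y ∂ν, ∀ᵐ x ∂μ, F x y ≤ a x := by
      exact (Measure.ae_ae_comm (p := fun x y => F x y ≤ a x)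
        (measurableSet_le hF (ha.comp measurable_fst))).1 h1
    filter_upwards [h2] with y hy
    simpa using lintegral_mono_ae hy
  rcases eq_or_ne p 1 with rfl | h1
  · simp only [eLpNorm_one_eq_lintegral_enorm, enorm_eq_self] at hle ⊢
    rw [lintegral_lintegral_swap (by exact (hF.comp measurable_swap).aemeasurable)]
    exact lintegral_mono hle
  have hpt : 1 < p.toReal := by
    have := (ENNReal.toReal_lt_toReal ENNReal.one_ne_top ht).2 (lt_of_le_of_ne hp h1.symm)
    simpa using this
  set P := p.toReal with hP
  have hP0 : 0 < P := zero_lt_one.trans hpt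
  have hconj := Real.HolderConjugate.conjExponent hpt
  set Q := P.conjExponent
  have hQ0 : 0 < Q := hconj.symm.pos
  set R := ∫⁻ x, a x ∂μ with hRdef
  have hexp : P / Q + 1 = P := by rw [hconj.div_conj_eq_sub_one]; ring
  rw [eLpNorm_eq_lintegral_rpow_enorm_toReal hp0 ht]
  simp only [enorm_eq_self, ← hP]
  have hpt1 : ∀ y, (∫⁻ x, F x y ∂μ) ^ P ≤ R ^ (P / Q) * ∫⁻ x, (F x y) ^ P * a x ^ (-(P / Q)) ∂μ := by
    intro y
    have e : ∫⁻ x, F x y ∂μ = ∫⁻ x, ((fun x => a x ^ (1 / Q)) * fun x => F x y * a x ^ (-(1 / Q))) x ∂μ := by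
      refine lintegral_congr_ae (hafin.mono fun x hx => ?_)
      simp only [Pi.mul_apply]
      rw [mul_comm, mul_assoc, ← ENNReal.rpow_add _ _ (hapos x) hx]
      simp
    have hFy : Measurable fun x => F x y := hF.comp (measurable_id.prodMk measurable_const)
    have hold := ENNReal.lintegral_mul_le_Lp_mul_Lq μ hconj.symm (ha.pow_const (1 / Q)).aemeasurable
      (g := fun x => F x y * a x ^ (-(1 / Q))) (hFy.mul (ha.pow_const (-(1 / Q)))).aemeasurable
    rw [e]
    refine (ENNReal.rpow_le_rpow hold hP0.le).trans (le_of_eq ?_)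
    rw [ENNReal.mul_rpow_of_nonneg _ _ hP0.le, ← ENNReal.rpow_mul, ← ENNReal.rpow_mul,
      one_div_mul_cancel hP0.ne', ENNReal.rpow_one]
    congr 1
    · congr 1
      · refine lintegral_congr fun x => ?_
        rw [← ENNReal.rpow_mul, one_div_mul_cancel hQ0.ne', ENNReal.rpow_one]
      · field_simp
    · refine lintegral_congr fun x => ?_
      rw [ENNReal.mul_rpow_of_nonneg _ _ hP0.le, ← ENNReal.rpow_mul]
      congr 2
      field_simp
  have hInt : ∫⁻ y, (∫⁻ x, F x y ∂μ) ^ P ∂ν ≤ R ^ P := by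
    calc ∫⁻ y, (∫⁻ x, F x y ∂μ) ^ P ∂ν
        ≤ ∫⁻ y, R ^ (P / Q) * ∫⁻ x, (F x y) ^ P * a x ^ (-(P / Q)) ∂μ ∂ν := lintegral_mono hpt1
      _ = R ^ (P / Q) * ∫⁻ y, ∫⁻ x, (F x y) ^ P * a x ^ (-(P / Q)) ∂μ ∂ν := by
          rw [lintegral_const_mul' _ _ (ENNReal.rpow_ne_top_of_nonneg (by positivity) hR)]
      _ = R ^ (P / Q) * ∫⁻ x, ∫⁻ y, (F x y) ^ P * a x ^ (-(P / Q)) ∂ν ∂μ := by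
          rw [lintegral_lintegral_swap]
          exact (((hF.comp measurable_swap).pow_const _).mul
            ((ha.pow_const _).comp measurable_snd)).aemeasurable
      _ ≤ R ^ (P / Q) * ∫⁻ x, a x ∂μ := by
          gcongr 1
          refine lintegral_mono_ae (hafin.mono fun x hx => ?_)
          have hFx : Measurable fun y => F x y := hF.comp (measurable_const.prodMk measurable_id)
          rw [lintegral_mul_const _ (hFx.pow_const _)]
          have h := hle x
          rw [eLpNorm_eq_lintegral_rpow_enorm_toReal hp0 ht] at h
          simp only [enorm_eq_self, ← hP] at h
          rw [one_div, ENNReal.rpow_inv_le_iff hP0] at h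
          calc _ ≤ a x ^ P * a x ^ (-(P / Q)) := by gcongr
            _ = a x := by
              rw [← ENNReal.rpow_add _ _ (hapos x) hx]
              have : P + -(P / Q) = 1 := by linarith
              rw [this, ENNReal.rpow_one]
      _ = R ^ P := by
          rw [← hRdef]
          nth_rewrite 2 [← ENNReal.rpow_one R]
          rw [← ENNReal.rpow_add_of_nonneg _ _ (by positivity) zero_le_one, hexp]
  rw [one_div, ENNReal.rpow_inv_le_iff hP0]
  exact hInt

/-- **Minkowski's integral inequality**. -/
theorem eLpNorm_lintegral_le {μ : Measure X} {ν : Measure Y} [SigmaFinite μ] [SFinite ν]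
    {F : X → Y → ℝ≥0∞} (hF : Measurable (Function.uncurry F)) {p : ℝ≥0∞} (hp : 1 ≤ p) :
    eLpNorm (fun y => ∫⁻ x, F x y ∂μ) p ν ≤ ∫⁻ x, eLpNorm (F x) p ν ∂μ := by
  refine ENNReal.le_of_forall_pos_le_add fun ε hε _ => ?_
  -- Adding a positive function of integral below `ε` makes the majorant non-vanishing.
  obtain ⟨b, hb0, hbm, hb⟩ := exists_pos_lintegral_lt_of_sigmaFinite μ
    (ENNReal.coe_ne_zero.2 hε.ne')
  have hm := measurable_eLpNorm_left (ν := ν) hF p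
  refine (eLpNorm_lintegral_le_of_pos (μ := μ) (ν := ν) hF hp
    (a := fun x => eLpNorm (F x) p ν + b x) (hm.add hbm.coe_nnreal_ennreal) (fun x => ?_)
    (fun x => le_self_add)).trans ?_
  · have := hb0 x
    simp [this.ne']
  · rw [lintegral_add_left hm]
    gcongr

end Minkowski

/-! ### Polynomial weights -/

section Weights

variable {d : ℕ}

lemma one_le_japaneseBracket (x : Rd d) : 1 ≤ japaneseBracket x := by
  rw [japaneseBracket, Real.one_le_sqrt]
  nlinarith [sq_nonneg ‖x‖]

lemma japaneseBracket_pos (x : Rd d) : 0 < japaneseBracket x :=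
  zero_lt_one.trans_le (one_le_japaneseBracket x)

lemma continuous_japaneseBracket : Continuous (japaneseBracket (d := d)) := by
  unfold japaneseBracket; fun_prop

lemma japaneseBracket_neg (x : Rd d) : japaneseBracket (-x) = japaneseBracket x := by
  simp [japaneseBracket]

lemma japaneseBracket_add_le (x y : Rd d) :
    japaneseBracket (x + y) ≤ 2 * japaneseBracket x * japaneseBracket y := by
  have hx := Real.sq_sqrt (show 0 ≤ 1 + ‖x‖ ^ 2 by positivity)
  have hy := Real.sq_sqrt (show 0 ≤ 1 + ‖y‖ ^ 2 by positivity)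
  refine (Real.sqrt_le_left (by positivity [japaneseBracket_pos x, japaneseBracket_pos y])).2 ?_
  rw [mul_pow, mul_pow]
  simp only [japaneseBracket, hx, hy]
  nlinarith [norm_add_le x y, norm_nonneg (x + y), sq_nonneg (‖x‖ - ‖y‖), sq_nonneg (‖x‖ * ‖y‖),
    norm_nonneg x, norm_nonneg y, sq_nonneg ‖x‖, sq_nonneg ‖y‖]

/-- The weight `⟨x⟩^s` with values in `[0, ∞]`. -/
def weight (s : ℝ) (x : Rd d) : ℝ≥0∞ := ENNReal.ofReal (japaneseBracket x ^ s)

lemma weight_ne_top (s : ℝ) (x : Rd d) : weight s x ≠ ∞ := ENNReal.ofReal_ne_top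

lemma weight_ne_zero (s : ℝ) (x : Rd d) : weight s x ≠ 0 := by
  have := Real.rpow_pos_of_pos (japaneseBracket_pos x) s
  simpa [weight] using this

lemma weight_add (s t : ℝ) (x : Rd d) : weight (s + t) x = weight s x * weight t x := by
  rw [weight, Real.rpow_add (japaneseBracket_pos x),
    ENNReal.ofReal_mul (Real.rpow_nonneg (japaneseBracket_pos x).le _)]
  rfl

@[simp] lemma weight_zero (x : Rd d) : weight 0 x = 1 := by simp [weight]

lemma weight_neg_mul (s : ℝ) (x : Rd d) : weight (-s) x * weight s x = 1 := by
  rw [← weight_add]; simp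

lemma weight_neg_arg (s : ℝ) (x : Rd d) : weight s (-x) = weight s x := by
  simp [weight, japaneseBracket_neg]

lemma weight_sub_comm (s : ℝ) (x y : Rd d) : weight s (x - y) = weight s (y - x) := by
  rw [← weight_neg_arg, neg_sub]

lemma weight_mono {s t : ℝ} (h : s ≤ t) (x : Rd d) : weight s x ≤ weight t x :=
  ENNReal.ofReal_le_ofReal (Real.rpow_le_rpow_of_exponent_le (one_le_japaneseBracket x) h)

lemma continuous_weight (s : ℝ) : Continuous (weight s : Rd d → ℝ≥0∞) :=
  ENNReal.continuous_ofReal.comp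
    (continuous_japaneseBracket.rpow_const fun x => Or.inl (japaneseBracket_pos x).ne')

@[fun_prop]
lemma measurable_weight (s : ℝ) : Measurable (weight s : Rd d → ℝ≥0∞) :=
  (continuous_weight s).measurable

/-- **Peetre's inequality**. -/
lemma weight_add_le (s : ℝ) (x y : Rd d) :
    weight s (x + y) ≤ ENNReal.ofReal (2 ^ |s|) * weight |s| x * weight s y := by
  have hx := japaneseBracket_pos x
  have hy := japaneseBracket_pos y
  have hxy := japaneseBracket_pos (x + y)
  rw [weight, weight, weight, ← ENNReal.ofReal_mul (by positivity),
    ← ENNReal.ofReal_mul (by positivity)]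
  refine ENNReal.ofReal_le_ofReal ?_
  rcases le_total 0 s with hs | hs
  · rw [abs_of_nonneg hs, ← Real.mul_rpow (by norm_num) hx.le, ← Real.mul_rpow (by positivity) hy.le]
    exact Real.rpow_le_rpow hxy.le (japaneseBracket_add_le x y) hs
  · rw [abs_of_nonpos hs, ← Real.mul_rpow (by norm_num) hx.le]
    -- A negative exponent reverses the inequality, so the bracket bound is needed for `y = -x + (x
    -- + y)`.
    have h := japaneseBracket_add_le (-x) (x + y)
    rw [neg_add_cancel_left, japaneseBracket_neg] at h
    have h2 := Real.rpow_le_rpow_of_nonpos hy h hs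
    rw [Real.mul_rpow (by positivity) hxy.le] at h2
    have h3 : (2 * japaneseBracket x) ^ (-s) * (2 * japaneseBracket x) ^ s = 1 := by
      rw [← Real.rpow_add (by positivity)]; simp
    calc japaneseBracket (x + y) ^ s
        = (2 * japaneseBracket x) ^ (-s) * ((2 * japaneseBracket x) ^ s * japaneseBracket (x + y) ^ s) := by
          rw [← mul_assoc, h3, one_mul]
      _ ≤ _ := by gcongr

lemma lintegral_weight_neg_lt_top {s : ℝ} (hs : d < s) : ∫⁻ x : Rd d, weight (-s) x < ∞ := by
  have h := integrable_rpow_neg_one_add_norm_sq (E := Rd d) (μ := volume) (r := s) (by simpa using hs)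
  have := h.lintegral_lt_top
  refine lt_of_eq_of_lt (lintegral_congr fun x => ?_) this
  rw [weight, japaneseBracket, Real.sqrt_eq_rpow, ← Real.rpow_mul (by positivity)]
  congr 2
  ring

lemma weightedLpNorm_eq (q : ℝ≥0∞) (s : ℝ) (F : Rd d → ℝ≥0∞) :
    weightedLpNorm q s F = eLpNorm (fun x => weight s x * F x) q volume := rfl

lemma weightedLpNorm_mono_ae {q : ℝ≥0∞} {s : ℝ} {F G : Rd d → ℝ≥0∞} (h : ∀ᵐ x, F x ≤ G x) :
    weightedLpNorm q s F ≤ weightedLpNorm q s G := by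
  refine eLpNorm_mono_enorm_ae (h.mono fun x hx => ?_)
  simp only [enorm_eq_self]
  gcongr

lemma weightedLpNorm_mono {q : ℝ≥0∞} {s : ℝ} {F G : Rd d → ℝ≥0∞} (h : ∀ x, F x ≤ G x) :
    weightedLpNorm q s F ≤ weightedLpNorm q s G :=
  weightedLpNorm_mono_ae (Eventually.of_forall h)

lemma weightedLpNorm_congr_ae {q : ℝ≥0∞} {s : ℝ} {F G : Rd d → ℝ≥0∞} (h : ∀ᵐ x, F x = G x) :
    weightedLpNorm q s F = weightedLpNorm q s G :=
  le_antisymm (weightedLpNorm_mono_ae (h.mono fun _ hx => hx.le))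
    (weightedLpNorm_mono_ae (h.mono fun _ hx => hx.ge))

lemma weightedLpNorm_const_mul_le (q : ℝ≥0∞) (s : ℝ) (F : Rd d → ℝ≥0∞) (c : ℝ≥0) :
    weightedLpNorm q s (fun x => c * F x) ≤ c * weightedLpNorm q s F := by
  have := eLpNorm_le_nnreal_smul_eLpNorm_of_ae_le_mul' (μ := (volume : Measure (Rd d)))
    (f := fun x => weight s x * (c * F x)) (g := fun x => weight s x * F x) (c := c)
    (Eventually.of_forall fun x => by simp only [enorm_eq_self]; rw [mul_left_comm]) q
  simpa [weightedLpNorm_eq, ENNReal.smul_def] using this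

lemma weightedLpNorm_lintegral_le {X : Type*} [MeasurableSpace X] {μ : Measure X} [SigmaFinite μ]
    {p : ℝ≥0∞} (hp : 1 ≤ p) (r : ℝ) {F : X → Rd d → ℝ≥0∞} (hF : Measurable (Function.uncurry F)) :
    weightedLpNorm p r (fun ξ => ∫⁻ x, F x ξ ∂μ) ≤ ∫⁻ x, weightedLpNorm p r (F x) ∂μ := by
  have hG : Measurable (Function.uncurry fun x ξ => weight r ξ * F x ξ) :=
    ((measurable_weight r).comp measurable_snd).mul hF
  refine le_trans (le_of_eq ?_) (eLpNorm_lintegral_le (ν := (volume : Measure (Rd d))) (μ := μ) hG hp)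
  rw [weightedLpNorm_eq]
  congr 1
  ext ξ
  rw [lintegral_const_mul' _ _ (weight_ne_top r ξ)]

lemma measurable_weightedLpNorm_left {X : Type*} [MeasurableSpace X] (p : ℝ≥0∞) (r : ℝ)
    {F : X → Rd d → ℝ≥0∞} (hF : Measurable (Function.uncurry F)) :
    Measurable fun x => weightedLpNorm p r (F x) :=
  measurable_eLpNorm_left (F := fun x ξ => weight r ξ * F x ξ)
    (((measurable_weight r).comp measurable_snd).mul hF) p

/-- Peetre's inequality for `ξ = η + (ξ - η)` moves the weight onto the translated variable, at the
cost of `⟨η⟩^{|r|}`. -/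
lemma weightedLpNorm_comp_sub_le (p : ℝ≥0∞) (r : ℝ) {F : Rd d → ℝ≥0∞} (hF : Measurable F)
    (η : Rd d) : weightedLpNorm p r (fun ξ => F (ξ - η)) ≤
      ENNReal.ofReal (2 ^ |r|) * weight |r| η * weightedLpNorm p r F := by
  have hmp := measurePreserving_sub_right (volume : Measure (Rd d)) η
  have h1 := eLpNorm_comp_measurePreserving (p := p) (g := fun ξ => weight r ξ * F ξ)
    (((measurable_weight r).mul hF).aestronglyMeasurable) hmp
  have hc : ENNReal.ofReal (2 ^ |r|) * weight |r| η ≠ ∞ :=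
    ENNReal.mul_ne_top ENNReal.ofReal_ne_top (weight_ne_top _ _)
  have := eLpNorm_le_nnreal_smul_eLpNorm_of_ae_le_mul' (μ := (volume : Measure (Rd d)))
    (f := fun ξ => weight r ξ * F (ξ - η)) (g := fun ξ => weight r (ξ - η) * F (ξ - η))
    (c := (ENNReal.ofReal (2 ^ |r|) * weight |r| η).toNNReal)
    (Eventually.of_forall fun ξ => by
      simp only [enorm_eq_self]
      rw [ENNReal.coe_toNNReal hc, ← mul_assoc]
      gcongr
      simpa using weight_add_le r η (ξ - η)) p
  rw [weightedLpNorm_eq, weightedLpNorm_eq, ← h1]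
  rw [ENNReal.smul_def, ENNReal.coe_toNNReal hc, smul_eq_mul] at this
  exact this

lemma weightedLpNorm_comp_neg (p : ℝ≥0∞) (r : ℝ) {F : Rd d → ℝ≥0∞} (hF : AEMeasurable F) :
    weightedLpNorm p r (fun ξ => F (-ξ)) = weightedLpNorm p r F := by
  have hmp := Measure.measurePreserving_neg (volume : Measure (Rd d))
  have h1 := eLpNorm_comp_measurePreserving (p := p) (g := fun ξ => weight r ξ * F ξ)
    (((measurable_weight r).aemeasurable.mul hF).aestronglyMeasurable) hmp
  rw [weightedLpNorm_eq, weightedLpNorm_eq, ← h1]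
  simp [Function.comp_def, weight_neg_arg]

/-- Convolution with a rapidly decaying kernel is bounded on weighted Lebesgue spaces. -/
lemma exists_weightedLpNorm_conv_weight_le {p : ℝ≥0∞} (hp : 1 ≤ p) (r : ℝ) {m : ℝ}
    (hm : d + |r| < m) : ∃ C : ℝ≥0, ∀ F : Rd d → ℝ≥0∞, Measurable F →
      weightedLpNorm p r (fun ξ => ∫⁻ η, weight (-m) (ξ - η) * F η) ≤ C * weightedLpNorm p r F := by
  -- Translation by `η` costs `⟨η⟩^{|r|}`; the condition `m > d + |r|` keeps the kernel integrable
  -- after this loss.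
  set K : ℝ≥0∞ := ∫⁻ η : Rd d, ENNReal.ofReal (2 ^ |r|) * weight (-(m - |r|)) η with hK
  have hKtop : K ≠ ∞ := by
    rw [hK, lintegral_const_mul' _ _ ENNReal.ofReal_ne_top]
    exact ENNReal.mul_ne_top ENNReal.ofReal_ne_top (lintegral_weight_neg_lt_top (by linarith)).ne
  refine ⟨K.toNNReal, fun F hF => ?_⟩
  rw [ENNReal.coe_toNNReal hKtop]
  have e : (fun ξ => ∫⁻ η, weight (-m) (ξ - η) * F η) =
      fun ξ => ∫⁻ η, weight (-m) η * F (ξ - η) := by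
    ext ξ
    rw [← lintegral_sub_left_eq_self _ ξ]
    simp
  rw [e]
  refine (weightedLpNorm_lintegral_le hp r (F := fun η ξ => weight (-m) η * F (ξ - η)) ?_).trans ?_
  · exact ((measurable_weight _).comp measurable_fst).mul
      (hF.comp (measurable_snd.sub measurable_fst))
  · rw [hK, ← lintegral_mul_const _ (by fun_prop)]
    refine lintegral_mono fun η => ?_
    have h1 := weightedLpNorm_const_mul_le p r (fun ξ => F (ξ - η)) (weight (-m) η).toNNReal
    rw [ENNReal.coe_toNNReal (weight_ne_top _ _)] at h1
    refine h1.trans ((mul_le_mul_right (weightedLpNorm_comp_sub_le p r hF η) _).trans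
      (le_of_eq ?_))
    rw [show -(m - |r|) = -m + |r| by ring, weight_add]
    ring

/-- `L^p_r ⊆ L^1_{-m}` for large `m`. -/
lemma exists_lintegral_weight_mul_le {p : ℝ≥0∞} (hp : 1 ≤ p) (r : ℝ) {m : ℝ}
    (hm : d + |r| < m) : ∃ C : ℝ≥0, ∀ F : Rd d → ℝ≥0∞, Measurable F →
      ∫⁻ ξ, weight (-m) ξ * F ξ ≤ C * weightedLpNorm p r F := by
  obtain ⟨C, hC⟩ := exists_weightedLpNorm_conv_weight_le (d := d) hp r hm
  have hp0 : p ≠ 0 := (zero_lt_one.trans_le hp).ne'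
  set S : Set (Rd d) := Metric.closedBall 0 1
  have hS : MeasurableSet S := Metric.isClosed_closedBall.measurableSet
  have hvol0 : (volume S) ≠ 0 :=
    (Metric.measure_closedBall_pos volume (0 : Rd d) one_pos).ne'
  have hvolt : (volume S) ≠ ∞ := measure_closedBall_lt_top.ne
  -- The `L^p` norm of the indicator of `S`. For `p = ∞` the exponent is `1 / 0 = 0`, which gives
  -- the correct value 1.
  obtain ⟨N, hN2⟩ : ∃ N, N = volume S ^ (1 / p.toReal) := ⟨_, rfl⟩
  have hN0 : N ≠ 0 := by
    rw [hN2]; exact (ENNReal.rpow_pos (pos_iff_ne_zero.2 hvol0) hvolt).ne'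
  have hNt : N ≠ ∞ := by
    rw [hN2]; exact ENNReal.rpow_ne_top_of_nonneg (by positivity) hvolt
  set c : ℝ≥0∞ := ENNReal.ofReal (2 ^ |m|) * ENNReal.ofReal (Real.sqrt 2 ^ (m + |r|))
  have hct : c ≠ ∞ := ENNReal.mul_ne_top ENNReal.ofReal_ne_top ENNReal.ofReal_ne_top
  refine ⟨(c * C / N).toNNReal, fun F hF => ?_⟩
  rw [ENNReal.coe_toNNReal (ENNReal.div_ne_top (ENNReal.mul_ne_top hct ENNReal.coe_ne_top) hN0)]
  set J := ∫⁻ ξ, weight (-m) ξ * F ξ with hJ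
  have hm0 : 0 < m := lt_of_le_of_lt (by positivity) hm
  -- In place of Hölder's inequality: on the unit ball, convolution with `⟨·⟩^{-m}` dominates a
  -- multiple of the number `J`, so its norm bound controls `J`. The factor `weight (-r)` cancels
  -- the weight in the norm.
  have key : ∀ ξ, J * S.indicator (weight (-r)) ξ ≤ c * ∫⁻ η, weight (-m) (ξ - η) * F η := by
    intro ξ
    by_cases hξ : ξ ∈ S
    · have hb : weight (m + |r|) ξ ≤ ENNReal.ofReal (Real.sqrt 2 ^ (m + |r|)) := by
        refine ENNReal.ofReal_le_ofReal (Real.rpow_le_rpow (japaneseBracket_pos ξ).le ?_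
          (by positivity))
        refine Real.sqrt_le_sqrt ?_
        have : ‖ξ‖ ≤ 1 := by simpa [S] using hξ
        nlinarith [norm_nonneg ξ]
      rw [Set.indicator_of_mem hξ, hJ, ← lintegral_mul_const' _ _ (weight_ne_top _ _),
        ← lintegral_const_mul' _ _ hct]
      refine lintegral_mono fun η => ?_
      have h1 := weight_add_le (-m) ξ (η - ξ)
      rw [add_sub_cancel, abs_neg, abs_of_pos hm0, weight_sub_comm] at h1
      calc weight (-m) η * F η * weight (-r) ξ
          ≤ (ENNReal.ofReal (2 ^ m) * weight m ξ * weight (-m) (ξ - η)) * F η * weight |r| ξ := by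
            gcongr
            exact weight_mono (neg_le_abs r) ξ
        _ = ENNReal.ofReal (2 ^ m) * weight (m + |r|) ξ * (weight (-m) (ξ - η) * F η) := by
            rw [weight_add]; ring
        _ ≤ _ := by
            simp only [c, abs_of_pos hm0]
            gcongr
    · simp [hξ]
  have hfin : J * N ≤ c * C * weightedLpNorm p r F := by
    have h1 : weightedLpNorm p r (fun ξ => J * S.indicator (weight (-r)) ξ) = J * N := by
      rw [hN2, ← enorm_eq_self J, ← eLpNorm_indicator_const' hS hvol0 hp0, weightedLpNorm_eq]
      congr 1
      ext x
      by_cases hx : x ∈ S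
      · simp only [hx, Set.indicator_of_mem, enorm_eq_self]
        rw [mul_left_comm, mul_comm (weight r x), weight_neg_mul, mul_one]
      · simp [hx]
    have h3 := weightedLpNorm_const_mul_le p r (fun ξ => ∫⁻ η, weight (-m) (ξ - η) * F η) c.toNNReal
    rw [ENNReal.coe_toNNReal hct] at h3
    rw [← h1, mul_assoc]
    exact (weightedLpNorm_mono key).trans (h3.trans (mul_le_mul_right (hC F hF) _))
  calc J ≤ c * C * weightedLpNorm p r F / N := by
        rw [ENNReal.le_div_iff_mul_le (Or.inl hN0) (Or.inl hNt)]; exact hfin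
    _ = _ := by rw [ENNReal.mul_div_right_comm]

end Weights

/-! ### Schwartz functions: seminorms, translations, products, characters -/

section Schwartz

variable {d : ℕ}

/-- The `m`-th of an increasing sequence of seminorms that defines the topology of `𝓢(ℝᵈ)`. -/
def supSeminorm (d m : ℕ) : Seminorm ℂ 𝓢(Rd d, ℂ) :=
  (Finset.Iic (m, m)).sup (schwartzSeminormFamily ℂ (Rd d) ℂ)

lemma one_add_pow_mul_le_supSeminorm {m k n : ℕ} (hk : k ≤ m) (hn : n ≤ m) (φ : 𝓢(Rd d, ℂ))
    (x : Rd d) : (1 + ‖x‖) ^ k * ‖iteratedFDeriv ℝ n φ x‖ ≤ 2 ^ m * supSeminorm d m φ :=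
  SchwartzMap.one_add_le_sup_seminorm_apply (𝕜 := ℂ) (m := (m, m)) hk hn φ x

lemma supSeminorm_le {m : ℕ} {φ : 𝓢(Rd d, ℂ)} {c : ℝ} (hc : 0 ≤ c)
    (h : ∀ k ≤ m, ∀ n ≤ m, ∀ x, ‖x‖ ^ k * ‖iteratedFDeriv ℝ n φ x‖ ≤ c) :
    supSeminorm d m φ ≤ c := by
  refine Seminorm.finset_sup_apply_le hc fun i hi => ?_
  have hi' : i.1 ≤ m ∧ i.2 ≤ m := by simpa [Prod.le_def] using hi
  exact SchwartzMap.seminorm_le_bound ℂ i.1 i.2 φ hc (h i.1 hi'.1 i.2 hi'.2)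

/-- Every finite set of seminorm indices lies in a square `Iic (m, m)`, so a single seminorm of the
increasing sequence suffices. -/
lemma exists_le_supSeminorm {q : Seminorm ℂ 𝓢(Rd d, ℂ)} (hq : Continuous q) :
    ∃ (m : ℕ) (C : ℝ≥0), ∀ φ, q φ ≤ C * supSeminorm d m φ := by
  obtain ⟨s, C, -, hs⟩ := Seminorm.bound_of_continuous (schwartz_withSeminorms ℂ (Rd d) ℂ) q hq
  obtain ⟨m, hm⟩ : ∃ m : ℕ, s ⊆ Finset.Iic (m, m) := by
    refine ⟨s.sup (fun i => max i.1 i.2), fun i hi => ?_⟩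
    have := Finset.le_sup (f := fun i : ℕ × ℕ => max i.1 i.2) hi
    simp only [Finset.mem_Iic, Prod.le_def]
    exact ⟨(le_max_left _ _).trans this, (le_max_right _ _).trans this⟩
  refine ⟨m, C, fun φ => (hs φ).trans ?_⟩
  have : s.sup (schwartzSeminormFamily ℂ (Rd d) ℂ) ≤ supSeminorm d m := Finset.sup_mono hm
  rw [smul_apply, NNReal.smul_def, smul_eq_mul]
  gcongr
  exact this φ

lemma continuous_supSeminorm (m : ℕ) : Continuous (supSeminorm d m) := by
  have h := (schwartz_withSeminorms ℂ (Rd d) ℂ).continuous_seminorm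
  refine Seminorm.continuous_of_le (q := ∑ i ∈ Finset.Iic (m, m), schwartzSeminormFamily ℂ (Rd d) ℂ i)
    ?_ (Seminorm.finset_sup_le_sum _ _)
  have e : ⇑(∑ i ∈ Finset.Iic (m, m), schwartzSeminormFamily ℂ (Rd d) ℂ i) =
      fun φ => ∑ i ∈ Finset.Iic (m, m), schwartzSeminormFamily ℂ (Rd d) ℂ i φ := by
    ext φ
    simp
  rw [e]
  exact continuous_finsetSum _ fun i _ => h i

lemma exists_norm_le_supSeminorm {E : Type*} [NormedAddCommGroup E] [NormedSpace ℂ E]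
    (f : 𝓢(Rd d, ℂ) →L[ℂ] E) : ∃ (m : ℕ) (C : ℝ≥0), ∀ φ, ‖f φ‖ ≤ C * supSeminorm d m φ :=
  exists_le_supSeminorm (q := (normSeminorm ℂ E).comp f.toLinearMap)
    (continuous_norm.comp f.continuous)

lemma exists_supSeminorm_apply_le (L : 𝓢(Rd d, ℂ) →L[ℂ] 𝓢(Rd d, ℂ)) (m : ℕ) :
    ∃ (m' : ℕ) (C : ℝ≥0), ∀ φ, supSeminorm d m (L φ) ≤ C * supSeminorm d m' φ :=
  exists_le_supSeminorm (q := (supSeminorm d m).comp L.toLinearMap)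
    ((continuous_supSeminorm m).comp L.continuous)

lemma tendsto_schwartz_of_supSeminorm {ι : Type*} {l : Filter ι} {u : ι → 𝓢(Rd d, ℂ)}
    {φ : 𝓢(Rd d, ℂ)} (h : ∀ m, Tendsto (fun i => supSeminorm d m (u i - φ)) l (𝓝 0)) :
    Tendsto u l (𝓝 φ) := by
  rw [(schwartz_withSeminorms ℂ (Rd d) ℂ).tendsto_nhds]
  intro i ε hε
  have hi : schwartzSeminormFamily ℂ (Rd d) ℂ i ≤ supSeminorm d (max i.1 i.2) :=
    Finset.le_sup (f := schwartzSeminormFamily ℂ (Rd d) ℂ) (by simp [Prod.le_def])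
  filter_upwards [(h (max i.1 i.2)).eventually_lt_const hε] with j hj
  exact (hi _).trans_lt hj

/-- The translate `y ↦ φ (y - x)`. -/
abbrev translate (x : Rd d) : 𝓢(Rd d, ℂ) →L[ℂ] 𝓢(Rd d, ℂ) := SchwartzMap.compSubConstCLM ℂ x

lemma iteratedFDeriv_translate (n : ℕ) (x : Rd d) (φ : 𝓢(Rd d, ℂ)) (y : Rd d) :
    iteratedFDeriv ℝ n (translate x φ) y = iteratedFDeriv ℝ n φ (y - x) := by
  have : ⇑(translate x φ) = fun z => φ (z - x) := by ext z; simp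
  rw [this, iteratedFDeriv_comp_sub]

lemma one_add_norm_add_le (x y : Rd d) : 1 + ‖x + y‖ ≤ (1 + ‖x‖) * (1 + ‖y‖) := by
  nlinarith [norm_add_le x y, mul_nonneg (norm_nonneg x) (norm_nonneg y)]

lemma supSeminorm_translate_le (m : ℕ) (x : Rd d) (φ : 𝓢(Rd d, ℂ)) :
    supSeminorm d m (translate x φ) ≤ 2 ^ m * (1 + ‖x‖) ^ m * supSeminorm d m φ := by
  refine supSeminorm_le (by positivity) fun k hk n hn y => ?_
  rw [iteratedFDeriv_translate]
  have h1 : ‖y‖ ^ k ≤ (1 + ‖x‖) ^ m * (1 + ‖y - x‖) ^ k := by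
    have h2 := one_add_norm_add_le x (y - x)
    rw [add_sub_cancel] at h2
    calc ‖y‖ ^ k ≤ ((1 + ‖x‖) * (1 + ‖y - x‖)) ^ k := by
          gcongr; linarith
      _ = (1 + ‖x‖) ^ k * (1 + ‖y - x‖) ^ k := mul_pow _ _ _
      _ ≤ _ := by gcongr; linarith [norm_nonneg x]
  calc _ ≤ (1 + ‖x‖) ^ m * ((1 + ‖y - x‖) ^ k * ‖iteratedFDeriv ℝ n φ (y - x)‖) := by
        rw [← mul_assoc]; gcongr
    _ ≤ (1 + ‖x‖) ^ m * (2 ^ m * supSeminorm d m φ) := by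
        exact mul_le_mul_of_nonneg_left (one_add_pow_mul_le_supSeminorm hk hn φ _) (by positivity)
    _ = _ := by ring

/-- Mean value inequality for the iterated derivatives on the ball of radius `‖h‖` around `y`; it
costs one derivative, and `‖h‖ ≤ 1` keeps the polynomial weights on that ball comparable. -/
lemma supSeminorm_translate_sub_le (m : ℕ) {h : Rd d} (hh : ‖h‖ ≤ 1) (φ : 𝓢(Rd d, ℂ)) :
    supSeminorm d m (translate h φ - φ) ≤ 2 ^ m * 2 ^ (m + 1) * supSeminorm d (m + 1) φ * ‖h‖ := by
  refine supSeminorm_le (by positivity) fun k hk n hn y => ?_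
  have e : iteratedFDeriv ℝ n (translate h φ - φ : 𝓢(Rd d, ℂ)) y =
      iteratedFDeriv ℝ n φ (y - h) - iteratedFDeriv ℝ n φ y := by
    have e1 : ⇑(translate h φ - φ) = ⇑(translate h φ) - ⇑φ := by ext z; simp
    rw [e1, iteratedFDeriv_sub_apply ((translate h φ).smooth n).contDiffAt (φ.smooth n).contDiffAt,
      iteratedFDeriv_translate]
  rw [e]
  have hdiff : Differentiable ℝ (iteratedFDeriv ℝ n φ) :=
    (φ.smooth (n + 1 : ℕ)).differentiable_iteratedFDeriv (by norm_cast; omega)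
  set S := supSeminorm d (m + 1) φ
  have hball : ∀ z ∈ Metric.closedBall y ‖h‖, ‖fderiv ℝ (iteratedFDeriv ℝ n φ) z‖ ≤
      2 ^ m * (2 ^ (m + 1) * S) / (1 + ‖y‖) ^ k := by
    intro z hz
    rw [norm_fderiv_iteratedFDeriv, le_div_iff₀ (by positivity), mul_comm]
    have h3 : 1 + ‖y‖ ≤ 2 * (1 + ‖z‖) := by
      have : ‖y - z‖ ≤ ‖h‖ := by simpa [dist_eq_norm, norm_sub_rev] using hz
      have := norm_le_insert' y z
      linarith [norm_nonneg z]
    calc (1 + ‖y‖) ^ k * ‖iteratedFDeriv ℝ (n + 1) φ z‖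
        ≤ (2 * (1 + ‖z‖)) ^ k * ‖iteratedFDeriv ℝ (n + 1) φ z‖ := by gcongr
      _ = 2 ^ k * ((1 + ‖z‖) ^ k * ‖iteratedFDeriv ℝ (n + 1) φ z‖) := by rw [mul_pow, mul_assoc]
      _ ≤ 2 ^ m * (2 ^ (m + 1) * S) :=
          mul_le_mul (pow_le_pow_right₀ (by norm_num) hk)
            (one_add_pow_mul_le_supSeminorm (by omega) (by omega) φ z) (by positivity)
            (by positivity)
  have hmv := Convex.norm_image_sub_le_of_norm_fderiv_le (𝕜 := ℝ) (s := Metric.closedBall y ‖h‖)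
    (x := y) (y := y - h) (fun z _ => hdiff z) hball (convex_closedBall _ _) (by simp) (by simp)
  rw [sub_sub_cancel_left, norm_neg] at hmv
  calc _ ≤ (1 + ‖y‖) ^ k * (2 ^ m * (2 ^ (m + 1) * S) / (1 + ‖y‖) ^ k * ‖h‖) := by
        gcongr; linarith
    _ = _ := by field_simp

/-- The difference splits as `T_x (φ - φ₀) + T_{x₀} (T_{x - x₀} φ₀ - φ₀)`, one term for each
variable. Joint continuity is what later makes the parameter integrals measurable. -/
lemma continuous_translate_prod :
    Continuous fun z : Rd d × 𝓢(Rd d, ℂ) => translate z.1 z.2 := by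
  rw [continuous_iff_continuousAt]
  rintro ⟨x₀, φ₀⟩
  refine tendsto_schwartz_of_supSeminorm fun m => ?_
  have e : ∀ z : Rd d × 𝓢(Rd d, ℂ), translate z.1 z.2 - translate x₀ φ₀ =
      translate z.1 (z.2 - φ₀) + translate x₀ (translate (z.1 - x₀) φ₀ - φ₀) := by
    intro z
    ext y
    simp
  have hlim : Tendsto (fun z : Rd d × 𝓢(Rd d, ℂ) =>
      2 ^ m * (1 + ‖z.1‖) ^ m * supSeminorm d m (z.2 - φ₀) + 2 ^ m * (1 + ‖x₀‖) ^ m *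
        (2 ^ m * 2 ^ (m + 1) * supSeminorm d (m + 1) φ₀ * ‖z.1 - x₀‖)) (𝓝 (x₀, φ₀)) (𝓝 0) := by
    have hc : Continuous (fun z : Rd d × 𝓢(Rd d, ℂ) =>
      2 ^ m * (1 + ‖z.1‖) ^ m * supSeminorm d m (z.2 - φ₀) + 2 ^ m * (1 + ‖x₀‖) ^ m *
        (2 ^ m * 2 ^ (m + 1) * supSeminorm d (m + 1) φ₀ * ‖z.1 - x₀‖)) := by
      have := (continuous_supSeminorm (d := d) m).comp
        ((continuous_snd (X := Rd d)).sub (continuous_const (y := φ₀)))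
      simp only [Function.comp_def] at this
      fun_prop
    have := hc.tendsto (x₀, φ₀)
    simpa using this
  refine tendsto_of_tendsto_of_tendsto_of_le_of_le' tendsto_const_nhds hlim
    (Eventually.of_forall fun z => apply_nonneg _ _) ?_
  have hnear : ∀ᶠ z : Rd d × 𝓢(Rd d, ℂ) in 𝓝 (x₀, φ₀), ‖z.1 - x₀‖ ≤ 1 := by
    have hc : Continuous fun z : Rd d × 𝓢(Rd d, ℂ) => ‖z.1 - x₀‖ := by fun_prop
    have := hc.tendsto (x₀, φ₀)
    simp only [sub_self, norm_zero] at this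
    exact this.eventually_le_const one_pos
  filter_upwards [hnear] with z hz
  rw [e]
  refine (map_add_le_add _ _ _).trans (add_le_add (supSeminorm_translate_le m z.1 _) ?_)
  refine (supSeminorm_translate_le m x₀ _).trans ?_
  gcongr
  exact supSeminorm_translate_sub_le m hz φ₀

/-- The pointwise product of two Schwartz functions. -/
def mulSchwartz (a : 𝓢(Rd d, ℂ)) : 𝓢(Rd d, ℂ) →L[ℂ] 𝓢(Rd d, ℂ) := SchwartzMap.smulLeftCLM ℂ a

@[simp] lemma mulSchwartz_apply (a b : 𝓢(Rd d, ℂ)) (y : Rd d) :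
    mulSchwartz a b y = a y * b y := by
  simp [mulSchwartz, SchwartzMap.smulLeftCLM_apply_apply a.hasTemperateGrowth]

/-- Off-diagonal decay, the source of all the spatial decay below: `1 + ‖x‖ ≤ (1 + ‖y‖)(1 + ‖y -
x‖)`, and each of the two Schwartz functions absorbs one of these factors. -/
lemma supSeminorm_mul_translate_le (m N : ℕ) (a b : 𝓢(Rd d, ℂ)) (x : Rd d) :
    (1 + ‖x‖) ^ N * supSeminorm d m (mulSchwartz a (translate x b)) ≤
      2 ^ m * (2 ^ (m + N) * supSeminorm d (m + N) a) * (2 ^ (m + N) * supSeminorm d (m + N) b) := by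
  have hx : 0 < (1 + ‖x‖) ^ N := by positivity
  rw [mul_comm, ← le_div_iff₀ hx]
  refine supSeminorm_le (by positivity) fun k hk n hn y => ?_
  rw [le_div_iff₀ hx]
  have e : ⇑(mulSchwartz a (translate x b)) = fun y => a y * translate x b y := by ext z; simp
  rw [e]
  have hsum := norm_iteratedFDeriv_mul_le (N := (n : ℕ∞)) (𝕜 := ℝ) (a.smooth n)
    ((translate x b).smooth n) y (n := n) le_rfl
  have hxy : (1 + ‖x‖) ^ N ≤ (1 + ‖y‖) ^ N * (1 + ‖y - x‖) ^ N := by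
    have h2 := one_add_norm_add_le y (-(y - x))
    rw [show y + -(y - x) = x by abel, norm_neg] at h2
    rw [← mul_pow]
    gcongr
  calc ‖y‖ ^ k * ‖iteratedFDeriv ℝ n (fun y => a y * translate x b y) y‖ * (1 + ‖x‖) ^ N
      ≤ (1 + ‖y‖) ^ k * (∑ i ∈ Finset.range (n + 1), (n.choose i : ℝ) * ‖iteratedFDeriv ℝ i a y‖ *
          ‖iteratedFDeriv ℝ (n - i) (translate x b) y‖) * ((1 + ‖y‖) ^ N * (1 + ‖y - x‖) ^ N) := by
        gcongr; linarith
    _ = ∑ i ∈ Finset.range (n + 1), (n.choose i : ℝ) *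
          (((1 + ‖y‖) ^ (k + N) * ‖iteratedFDeriv ℝ i a y‖) *
          ((1 + ‖y - x‖) ^ N * ‖iteratedFDeriv ℝ (n - i) b (y - x)‖)) := by
        rw [Finset.mul_sum, Finset.sum_mul]
        refine Finset.sum_congr rfl fun i _ => ?_
        rw [iteratedFDeriv_translate, pow_add]
        ring
    _ ≤ ∑ i ∈ Finset.range (n + 1), (n.choose i : ℝ) *
          ((2 ^ (m + N) * supSeminorm d (m + N) a) * (2 ^ (m + N) * supSeminorm d (m + N) b)) := by
        refine Finset.sum_le_sum fun i hi => ?_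
        have hi' : i ≤ n := Nat.lt_succ_iff.1 (Finset.mem_range.1 hi)
        refine mul_le_mul_of_nonneg_left (mul_le_mul ?_ ?_ (by positivity) (by positivity))
          (by positivity)
        · exact one_add_pow_mul_le_supSeminorm (by omega) (by omega) a y
        · exact one_add_pow_mul_le_supSeminorm (by omega) (by omega) b _
    _ = 2 ^ n * ((2 ^ (m + N) * supSeminorm d (m + N) a) *
          (2 ^ (m + N) * supSeminorm d (m + N) b)) := by
        rw [← Finset.sum_mul]
        congr 1
        exact_mod_cast Nat.sum_range_choose n
    _ ≤ _ := by
        refine (mul_le_mul_of_nonneg_right (pow_le_pow_right₀ one_le_two hn)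
          (by positivity)).trans_eq (by ring)

/-- Only `b` has to supply decay. This is meant for dilated cutoffs `a`, whose derivatives are
bounded uniformly although their weighted seminorms are not. -/
lemma supSeminorm_mul_le_of_bounded (m : ℕ) {K : ℝ} (hK : 0 ≤ K) (a b : 𝓢(Rd d, ℂ))
    (ha : ∀ n ≤ m, ∀ y, ‖iteratedFDeriv ℝ n a y‖ ≤ K) :
    supSeminorm d m (mulSchwartz a b) ≤ 2 ^ m * (K * (2 ^ m * supSeminorm d m b)) := by
  refine supSeminorm_le (by positivity) fun k hk n hn y => ?_
  have e : ⇑(mulSchwartz a b) = fun y => a y * b y := by ext z; simp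
  rw [e]
  have hsum := norm_iteratedFDeriv_mul_le (N := (n : ℕ∞)) (𝕜 := ℝ) (a.smooth n)
    (b.smooth n) y (n := n) le_rfl
  calc ‖y‖ ^ k * ‖iteratedFDeriv ℝ n (fun y => a y * b y) y‖
      ≤ (1 + ‖y‖) ^ k * (∑ i ∈ Finset.range (n + 1), (n.choose i : ℝ) * ‖iteratedFDeriv ℝ i a y‖ *
          ‖iteratedFDeriv ℝ (n - i) b y‖) := by
        gcongr; linarith
    _ = ∑ i ∈ Finset.range (n + 1), (n.choose i : ℝ) * (‖iteratedFDeriv ℝ i a y‖ *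
          ((1 + ‖y‖) ^ k * ‖iteratedFDeriv ℝ (n - i) b y‖)) := by
        rw [Finset.mul_sum]
        refine Finset.sum_congr rfl fun i _ => ?_
        ring
    _ ≤ ∑ i ∈ Finset.range (n + 1), (n.choose i : ℝ) * (K * (2 ^ m * supSeminorm d m b)) := by
        refine Finset.sum_le_sum fun i hi => ?_
        have hi' : i ≤ n := Nat.lt_succ_iff.1 (Finset.mem_range.1 hi)
        refine mul_le_mul_of_nonneg_left (mul_le_mul ?_ ?_ (by positivity) hK) (by positivity)
        · exact ha i (by omega) y
        · exact one_add_pow_mul_le_supSeminorm (by omega) (by omega) b _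
    _ = 2 ^ n * (K * (2 ^ m * supSeminorm d m b)) := by
        rw [← Finset.sum_mul]
        congr 1
        exact_mod_cast Nat.sum_range_choose n
    _ ≤ _ := by
        gcongr
        norm_num

end Schwartz

/-! ### Weak integrals of families of Schwartz functions -/

section WeakIntegral

variable {V : Type*} [NormedAddCommGroup V] [NormedSpace ℝ V]

lemma iteratedFDeriv_schwartz_add (n : ℕ) (φ ψ : 𝓢(V, ℂ)) (y : V) :
    iteratedFDeriv ℝ n (φ + ψ : 𝓢(V, ℂ)) y = iteratedFDeriv ℝ n φ y + iteratedFDeriv ℝ n ψ y := by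
  have : ⇑(φ + ψ) = ⇑φ + ⇑ψ := rfl
  rw [this, iteratedFDeriv_add_apply (φ.smooth n).contDiffAt (ψ.smooth n).contDiffAt]

lemma iteratedFDeriv_schwartz_smul (n : ℕ) (a : ℂ) (φ : 𝓢(V, ℂ)) (y : V) :
    iteratedFDeriv ℝ n (a • φ : 𝓢(V, ℂ)) y = a • iteratedFDeriv ℝ n φ y := by
  have : ⇑(a • φ) = a • ⇑φ := rfl
  rw [this, iteratedFDeriv_const_smul_apply (φ.smooth n).contDiffAt]

lemma norm_iteratedFDeriv_apply_le (n : ℕ) (φ : 𝓢(V, ℂ)) (y : V) (v : Fin n → V) :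
    ‖iteratedFDeriv ℝ n φ y v‖ ≤ SchwartzMap.seminorm ℂ 0 n φ * ∏ i, ‖v i‖ :=
  (ContinuousMultilinearMap.le_opNorm _ v).trans (mul_le_mul_of_nonneg_right
    (SchwartzMap.norm_iteratedFDeriv_le_seminorm ℂ φ n y) (by positivity))

/-- The functional `φ ↦ D^n φ(y) v` on the Schwartz space. -/
def derivEvalCLM {n : ℕ} (y : V) (v : Fin n → V) : 𝓢(V, ℂ) →L[ℂ] ℂ :=
  SchwartzMap.mkCLMtoNormedSpace (σ := RingHom.id ℂ) (fun φ => iteratedFDeriv ℝ n φ y v)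
    (fun φ ψ => by rw [iteratedFDeriv_schwartz_add]; rfl)
    (fun a φ => by rw [iteratedFDeriv_schwartz_smul]; rfl)
    ⟨{(0, n)}, ∏ i, ‖v i‖, by positivity, fun φ => by
      rw [Finset.sup_singleton, mul_comm]
      exact norm_iteratedFDeriv_apply_le n φ y v⟩

lemma hasDerivAt_iteratedFDeriv_apply (n : ℕ) (φ : 𝓢(V, ℂ)) (y : V) (v : Fin (n + 1) → V) (t : ℝ) :
    HasDerivAt (fun t : ℝ => iteratedFDeriv ℝ n φ (y + t • v 0) (Fin.tail v))
      (iteratedFDeriv ℝ (n + 1) φ (y + t • v 0) v) t := by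
  have h1 : HasFDerivAt (iteratedFDeriv ℝ n φ) (fderiv ℝ (iteratedFDeriv ℝ n φ) (y + t • v 0))
      (y + t • v 0) := ((φ.smooth (n + 1 : ℕ)).differentiable_iteratedFDeriv (m := n)
        (by norm_cast; omega) _).hasFDerivAt
  have h2 : HasDerivAt (fun t : ℝ => y + t • v 0) (v 0) t := by
    simpa using ((hasDerivAt_id t).smul_const (v 0)).const_add y
  rw [iteratedFDeriv_succ_apply_left]
  exact (h1.continuousMultilinear_apply_const (Fin.tail v)).comp_hasDerivAt t h2

variable {X : Type*} [TopologicalSpace X] [MeasurableSpace X] {μ : Measure X}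

/-- A continuous family of Schwartz functions that is dominated in every seminorm. -/
structure IsDominated (μ : Measure X) (Φ : X → 𝓢(V, ℂ)) : Prop where
  continuous : Continuous Φ
  dominated : ∀ k n, ∃ g : X → ℝ, Integrable g μ ∧ ∀ x, SchwartzMap.seminorm ℂ k n (Φ x) ≤ g x

variable [OpensMeasurableSpace X] [SecondCountableTopology X]

theorem IsDominated.integrable_apply {E : Type*} [NormedAddCommGroup E] [NormedSpace ℂ E]
    {Φ : X → 𝓢(V, ℂ)} (hΦ : IsDominated μ Φ) (T : 𝓢(V, ℂ) →L[ℂ] E) :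
    Integrable (fun x => T (Φ x)) μ := by
  obtain ⟨s, C, -, hT⟩ := Seminorm.bound_of_continuous (schwartz_withSeminorms ℂ V ℂ)
    ((normSeminorm ℂ E).comp T.toLinearMap) (continuous_norm.comp T.continuous)
  choose g hg hgle using hΦ.dominated
  have hsum : Integrable (fun x => ∑ i ∈ s, g i.1 i.2 x) μ :=
    integrable_finsetSum _ fun i _ => hg i.1 i.2
  refine (hsum.const_mul C).mono' (T.continuous.comp hΦ.continuous).aestronglyMeasurable
    (Eventually.of_forall fun x => (hT _).trans ?_)
  rw [smul_apply, NNReal.smul_def, smul_eq_mul]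
  refine mul_le_mul_of_nonneg_left ?_ C.2
  have hnn : ∀ i : ℕ × ℕ, 0 ≤ g i.1 i.2 x := fun i => (apply_nonneg _ _).trans (hgle i.1 i.2 x)
  exact Seminorm.finset_sup_apply_le (Finset.sum_nonneg fun i _ => hnn i) fun i hi =>
    (hgle i.1 i.2 x).trans (Finset.single_le_sum (f := fun i => g i.1 i.2 x) (fun i _ => hnn i) hi)

/-- Differentiation under the integral sign, one order at a time, along the line through `y` in
direction `v 0`. -/
lemma IsDominated.integral_iteratedFDeriv {Φ : X → 𝓢(V, ℂ)} (hΦ : IsDominated μ Φ)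
    {φ : 𝓢(V, ℂ)} (hφ : ∀ y, φ y = ∫ x, Φ x y ∂μ) (n : ℕ) (y : V) (v : Fin n → V) :
    iteratedFDeriv ℝ n φ y v = ∫ x, iteratedFDeriv ℝ n (Φ x) y v ∂μ := by
  induction n generalizing y with
  | zero => simpa using hφ y
  | succ n ih =>
    obtain ⟨g, hg, hgle⟩ := hΦ.dominated 0 (n + 1)
    have h1 := hasDerivAt_iteratedFDeriv_apply n φ y v 0
    have h2 := (hasDerivAt_integral_of_dominated_loc_of_deriv_le (μ := μ) (𝕜 := ℝ) (x₀ := (0 : ℝ))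
      (F := fun t x => iteratedFDeriv ℝ n (Φ x) (y + t • v 0) (Fin.tail v))
      (F' := fun t x => iteratedFDeriv ℝ (n + 1) (Φ x) (y + t • v 0) v) (s := Set.univ)
      (bound := fun x => g x * ∏ i, ‖v i‖) univ_mem
      (Eventually.of_forall fun t =>
        (hΦ.integrable_apply (derivEvalCLM (y + t • v 0) (Fin.tail v))).aestronglyMeasurable)
      (hΦ.integrable_apply (derivEvalCLM (y + (0 : ℝ) • v 0) (Fin.tail v)))
      (hΦ.integrable_apply (derivEvalCLM (y + (0 : ℝ) • v 0) v)).aestronglyMeasurable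
      (Eventually.of_forall fun x t _ => (norm_iteratedFDeriv_apply_le (n + 1) (Φ x) _ v).trans
        (mul_le_mul_of_nonneg_right (hgle x) (by positivity)))
      (hg.mul_const _)
      (Eventually.of_forall fun x t _ => hasDerivAt_iteratedFDeriv_apply n (Φ x) y v t)).2
    have h3 : (fun t : ℝ => iteratedFDeriv ℝ n φ (y + t • v 0) (Fin.tail v)) =
        fun t : ℝ => ∫ x, iteratedFDeriv ℝ n (Φ x) (y + t • v 0) (Fin.tail v) ∂μ :=
      funext fun t => ih _ _
    rw [h3] at h1
    simpa using h1.unique h2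

variable (V) in
/-- The points at which weighted derivatives of order in `s` are evaluated. -/
abbrev DerivIndex (s : Finset (ℕ × ℕ)) : Type _ := (i : s) × (V × (Fin i.1.2 → V))

/-- The normalized values `‖y‖^k D^n φ(y) v / ∏ ‖v_i‖`. -/
def derivValue {s : Finset (ℕ × ℕ)} (φ : 𝓢(V, ℂ)) (j : DerivIndex V s) : ℂ :=
  ((‖j.2.1‖ ^ j.1.1.1 / ∏ i, ‖j.2.2 i‖ : ℝ) : ℂ) * iteratedFDeriv ℝ j.1.1.2 φ j.2.1 j.2.2

lemma norm_derivValue_le {s : Finset (ℕ × ℕ)} (φ : 𝓢(V, ℂ)) (j : DerivIndex V s) :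
    ‖derivValue φ j‖ ≤ SchwartzMap.seminorm ℂ j.1.1.1 j.1.1.2 φ := by
  rw [derivValue, norm_mul, Complex.norm_real, Real.norm_of_nonneg (by positivity), div_mul_eq_mul_div]
  refine div_le_of_le_mul₀ (by positivity) (apply_nonneg _ _) ?_
  calc _ ≤ ‖j.2.1‖ ^ j.1.1.1 * (‖iteratedFDeriv ℝ j.1.1.2 φ j.2.1‖ * ∏ i, ‖j.2.2 i‖) :=
        mul_le_mul_of_nonneg_left (ContinuousMultilinearMap.le_opNorm _ _) (by positivity)
    _ ≤ _ := by
        rw [← mul_assoc]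
        exact mul_le_mul_of_nonneg_right (SchwartzMap.le_seminorm ℂ _ _ φ _) (by positivity)

lemma seminorm_le_of_derivValue {s : Finset (ℕ × ℕ)} (φ : 𝓢(V, ℂ)) {c : ℝ} (hc : 0 ≤ c)
    (h : ∀ j : DerivIndex V s, ‖derivValue φ j‖ ≤ c) (i : s) :
    SchwartzMap.seminorm ℂ i.1.1 i.1.2 φ ≤ c := by
  refine SchwartzMap.seminorm_le_bound ℂ _ _ φ hc fun y => ?_
  have h1 : ‖((‖y‖ ^ i.1.1 : ℝ) : ℂ) • iteratedFDeriv ℝ i.1.2 φ y‖ ≤ c := by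
    refine ContinuousMultilinearMap.opNorm_le_bound hc fun v => ?_
    -- When the product vanishes, division by zero makes `derivValue` zero and `h` says nothing;
    -- there the multilinear map itself vanishes on `v`.
    rcases eq_or_ne (∏ i, ‖v i‖) 0 with h0 | h0
    · have := ContinuousMultilinearMap.le_opNorm
        (((‖y‖ ^ i.1.1 : ℝ) : ℂ) • iteratedFDeriv ℝ i.1.2 φ y) v
      rw [h0] at this ⊢
      simpa using this
    · have h2 := h ⟨i, y, v⟩
      have hpos : 0 < ∏ i, ‖v i‖ := lt_of_le_of_ne (by positivity) h0.symm
      rw [derivValue, norm_mul, Complex.norm_real, Real.norm_of_nonneg (by positivity),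
        div_mul_eq_mul_div, div_le_iff₀ hpos] at h2
      simpa using h2
  rw [norm_smul, Complex.norm_real, Real.norm_of_nonneg (by positivity)] at h1
  exact h1

/-- The embedding of the Schwartz space into bounded functions by the values `derivValue`. -/
def derivValueCLM (s : Finset (ℕ × ℕ)) : 𝓢(V, ℂ) →L[ℂ] lp (fun _ : DerivIndex V s => ℂ) ∞ :=
  SchwartzMap.mkCLMtoNormedSpace (σ := RingHom.id ℂ)
    (fun φ => ⟨fun j => derivValue φ j, memℓp_infty ⟨s.sup (schwartzSeminormFamily ℂ V ℂ) φ, by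
      rintro _ ⟨j, rfl⟩
      exact (norm_derivValue_le φ j).trans
        (Finset.le_sup (f := schwartzSeminormFamily ℂ V ℂ) j.1.2 φ)⟩⟩)
    (fun φ ψ => by
      ext j
      simp only [derivValue, iteratedFDeriv_schwartz_add]
      exact mul_add _ _ _)
    (fun a φ => by
      ext j
      simp only [derivValue, iteratedFDeriv_schwartz_smul]
      exact mul_left_comm _ _ _)
    ⟨s, 1, zero_le_one, fun φ => by
      rw [one_mul]
      refine lp.norm_le_of_forall_le (apply_nonneg _ _) fun j => ?_
      exact (norm_derivValue_le φ j).trans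
        (Finset.le_sup (f := schwartzSeminormFamily ℂ V ℂ) j.1.2 φ)⟩

/-- A continuous functional is bounded by finitely many seminorms, hence by the norm of the
embedding into bounded functions; it therefore descends to the range, and Hahn–Banach extends it.
This transfers weak integrals from the Schwartz space to a Banach space, where Bochner integrals are
available. -/
lemma exists_dual_factorization (T : 𝓢(V, ℂ) →L[ℂ] ℂ) : ∃ (s : Finset (ℕ × ℕ))
    (L : lp (fun _ : DerivIndex V s => ℂ) ∞ →L[ℂ] ℂ), ∀ φ, T φ = L (derivValueCLM s φ) := by
  obtain ⟨s₀, C, -, hT⟩ := Seminorm.bound_of_continuous (schwartz_withSeminorms ℂ V ℂ)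
    ((normSeminorm ℂ ℂ).comp T.toLinearMap) (continuous_norm.comp T.continuous)
  -- The index `(0, 0)`, the sup norm, makes the embedding injective.
  set s : Finset (ℕ × ℕ) := insert (0, 0) s₀
  set J := derivValueCLM (V := V) s
  have hJ' : ∀ (i : ℕ × ℕ) (_ : i ∈ s) φ, SchwartzMap.seminorm ℂ i.1 i.2 φ ≤ ‖J φ‖ :=
    fun i hi φ => seminorm_le_of_derivValue φ (norm_nonneg _)
      (fun j => lp.norm_apply_le_norm ENNReal.top_ne_zero (J φ) j) ⟨i, hi⟩
  have hJ : ∀ φ, ‖T φ‖ ≤ C * ‖J φ‖ := by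
    intro φ
    refine (hT φ).trans ?_
    rw [smul_apply, NNReal.smul_def, smul_eq_mul]
    refine mul_le_mul_of_nonneg_left ?_ C.2
    exact Seminorm.finset_sup_apply_le (norm_nonneg _) fun i hi =>
      hJ' i (Finset.mem_insert_of_mem hi) φ
  have hinj : Function.Injective J := by
    rw [injective_iff_map_eq_zero]
    intro φ h0
    ext y
    have h1 := SchwartzMap.norm_le_seminorm ℂ φ y
    have h2 := hJ' (0, 0) (Finset.mem_insert_self _ _) φ
    rw [h0, norm_zero] at h2
    simpa using h1.trans h2
  let e := LinearEquiv.ofInjective J.toLinearMap hinj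
  let f : StrongDual ℂ (LinearMap.range J.toLinearMap) :=
    LinearMap.mkContinuous (T.toLinearMap ∘ₗ e.symm.toLinearMap) C (fun v => by
      obtain ⟨φ, rfl⟩ := e.surjective v
      simp only [LinearMap.coe_comp, LinearEquiv.coe_coe, Function.comp_apply,
        LinearEquiv.symm_apply_apply]
      exact hJ φ)
  obtain ⟨L, hL, -⟩ := exists_extension_norm_eq _ f
  refine ⟨s, L, fun φ => ?_⟩
  have h := hL (e φ)
  have h1 : f (e φ) = T φ := by simp [f]
  rw [h1] at h
  exact h.symm

/-- Continuous linear maps on the Schwartz space commute with weak integrals. -/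
theorem IsDominated.apply_eq_integral {E : Type*} [NormedAddCommGroup E] [NormedSpace ℂ E]
    [CompleteSpace E] {Φ : X → 𝓢(V, ℂ)} (hΦ : IsDominated μ Φ) {φ : 𝓢(V, ℂ)}
    (hφ : ∀ y, φ y = ∫ x, Φ x y ∂μ) (T : 𝓢(V, ℂ) →L[ℂ] E) :
    T φ = ∫ x, T (Φ x) ∂μ := by
  rw [SeparatingDual.eq_iff_forall_dual_eq (R := ℂ)]
  intro ℓ
  rw [← ℓ.integral_comp_comm (hΦ.integrable_apply T)]
  -- It remains to identify a Bochner integral of bounded functions, which can be done coordinate by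
  -- coordinate, that is, derivative by derivative.
  obtain ⟨s, L, hL⟩ := exists_dual_factorization (ℓ.comp T)
  simp only [ContinuousLinearMap.comp_apply] at hL
  simp only [hL]
  have hInt := hΦ.integrable_apply (derivValueCLM s)
  rw [L.integral_comp_comm hInt]
  congr 1
  ext j
  have h1 := (lp.evalCLM ℂ (fun _ : DerivIndex V s => ℂ) ∞ j).integral_comp_comm hInt
  refine Eq.trans ?_ h1
  change derivValue φ j = ∫ x, derivValue (Φ x) j ∂μ
  simp only [derivValue]
  rw [integral_const_mul, hΦ.integral_iteratedFDeriv hφ]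

end WeakIntegral

/-! ### Characters and the Fourier transform -/

section Characters

variable {d : ℕ}

lemma norm_character (ξ y : Rd d) : ‖character ξ y‖ = 1 := by
  rw [character, show (-(2 * Real.pi * Complex.I * ((inner ℝ y ξ : ℝ) : ℂ))) =
    ((-(2 * Real.pi * inner ℝ y ξ) : ℝ) : ℂ) * Complex.I by push_cast; ring,
    Complex.norm_exp_ofReal_mul_I]

lemma character_add_left (ξ η y : Rd d) :
    character (ξ + η) y = character ξ y * character η y := by
  rw [character, character, character, ← Complex.exp_add, inner_add_right]
  congr 1
  push_cast
  ring

lemma character_comm (ξ y : Rd d) : character ξ y = character y ξ := by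
  rw [character, character, real_inner_comm]

lemma character_add_right (ξ y z : Rd d) :
    character ξ (y + z) = character ξ y * character ξ z := by
  rw [character_comm, character_add_left, character_comm y, character_comm z]

lemma fourier_schwartz_apply (φ : 𝓢(Rd d, ℂ)) (ξ : Rd d) :
    (𝓕 φ) ξ = ∫ y, character ξ y * φ y := by
  rw [SchwartzMap.fourier_coe, Real.fourier_eq']
  refine integral_congr_ae (Eventually.of_forall fun y => ?_)
  simp only [character, smul_eq_mul]
  congr 2
  push_cast
  ring

lemma fourierInv_schwartz_apply (φ : 𝓢(Rd d, ℂ)) (ξ : Rd d) :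
    (𝓕⁻ φ) ξ = ∫ y, character (-ξ) y * φ y := by
  rw [SchwartzMap.fourierInv_coe, Real.fourierInv_eq']
  refine integral_congr_ae (Eventually.of_forall fun y => ?_)
  simp only [character, smul_eq_mul, inner_neg_right]
  congr 2
  push_cast
  ring

lemma fourierInv_schwartz_eq_neg (φ : 𝓢(Rd d, ℂ)) (ξ : Rd d) : (𝓕⁻ φ) ξ = (𝓕 φ) (-ξ) := by
  rw [fourierInv_schwartz_apply, fourier_schwartz_apply]

lemma fourier_translate (ξ : Rd d) (φ : 𝓢(Rd d, ℂ)) :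
    𝓕 (translate ξ φ) = charMul ξ (𝓕 φ) := by
  ext y
  rw [charMul_apply, fourier_schwartz_apply, fourier_schwartz_apply, ← integral_const_mul,
    ← integral_add_right_eq_self _ ξ]
  refine integral_congr_ae (Eventually.of_forall fun z => ?_)
  simp only [SchwartzMap.compSubConstCLM_apply, add_sub_cancel_right]
  rw [character_add_right, character_comm y ξ]
  ring

/-- Modulation is translation conjugated by the Fourier transform, so its joint continuity and its
polynomial growth in `ξ` are inherited from translations. -/
lemma charMul_eq_fourier_translate (ξ : Rd d) (φ : 𝓢(Rd d, ℂ)) :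
    charMul ξ φ = 𝓕 (translate ξ (𝓕⁻ φ)) := by
  rw [fourier_translate, FourierTransform.fourier_fourierInv_eq]

lemma fourierInv_charMul (ξ : Rd d) (φ : 𝓢(Rd d, ℂ)) :
    𝓕⁻ (charMul ξ φ) = translate ξ (𝓕⁻ φ) := by
  rw [charMul_eq_fourier_translate, FourierTransform.fourierInv_fourier_eq]

lemma norm_fourierInv_translate (x : Rd d) (φ : 𝓢(Rd d, ℂ)) (η : Rd d) :
    ‖(𝓕⁻ (translate x φ)) η‖ = ‖(𝓕⁻ φ) η‖ := by
  rw [fourierInv_schwartz_eq_neg, fourierInv_schwartz_eq_neg, fourier_translate, charMul_apply,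
    norm_mul, norm_character, one_mul]

lemma continuous_fourier_schwartz : Continuous fun φ : 𝓢(Rd d, ℂ) => 𝓕 φ :=
  (FourierTransform.fourierCLM ℂ 𝓢(Rd d, ℂ)).continuous

lemma continuous_fourierInv_schwartz : Continuous fun φ : 𝓢(Rd d, ℂ) => 𝓕⁻ φ :=
  (FourierTransform.fourierCLE ℂ 𝓢(Rd d, ℂ)).symm.continuous

lemma continuous_charMul_prod :
    Continuous fun z : Rd d × 𝓢(Rd d, ℂ) => charMul z.1 z.2 := by
  simp only [charMul_eq_fourier_translate]
  exact continuous_fourier_schwartz.comp (continuous_translate_prod.comp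
    (continuous_fst.prodMk (continuous_fourierInv_schwartz.comp continuous_snd)))

lemma continuous_charMul {X : Type*} [TopologicalSpace X] {u : X → Rd d} {v : X → 𝓢(Rd d, ℂ)}
    (hu : Continuous u) (hv : Continuous v) : Continuous fun x => charMul (u x) (v x) := by
  have huv : Continuous fun x => (u x, v x) := hu.prodMk hv
  have h := Continuous.comp (g := fun z : Rd d × 𝓢(Rd d, ℂ) => charMul z.1 z.2)
    continuous_charMul_prod huv
  simpa only [Function.comp_def] using h

lemma continuous_translate {X : Type*} [TopologicalSpace X] {u : X → Rd d} {v : X → 𝓢(Rd d, ℂ)}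
    (hu : Continuous u) (hv : Continuous v) : Continuous fun x => translate (u x) (v x) :=
  continuous_translate_prod.comp (hu.prodMk hv)

lemma exists_supSeminorm_fourier_le (m : ℕ) : ∃ (m' : ℕ) (C : ℝ≥0), ∀ φ : 𝓢(Rd d, ℂ),
    supSeminorm d m (𝓕 φ) ≤ C * supSeminorm d m' φ :=
  exists_supSeminorm_apply_le (FourierTransform.fourierCLM ℂ 𝓢(Rd d, ℂ)) m

lemma exists_supSeminorm_fourierInv_le (m : ℕ) : ∃ (m' : ℕ) (C : ℝ≥0), ∀ φ : 𝓢(Rd d, ℂ),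
    supSeminorm d m (𝓕⁻ φ) ≤ C * supSeminorm d m' φ :=
  exists_supSeminorm_apply_le
    ((FourierTransform.fourierCLE ℂ 𝓢(Rd d, ℂ)).symm : 𝓢(Rd d, ℂ) →L[ℂ] 𝓢(Rd d, ℂ)) m

lemma exists_supSeminorm_charMul_le (m : ℕ) : ∃ (k m' : ℕ) (C : ℝ≥0), ∀ (ξ : Rd d)
    (φ : 𝓢(Rd d, ℂ)), supSeminorm d m (charMul ξ φ) ≤ C * (1 + ‖ξ‖) ^ k * supSeminorm d m' φ := by
  obtain ⟨m₁, C₁, h₁⟩ := exists_supSeminorm_fourier_le (d := d) m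
  obtain ⟨m₂, C₂, h₂⟩ := exists_supSeminorm_fourierInv_le (d := d) m₁
  refine ⟨m₁, m₂, C₁ * 2 ^ m₁ * C₂, fun ξ φ => ?_⟩
  rw [charMul_eq_fourier_translate]
  refine (h₁ _).trans ?_
  calc (C₁ : ℝ) * supSeminorm d m₁ (translate ξ (𝓕⁻ φ))
      ≤ C₁ * (2 ^ m₁ * (1 + ‖ξ‖) ^ m₁ * (C₂ * supSeminorm d m₂ φ)) := by
        refine mul_le_mul_of_nonneg_left ((supSeminorm_translate_le m₁ ξ _).trans ?_) C₁.2
        exact mul_le_mul_of_nonneg_left (h₂ φ) (by positivity)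
    _ = _ := by push_cast; ring

lemma one_add_pow_mul_norm_le (N : ℕ) (φ : 𝓢(Rd d, ℂ)) (x : Rd d) :
    (1 + ‖x‖) ^ N * ‖φ x‖ ≤ 2 ^ N * supSeminorm d N φ := by
  simpa using one_add_pow_mul_le_supSeminorm (le_refl N) (Nat.zero_le N) φ x

lemma ofReal_le_mul_weight {a c : ℝ} {x : Rd d} {N : ℕ} (h : (1 + ‖x‖) ^ N * a ≤ c) :
    ENNReal.ofReal a ≤ ENNReal.ofReal c * weight (-(N : ℝ)) x := by
  have hb := japaneseBracket_pos x
  rcases le_or_gt a 0 with ha | ha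
  · rw [ENNReal.ofReal_of_nonpos ha]; exact zero_le
  have hc : 0 ≤ c := le_trans (by positivity) h
  rw [weight, ← ENNReal.ofReal_mul hc]
  refine ENNReal.ofReal_le_ofReal ?_
  rw [Real.rpow_neg hb.le, Real.rpow_natCast, ← div_eq_mul_inv, le_div_iff₀ (by positivity), mul_comm]
  refine le_trans ?_ h
  have : japaneseBracket x ≤ 1 + ‖x‖ := by
    rw [japaneseBracket]
    refine Real.sqrt_le_iff.2 ⟨by positivity, ?_⟩
    nlinarith [norm_nonneg x]
  gcongr

lemma enorm_apply_le (N : ℕ) (φ : 𝓢(Rd d, ℂ)) (x : Rd d) :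
    ‖φ x‖ₑ ≤ ENNReal.ofReal (2 ^ N * supSeminorm d N φ) * weight (-(N : ℝ)) x := by
  rw [← ofReal_norm]
  exact ofReal_le_mul_weight (one_add_pow_mul_norm_le N φ x)

lemma integrable_of_one_add_pow_mul_le {E : Type*} [NormedAddCommGroup E] {g : Rd d → E}
    (hg : AEStronglyMeasurable g) {c : ℝ} (h : ∀ x, (1 + ‖x‖) ^ (d + 1) * ‖g x‖ ≤ c) :
    Integrable g := by
  have h0 := (integrable_one_add_norm (E := Rd d) (μ := volume) (r := d + 1) (by simp)).const_mul c
  refine h0.mono' hg (Eventually.of_forall fun x => ?_)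
  have hx : 0 < 1 + ‖x‖ := by positivity
  rw [Real.rpow_neg hx.le, ← div_eq_mul_inv, le_div_iff₀ (by positivity), mul_comm]
  have := h x
  rwa [← Real.rpow_natCast, Nat.cast_add, Nat.cast_one] at this

lemma isDominated_of_decay {Φ : Rd d → 𝓢(Rd d, ℂ)} (hΦ : Continuous Φ)
    (h : ∀ m, ∃ c : ℝ, ∀ x, (1 + ‖x‖) ^ (d + 1) * supSeminorm d m (Φ x) ≤ c) :
    IsDominated volume Φ := by
  refine ⟨hΦ, fun k n => ?_⟩
  obtain ⟨c, hc⟩ := h (max k n)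
  refine ⟨fun x => supSeminorm d (max k n) (Φ x), ?_, fun x => ?_⟩
  · refine integrable_of_one_add_pow_mul_le
      ((continuous_supSeminorm _).comp hΦ).aestronglyMeasurable (c := c) fun x => ?_
    rw [Real.norm_of_nonneg (apply_nonneg _ _)]
    exact hc x
  · exact (Finset.le_sup (f := schwartzSeminormFamily ℂ (Rd d) ℂ) (b := (k, n))
      (by simp [Prod.le_def])) (Φ x)

lemma isDominated_smul_charMul (a φ : 𝓢(Rd d, ℂ)) :
    IsDominated volume fun ξ => φ ξ • charMul ξ a := by
  have hc := continuous_charMul (d := d) continuous_id (continuous_const (y := a))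
  refine isDominated_of_decay (φ.continuous.smul hc) fun m => ?_
  obtain ⟨k, m', C, h⟩ := exists_supSeminorm_charMul_le (d := d) m
  refine ⟨(2 ^ (d + 1 + k) * supSeminorm d (d + 1 + k) φ) * (C * supSeminorm d m' a), fun ξ => ?_⟩
  rw [map_smul_eq_mul]
  calc (1 + ‖ξ‖) ^ (d + 1) * (‖φ ξ‖ * supSeminorm d m (charMul ξ a))
      ≤ (1 + ‖ξ‖) ^ (d + 1) * (‖φ ξ‖ * (C * (1 + ‖ξ‖) ^ k * supSeminorm d m' a)) := by
        gcongr; exact h ξ a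
    _ = ((1 + ‖ξ‖) ^ (d + 1 + k) * ‖φ ξ‖) * (C * supSeminorm d m' a) := by
        rw [pow_add _ (d + 1) k]; ring
    _ ≤ _ := mul_le_mul_of_nonneg_right (one_add_pow_mul_norm_le _ φ ξ) (by positivity)

lemma isDominated_mul_translate (φ G : 𝓢(Rd d, ℂ)) :
    IsDominated volume fun x => mulSchwartz φ (translate x G) :=
  isDominated_of_decay ((mulSchwartz φ).continuous.comp
    (continuous_translate continuous_id continuous_const)) fun m =>
      ⟨_, fun x => supSeminorm_mul_translate_le m (d + 1) φ G x⟩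

variable {E : Type*} [NormedAddCommGroup E] [NormedSpace ℂ E] (f : 𝓢(Rd d, ℂ) →L[ℂ] E)

lemma integrable_smul_apply_charMul (a φ : 𝓢(Rd d, ℂ)) :
    Integrable fun ξ => φ ξ • f (charMul ξ a) := by
  simpa using (isDominated_smul_charMul a φ).integrable_apply f

lemma continuous_apply_charMul (a : 𝓢(Rd d, ℂ)) : Continuous fun ξ => f (charMul ξ a) :=
  f.continuous.comp (continuous_charMul continuous_id continuous_const)

lemma exists_norm_apply_charMul_le (a : 𝓢(Rd d, ℂ)) :
    ∃ (k : ℕ) (C : ℝ≥0), ∀ ξ, ‖f (charMul ξ a)‖ ≤ C * (1 + ‖ξ‖) ^ k := by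
  obtain ⟨m, C, h⟩ := exists_norm_le_supSeminorm f
  obtain ⟨k, m', C', h'⟩ := exists_supSeminorm_charMul_le (d := d) m
  refine ⟨k, C * C' * (supSeminorm d m' a).toNNReal, fun ξ => (h _).trans ?_⟩
  calc (C : ℝ) * supSeminorm d m (charMul ξ a)
      ≤ C * (C' * (1 + ‖ξ‖) ^ k * supSeminorm d m' a) :=
        mul_le_mul_of_nonneg_left (h' ξ a) C.2
    _ = _ := by
        push_cast
        rw [Real.coe_toNNReal _ (apply_nonneg _ _)]
        ring

/-- The `𝓕L^p_r`-norm of the product `a f`. -/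
def localNorm (p : ℝ≥0∞) (r : ℝ) (f : 𝓢(Rd d, ℂ) →L[ℂ] E) (a : 𝓢(Rd d, ℂ)) : ℝ≥0∞ :=
  weightedLpNorm p r (fun ξ => ‖f (charMul ξ a)‖ₑ)

variable [CompleteSpace E]

/-- The Fourier transform of the truncated distribution `a f` is `ξ ↦ f (a e^{-2πi ξ·})`. -/
theorem apply_mul_fourier (a φ : 𝓢(Rd d, ℂ)) :
    f (mulSchwartz a (𝓕 φ)) = ∫ ξ, φ ξ • f (charMul ξ a) := by
  rw [(isDominated_smul_charMul a φ).apply_eq_integral (φ := mulSchwartz a (𝓕 φ)) _ f]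
  · simp
  intro y
  rw [mulSchwartz_apply, fourier_schwartz_apply, ← integral_const_mul]
  refine integral_congr_ae (Eventually.of_forall fun ξ => ?_)
  simp only [smul_apply, charMul_apply, smul_eq_mul]
  rw [character_comm]
  ring

/-- Decomposition of a distribution along the translates of a function with integral one. -/
theorem apply_eq_integral_translate {G : 𝓢(Rd d, ℂ)} (hG : ∫ x, G x = 1) (φ : 𝓢(Rd d, ℂ)) :
    f φ = ∫ x, f (mulSchwartz φ (translate x G)) := by
  refine (isDominated_mul_translate φ G).apply_eq_integral (fun y => ?_) f
  simp only [mulSchwartz_apply, SchwartzMap.compSubConstCLM_apply]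
  rw [integral_const_mul, integral_sub_left_eq_self, hG, mul_one]

/-- On the Fourier side, multiplication by `κ` is an integral of shifts against `𝓕⁻ κ`. -/
lemma apply_charMul_mul (a κ : 𝓢(Rd d, ℂ)) (ξ : Rd d) :
    f (charMul ξ (mulSchwartz a κ)) = ∫ η, (𝓕⁻ κ) η • f (charMul (ξ + η) a) := by
  have h := apply_mul_fourier f (charMul ξ a) (𝓕⁻ κ)
  rw [FourierTransform.fourier_fourierInv_eq] at h
  have e : charMul ξ (mulSchwartz a κ) = mulSchwartz (charMul ξ a) κ := by
    ext y; simp [charMul_apply, mul_assoc]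
  rw [e, h]
  congr 1
  ext η
  congr 2
  ext y
  simp only [charMul_apply, character_add_left]
  ring

/-- Multiplication by translates of a Schwartz function is uniformly bounded on `𝓕L^p_r`. -/
lemma exists_localNorm_mul_translate_le (d : ℕ) {p : ℝ≥0∞} (hp : 1 ≤ p) (r : ℝ) :
    ∃ (m : ℕ) (C : ℝ≥0), ∀ (f : 𝓢(Rd d, ℂ) →L[ℂ] E) (a κ : 𝓢(Rd d, ℂ)) (x : Rd d),
      localNorm p r f (mulSchwartz a (translate x κ)) ≤
        C * ENNReal.ofReal (supSeminorm d m κ) * localNorm p r f a := by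
  obtain ⟨N, hN⟩ := exists_nat_gt (d + |r|)
  obtain ⟨C, hC⟩ := exists_weightedLpNorm_conv_weight_le (d := d) hp r hN
  obtain ⟨m, C', hm⟩ := exists_supSeminorm_fourierInv_le (d := d) N
  refine ⟨m, 2 ^ N * C' * C, fun f a κ x => ?_⟩
  set F : Rd d → ℝ≥0∞ := fun ξ => ‖f (charMul ξ a)‖ₑ
  have hF : Measurable F := (continuous_apply_charMul f a).enorm.measurable
  set c : ℝ≥0 := 2 ^ N * C' * (supSeminorm d m κ).toNNReal with hc
  -- Translating `κ` changes `𝓕⁻ κ` only by a phase; this gives uniformity in `x`.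
  have hker : ∀ η, ‖(𝓕⁻ (translate x κ)) η‖ₑ ≤ c * weight (-(N : ℝ)) η := by
    intro η
    rw [← ofReal_norm, norm_fourierInv_translate, ofReal_norm]
    refine (enorm_apply_le N _ η).trans ?_
    gcongr
    rw [hc, ← ENNReal.ofReal_coe_nnreal]
    refine ENNReal.ofReal_le_ofReal ?_
    push_cast
    rw [Real.coe_toNNReal _ (apply_nonneg _ _), mul_assoc]
    exact mul_le_mul_of_nonneg_left (hm κ) (by positivity)
  have hpt : ∀ ξ, ‖f (charMul ξ (mulSchwartz a (translate x κ)))‖ₑ ≤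
      c * ∫⁻ η, weight (-(N : ℝ)) (ξ - η) * F η := by
    intro ξ
    rw [apply_charMul_mul]
    refine (enorm_integral_le_lintegral_enorm _).trans ?_
    rw [← lintegral_const_mul' _ _ ENNReal.coe_ne_top,
      ← lintegral_add_left_eq_self (fun η => c * (weight (-(N : ℝ)) (ξ - η) * F η)) ξ]
    refine lintegral_mono fun η => ?_
    rw [enorm_smul]
    simp only [sub_add_cancel_left, weight_neg_arg, F]
    rw [← mul_assoc]
    gcongr
    exact hker η
  refine (weightedLpNorm_mono hpt).trans ((weightedLpNorm_const_mul_le _ _ _ c).trans ?_)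
  refine (mul_le_mul_right (hC F hF) _).trans (le_of_eq ?_)
  rw [hc, ENNReal.ofReal, localNorm]
  push_cast
  ring

end Characters

/-! ### Change of window and truncation -/

section Windows

variable {d : ℕ} {E : Type*} [NormedAddCommGroup E] [NormedSpace ℂ E]

lemma continuous_apply_charMul_prod {X : Type*} [TopologicalSpace X] (f : 𝓢(Rd d, ℂ) →L[ℂ] E)
    {a : X → 𝓢(Rd d, ℂ)} (ha : Continuous a) :
    Continuous (Function.uncurry fun (x : X) (ξ : Rd d) => f (charMul ξ (a x))) :=
  f.continuous.comp (continuous_charMul continuous_snd (ha.comp continuous_fst))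

lemma measurable_enorm_apply_charMul (f : 𝓢(Rd d, ℂ) →L[ℂ] E) {a : Rd d → 𝓢(Rd d, ℂ)}
    (ha : Continuous a) :
    Measurable (Function.uncurry fun (x ξ : Rd d) => ‖f (charMul ξ (a x))‖ₑ) :=
  (continuous_apply_charMul_prod f ha).enorm.measurable

lemma measurable_localNorm (p : ℝ≥0∞) (r : ℝ) (f : 𝓢(Rd d, ℂ) →L[ℂ] E)
    {a : Rd d → 𝓢(Rd d, ℂ)} (ha : Continuous a) : Measurable fun x => localNorm p r f (a x) :=
  measurable_weightedLpNorm_left p r (measurable_enorm_apply_charMul f ha)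

lemma continuous_translate_left (g : 𝓢(Rd d, ℂ)) : Continuous fun x => translate x g :=
  continuous_translate continuous_id continuous_const

lemma conjSchwartz_translate (x : Rd d) (g : 𝓢(Rd d, ℂ)) :
    conjSchwartz (translate x g) = translate x (conjSchwartz g) := by
  ext y
  simp [conjSchwartz_apply]

lemma amalgamNorm_eq (p q : ℝ≥0∞) (r s : ℝ) (g : 𝓢(Rd d, ℂ)) (f : 𝓢'(Rd d, E)) :
    amalgamNorm p q r s g f = weightedLpNorm q s fun x =>
      localNorm p r (f : 𝓢(Rd d, ℂ) →L[ℂ] E) (translate x (conjSchwartz g)) := by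
  simp only [← conjSchwartz_translate]
  rfl

lemma conjSchwartz_ne_zero {g : 𝓢(Rd d, ℂ)} (hg : g ≠ 0) : conjSchwartz g ≠ 0 := by
  contrapose hg
  ext y
  have : conjSchwartz g y = 0 := by rw [hg]; rfl
  simpa [conjSchwartz_apply] using this

/-- The normalized conjugate of `g` works. Through the product `g γ`, any non-zero window yields a
continuous partition of unity. -/
lemma exists_integral_mul_eq_one {g : 𝓢(Rd d, ℂ)} (hg : g ≠ 0) :
    ∃ γ : 𝓢(Rd d, ℂ), ∫ x, mulSchwartz g γ x = 1 := by
  have h0 : ∫ x, mulSchwartz g (conjSchwartz g) x ≠ 0 := by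
    intro h
    have e : ∀ x, mulSchwartz g (conjSchwartz g) x = ((‖g x‖ ^ 2 : ℝ) : ℂ) := by
      intro x
      rw [mulSchwartz_apply, conjSchwartz_apply, Complex.mul_conj, Complex.normSq_eq_norm_sq]
    simp only [e, integral_complex_ofReal] at h
    rw [Complex.ofReal_eq_zero] at h
    have hInt : Integrable fun x => ‖g x‖ ^ 2 := by
      have := (mulSchwartz g (conjSchwartz g)).integrable (μ := volume)
      have h2 : ⇑(mulSchwartz g (conjSchwartz g)) = fun x => ((‖g x‖ ^ 2 : ℝ) : ℂ) := funext e
      rw [h2] at this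
      exact this.re.congr (Eventually.of_forall fun x => RCLike.ofReal_re (K := ℂ) _)
    rw [integral_eq_zero_iff_of_nonneg (fun x => by positivity) hInt] at h
    have hc : Continuous fun x => ‖g x‖ ^ 2 := by fun_prop
    have h3 := (Continuous.ae_eq_iff_eq volume hc continuous_const).1 h
    refine hg ?_
    ext x
    have h4 : ‖g x‖ ^ 2 = 0 := congrFun h3 x
    simpa using h4
  refine ⟨(∫ x, mulSchwartz g (conjSchwartz g) x)⁻¹ • conjSchwartz g, ?_⟩
  rw [map_smul]
  simp only [smul_apply, smul_eq_mul]
  rw [integral_const_mul, inv_mul_cancel₀ h0]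

variable [CompleteSpace E]

/-- All non-zero windows define equivalent norms. -/
theorem exists_windowChange_le {p q : ℝ≥0∞} (hp : 1 ≤ p) (hq : 1 ≤ q) (r s : ℝ)
    {g : 𝓢(Rd d, ℂ)} (hg : g ≠ 0) (g' : 𝓢(Rd d, ℂ)) :
    ∃ C : ℝ≥0, ∀ f : 𝓢(Rd d, ℂ) →L[ℂ] E,
      weightedLpNorm q s (fun z => localNorm p r f (translate z g')) ≤
        C * weightedLpNorm q s (fun x => localNorm p r f (translate x g)) := by
  obtain ⟨γ, hγ⟩ := exists_integral_mul_eq_one hg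
  obtain ⟨m, C, hC⟩ := exists_localNorm_mul_translate_le (E := E) d hp r
  obtain ⟨N, hN⟩ := exists_nat_gt (d + |s|)
  obtain ⟨K, hK⟩ := exists_weightedLpNorm_conv_weight_le (d := d) hq s hN
  set c : ℝ := 2 ^ m * (2 ^ (m + N) * supSeminorm d (m + N) γ) *
    (2 ^ (m + N) * supSeminorm d (m + N) g')
  refine ⟨C * c.toNNReal * K, fun f => ?_⟩
  set A : Rd d → ℝ≥0∞ := fun x => localNorm p r f (translate x g)
  have hA : Measurable A := measurable_localNorm p r f (continuous_translate_left g)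
  -- Regrouping: the piece of the new window at `z` near `x` is the old window at `x` times a
  -- translate by `x` of `γ · T_{z - x} g'`, whose seminorms decay in `z - x`.
  have e : ∀ x z ξ : Rd d, mulSchwartz (charMul ξ (translate z g')) (translate x (mulSchwartz g γ)) =
      charMul ξ (mulSchwartz (translate x g) (translate x (mulSchwartz γ (translate (z - x) g')))) := by
    intro x z ξ
    ext y
    simp only [mulSchwartz_apply, charMul_apply, SchwartzMap.compSubConstCLM_apply,
      sub_sub_sub_cancel_right]
    ring
  have hpt : ∀ z, localNorm p r f (translate z g') ≤
      (C * c.toNNReal : ℝ≥0) * ∫⁻ x, weight (-(N : ℝ)) (z - x) * A x := by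
    intro z
    set a : Rd d → 𝓢(Rd d, ℂ) := fun x =>
      mulSchwartz (translate x g) (translate x (mulSchwartz γ (translate (z - x) g'))) with ha
    have hac : Continuous a := by
      have : a = fun x => mulSchwartz (translate z g') (translate x (mulSchwartz g γ)) := by
        funext x
        ext y
        simp only [ha, mulSchwartz_apply, SchwartzMap.compSubConstCLM_apply,
          sub_sub_sub_cancel_right]
        ring
      rw [this]
      exact (mulSchwartz _).continuous.comp (continuous_translate_left _)
    calc localNorm p r f (translate z g')
        ≤ weightedLpNorm p r (fun ξ => ∫⁻ x, ‖f (charMul ξ (a x))‖ₑ) := by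
          refine weightedLpNorm_mono fun ξ => ?_
          rw [apply_eq_integral_translate f hγ]
          refine (enorm_integral_le_lintegral_enorm _).trans (le_of_eq ?_)
          simp only [e, ha]
      _ ≤ ∫⁻ x, localNorm p r f (a x) :=
          weightedLpNorm_lintegral_le hp r (measurable_enorm_apply_charMul f hac)
      _ ≤ ∫⁻ x, (C * c.toNNReal : ℝ≥0) * (weight (-(N : ℝ)) (z - x) * A x) := by
          refine lintegral_mono fun x => (hC f _ _ x).trans ?_
          have := ofReal_le_mul_weight (supSeminorm_mul_translate_le m N γ g' (z - x))
          calc _ ≤ C * (ENNReal.ofReal c * weight (-(N : ℝ)) (z - x)) *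
                localNorm p r f (translate x g) := by gcongr
            _ = _ := by
                rw [ENNReal.ofReal]
                push_cast
                ring
      _ = _ := lintegral_const_mul' _ _ ENNReal.coe_ne_top
  refine (weightedLpNorm_mono hpt).trans ((weightedLpNorm_const_mul_le _ _ _ _).trans ?_)
  refine (mul_le_mul_right (hK A hA) _).trans (le_of_eq ?_)
  push_cast
  ring

/-- Each derivative of a dilate produces a factor `(n + 1)⁻¹ ≤ 1`, so the bound does not depend on
`n`. -/
lemma norm_iteratedFDeriv_dilate_le (χ : 𝓢(Rd d, ℂ)) (n k m : ℕ) (hk : k ≤ m) (y : Rd d) :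
    ‖iteratedFDeriv ℝ k (dilate χ n) y‖ ≤ 2 ^ m * supSeminorm d m χ := by
  have e : ⇑(dilate χ n) = fun x => χ ((n + 1 : ℝ)⁻¹ • x) := by ext; rfl
  rw [e, iteratedFDeriv_comp_const_smul _ (χ.smooth k)]
  have h1 := one_add_pow_mul_le_supSeminorm (Nat.zero_le m) hk χ ((n + 1 : ℝ)⁻¹ • y)
  rw [pow_zero, one_mul] at h1
  refine le_trans ?_ h1
  rw [norm_smul]
  refine mul_le_of_le_one_left (norm_nonneg _) ?_
  rw [norm_pow, Real.norm_of_nonneg (by positivity)]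
  exact pow_le_one₀ (by positivity) (inv_le_one_of_one_le₀ (by linarith [n.cast_nonneg (α := ℝ)]))

/-- Truncation is uniformly bounded on localized pieces. -/
lemma exists_localNorm_truncation_le {p : ℝ≥0∞} (hp : 1 ≤ p) (r : ℝ) {ψ ρ : 𝓢(Rd d, ℂ)}
    (hρ : ∀ y, ψ y ≠ 0 → ρ y = 1) (χ : 𝓢(Rd d, ℂ)) :
    ∃ C : ℝ≥0, ∀ (f : 𝓢(Rd d, ℂ) →L[ℂ] E) (n : ℕ) (x : Rd d),
      localNorm p r f (mulSchwartz (translate x ψ) (dilate χ n)) ≤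
        C * localNorm p r f (translate x ψ) := by
  obtain ⟨m, C, hC⟩ := exists_localNorm_mul_translate_le (E := E) d hp r
  set c : ℝ := 2 ^ m * ((2 ^ m * supSeminorm d m χ) * (2 ^ m * supSeminorm d m ρ))
  refine ⟨C * c.toNNReal, fun f n x => ?_⟩
  -- Since `ρ = 1` wherever `ψ ≠ 0`, it can be inserted for free; it turns the cutoff into a
  -- translate by `x` of a Schwartz function with seminorms bounded uniformly in `n` and `x`.
  have e : mulSchwartz (translate x ψ) (dilate χ n) =
      mulSchwartz (translate x ψ) (translate x (mulSchwartz (translate (-x) (dilate χ n)) ρ)) := by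
    ext y
    simp only [mulSchwartz_apply, SchwartzMap.compSubConstCLM_apply, sub_neg_eq_add, sub_add_cancel]
    by_cases h : ψ (y - x) = 0
    · simp [h]
    · rw [hρ _ h, mul_one]
  rw [e]
  refine (hC f _ _ x).trans ?_
  rw [ENNReal.coe_mul]
  gcongr
  rw [ENNReal.ofReal]
  gcongr
  refine supSeminorm_mul_le_of_bounded m (by positivity) _ _ fun k hk y => ?_
  rw [iteratedFDeriv_translate]
  exact norm_iteratedFDeriv_dilate_le χ n k m hk _

lemma exists_bump (d : ℕ) {R : ℝ} (hR : 0 < R) : ∃ ρ : 𝓢(Rd d, ℂ), (∀ y, ‖y‖ ≤ R → ρ y = 1) ∧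
    (∀ y, R + 1 ≤ ‖y‖ → ρ y = 0) ∧ HasCompactSupport ρ ∧ ∫ y, ρ y ≠ 0 := by
  let b : ContDiffBump (0 : Rd d) := ⟨R, R + 1, hR, by linarith⟩
  have hs : HasCompactSupport fun y => (b y : ℂ) :=
    b.hasCompactSupport.comp_left (g := fun t : ℝ => (t : ℂ)) Complex.ofReal_zero
  have hc : ContDiff ℝ ((⊤ : ℕ∞) : WithTop ℕ∞) fun y => (b y : ℂ) :=
    Complex.ofRealCLM.contDiff.comp (f := fun y => b y) b.contDiff
  refine ⟨hs.toSchwartzMap hc, ?_, ?_, hs, ?_⟩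
  · intro y hy
    have : b y = 1 := b.one_of_mem_closedBall (by simpa using hy)
    simp [this]
  · intro y hy
    have : b y = 0 := b.zero_of_le_dist (by simpa using hy)
    simp [this]
  · have : ∫ y, (b y : ℂ) = ((∫ y, b y : ℝ) : ℂ) := integral_complex_ofReal
    simp only [HasCompactSupport.toSchwartzMap_toFun]
    rw [this]
    exact_mod_cast (b.integral_pos (μ := volume)).ne'

end Windows

/-! ### The local estimate -/

section Local

variable {d : ℕ}

/-- The reflection `y ↦ φ (-y)` of a Schwartz function. -/
def reflect (φ : 𝓢(Rd d, ℂ)) : 𝓢(Rd d, ℂ) := 𝓕⁻ (𝓕⁻ φ)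

lemma reflect_apply (φ : 𝓢(Rd d, ℂ)) (y : Rd d) : reflect φ y = φ (-y) := by
  rw [reflect, fourierInv_schwartz_eq_neg, FourierTransform.fourier_fourierInv_eq]

lemma fourier_reflect (φ : 𝓢(Rd d, ℂ)) : 𝓕 (reflect φ) = 𝓕⁻ φ := by
  rw [reflect, FourierTransform.fourier_fourierInv_eq]

lemma IsCutoff.eventually_dilate_eq_one {χ : 𝓢(Rd d, ℂ)} (hχ : IsCutoff χ) (R : ℝ) :
    ∀ᶠ n : ℕ in atTop, ∀ y : Rd d, ‖y‖ ≤ R → dilate χ n y = 1 := by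
  obtain ⟨ε, hε, h⟩ := Metric.eventually_nhds_iff.1 hχ.2
  obtain ⟨n₀, hn₀⟩ := exists_nat_gt (|R| / ε)
  filter_upwards [eventually_ge_atTop n₀] with n hn y hy
  rw [dilate_apply]
  refine h ?_
  have hn1 : (0 : ℝ) < n + 1 := by positivity
  rw [dist_zero_right, norm_smul, Real.norm_of_nonneg (by positivity), inv_mul_lt_iff₀ hn1]
  rw [div_lt_iff₀ hε] at hn₀
  have : (n₀ : ℝ) ≤ n := by exact_mod_cast hn
  nlinarith [le_abs_self R]

lemma exists_isCutoff (d : ℕ) : ∃ χ : 𝓢(Rd d, ℂ), IsCutoff χ := by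
  obtain ⟨ρ, h1, -, hs, -⟩ := exists_bump d one_pos
  refine ⟨ρ, hs, ?_⟩
  filter_upwards [Metric.closedBall_mem_nhds (0 : Rd d) one_pos] with y hy
  exact h1 y (by simpa using hy)

section Distribution

variable {E : Type*} [NormedAddCommGroup E] [NormedSpace ℂ E]

/-- The distribution `a f`. -/
def mulDistribution (a : 𝓢(Rd d, ℂ)) (f : 𝓢(Rd d, ℂ) →L[ℂ] E) : 𝓢'(Rd d, E) :=
  (f.comp (mulSchwartz a) : 𝓢(Rd d, ℂ) →L[ℂ] E)

lemma mulDistribution_apply (a : 𝓢(Rd d, ℂ)) (f : 𝓢(Rd d, ℂ) →L[ℂ] E) (φ : 𝓢(Rd d, ℂ)) :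
    mulDistribution a f φ = f (mulSchwartz a φ) := rfl

lemma fourierOfTruncation_mulDistribution {a χ : 𝓢(Rd d, ℂ)} (f : 𝓢(Rd d, ℂ) →L[ℂ] E)
    (h : ∀ y, a y ≠ 0 → χ y = 1) (ξ : Rd d) :
    fourierOfTruncation χ (mulDistribution a f) ξ = f (charMul ξ a) := by
  rw [fourierOfTruncation, mulDistribution_apply]
  congr 1
  ext y
  rw [mulSchwartz_apply, charMul_apply, charMul_apply]
  by_cases hy : a y = 0
  · simp [hy]
  · rw [h y hy]; ring

lemma IsGivenBy.locallyIntegrable {T : 𝓢'(Rd d, E)} {u : Rd d → E} (h : IsGivenBy T u) :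
    LocallyIntegrable u volume := by
  rw [locallyIntegrable_iff]
  intro K hK
  obtain ⟨R, hR0, hR⟩ := hK.isBounded.exists_pos_norm_le
  obtain ⟨ρ, hρ, -⟩ := exists_bump d hR0
  have h1 := ((h.2 ρ).1).integrableOn (s := K)
  refine h1.congr_fun (fun y hy => ?_) hK.measurableSet
  simp [hρ y (hR y hy)]

variable [CompleteSpace E]

/-- The sign in `-ξ` appears because the Fourier–Lebesgue norm uses `𝓕⁻`; it does not affect norms,
as the weights are even. -/
lemma isGivenBy_fourierInv_mulDistribution (a : 𝓢(Rd d, ℂ)) (f : 𝓢(Rd d, ℂ) →L[ℂ] E) :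
    IsGivenBy (𝓕⁻ (mulDistribution a f)) fun ξ => f (charMul (-ξ) a) := by
  refine ⟨((continuous_apply_charMul f a).comp continuous_neg).aestronglyMeasurable, fun φ => ?_⟩
  have h := integrable_smul_apply_charMul f a (reflect φ)
  simp only [reflect_apply] at h
  constructor
  · simpa using h.comp_neg
  · rw [TemperedDistribution.fourierInv_apply, mulDistribution_apply, ← fourier_reflect,
      apply_mul_fourier, ← integral_neg_eq_self]
    simp [reflect_apply]

lemma fourierLebesgueNorm_mulDistribution_le (p : ℝ≥0∞) (r : ℝ) (a : 𝓢(Rd d, ℂ))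
    (f : 𝓢(Rd d, ℂ) →L[ℂ] E) :
    fourierLebesgueNorm p r (mulDistribution a f) ≤ localNorm p r f a := by
  refine (iInf₂_le _ (isGivenBy_fourierInv_mulDistribution a f)).trans (le_of_eq ?_)
  exact weightedLpNorm_comp_neg p r (F := fun ξ => ‖f (charMul ξ a)‖ₑ)
    (continuous_apply_charMul f a).enorm.measurable.aemeasurable

/-- Tested against compactly supported smooth functions. It shows that the infimum in
`fourierLebesgueNorm` runs over a single almost-everywhere class, so a lower bound needs only one
representative. -/
lemma IsGivenBy.ae_eq {T : 𝓢'(Rd d, E)} {u v : Rd d → E} (hu : IsGivenBy T u)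
    (hv : IsGivenBy T v) : u =ᵐ[volume] v := by
  refine ae_eq_of_integral_contDiff_smul_eq hu.locallyIntegrable hv.locallyIntegrable
    fun g hg hgs => ?_
  have hs : HasCompactSupport fun y => (g y : ℂ) :=
    hgs.comp_left (g := fun t : ℝ => (t : ℂ)) Complex.ofReal_zero
  have hc : ContDiff ℝ ((⊤ : ℕ∞) : WithTop ℕ∞) fun y => (g y : ℂ) :=
    Complex.ofRealCLM.contDiff.comp (f := g) hg
  have h1 := (hu.2 (hs.toSchwartzMap hc)).2
  have h2 := (hv.2 (hs.toSchwartzMap hc)).2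
  simpa using h1.symm.trans h2

end Distribution

variable {E₁ E₂ E₃ : Type*}
    [NormedAddCommGroup E₁] [NormedSpace ℂ E₁] [NormedAddCommGroup E₂] [NormedSpace ℂ E₂]
    [NormedAddCommGroup E₃] [NormedSpace ℂ E₃] (B : E₁ →L[ℂ] E₂ →L[ℂ] E₃)
    (f₁ : 𝓢(Rd d, ℂ) →L[ℂ] E₁) (f₂ : 𝓢(Rd d, ℂ) →L[ℂ] E₂)

/-- The Fourier transform of the convolution of `a f₁` and `b f₂`. -/
def prodSymbol (a b : 𝓢(Rd d, ℂ)) (ξ : Rd d) : E₃ := B (f₁ (charMul ξ a)) (f₂ (charMul ξ b))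

lemma continuous_prodSymbol (a b : 𝓢(Rd d, ℂ)) : Continuous (prodSymbol B f₁ f₂ a b) :=
  (B.continuous.comp (continuous_apply_charMul f₁ a)).clm_apply (continuous_apply_charMul f₂ b)

lemma exists_norm_prodSymbol_le (a b : 𝓢(Rd d, ℂ)) :
    ∃ (k : ℕ) (C : ℝ≥0), ∀ ξ, ‖prodSymbol B f₁ f₂ a b ξ‖ ≤ C * (1 + ‖ξ‖) ^ k := by
  obtain ⟨k₁, C₁, h₁⟩ := exists_norm_apply_charMul_le f₁ a
  obtain ⟨k₂, C₂, h₂⟩ := exists_norm_apply_charMul_le f₂ b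
  refine ⟨k₁ + k₂, ‖B‖₊ * C₁ * C₂, fun ξ => (B.le_opNorm₂ _ _).trans ?_⟩
  calc _ ≤ ‖B‖ * (C₁ * (1 + ‖ξ‖) ^ k₁) * (C₂ * (1 + ‖ξ‖) ^ k₂) := by
        gcongr
        · exact h₁ ξ
        · exact h₂ ξ
    _ = _ := by push_cast; rw [pow_add]; ring

lemma integrable_schwartz_mul_pow (φ : 𝓢(Rd d, ℂ)) (k : ℕ) :
    Integrable fun ξ => ‖φ ξ‖ * (1 + ‖ξ‖) ^ k := by
  refine integrable_of_one_add_pow_mul_le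
    (c := 2 ^ (d + 1 + k) * supSeminorm d (d + 1 + k) φ) ?_ fun ξ => ?_
  · have : Continuous fun ξ => ‖φ ξ‖ * (1 + ‖ξ‖) ^ k := by fun_prop
    exact this.aestronglyMeasurable
  · rw [Real.norm_of_nonneg (by positivity)]
    refine le_of_eq_of_le ?_ (one_add_pow_mul_norm_le (d + 1 + k) φ ξ)
    rw [pow_add _ (d + 1) k]
    ring

lemma integrable_smul_of_le_pow {φ : 𝓢(Rd d, ℂ)} {u : Rd d → E₃} (hu : Continuous u) {k : ℕ}
    {C : ℝ} (h : ∀ ξ, ‖u ξ‖ ≤ C * (1 + ‖ξ‖) ^ k) : Integrable fun ξ => φ ξ • u ξ := by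
  refine ((integrable_schwartz_mul_pow φ k).const_mul C).mono'
    (φ.continuous.smul hu).aestronglyMeasurable (Eventually.of_forall fun ξ => ?_)
  rw [norm_smul]
  calc _ ≤ ‖φ ξ‖ * (C * (1 + ‖ξ‖) ^ k) := mul_le_mul_of_nonneg_left (h ξ) (norm_nonneg _)
    _ = _ := by ring

lemma integrable_smul_prodSymbol (a b φ : 𝓢(Rd d, ℂ)) :
    Integrable fun ξ => φ ξ • prodSymbol B f₁ f₂ a b ξ := by
  obtain ⟨k, C, h⟩ := exists_norm_prodSymbol_le B f₁ f₂ a b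
  exact integrable_smul_of_le_pow (continuous_prodSymbol B f₁ f₂ a b) h

variable [CompleteSpace E₁] [CompleteSpace E₂] [CompleteSpace E₃]

/-- The estimate for compactly supported pieces that `FourierLebesgueConvEmbeds` contains. -/
theorem FourierLebesgueConvEmbeds.exists_prodSymbol_le {p₁ p₂ p₃ : ℝ≥0∞} {r₁ r₂ r₃ : ℝ}
    {B : E₁ →L[ℂ] E₂ →L[ℂ] E₃} (hloc : FourierLebesgueConvEmbeds d B p₁ p₂ p₃ r₁ r₂ r₃) :
    ∃ C : ℝ≥0, ∀ (f₁ : 𝓢(Rd d, ℂ) →L[ℂ] E₁) (f₂ : 𝓢(Rd d, ℂ) →L[ℂ] E₂) (a b : 𝓢(Rd d, ℂ)) (R : ℝ),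
      (∀ y, R < ‖y‖ → a y = 0) → (∀ y, R < ‖y‖ → b y = 0) →
      localNorm p₁ r₁ f₁ a < ∞ → localNorm p₂ r₂ f₂ b < ∞ →
      weightedLpNorm p₃ r₃ (fun ξ => ‖prodSymbol B f₁ f₂ a b ξ‖ₑ) ≤
        C * localNorm p₁ r₁ f₁ a * localNorm p₂ r₂ f₂ b := by
  obtain ⟨C, hC⟩ := hloc
  refine ⟨C, fun f₁ f₂ a b R ha hb hfin₁ hfin₂ => ?_⟩
  have hle₁ := fourierLebesgueNorm_mulDistribution_le p₁ r₁ a f₁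
  have hle₂ := fourierLebesgueNorm_mulDistribution_le p₂ r₂ b f₂
  obtain ⟨h, hconv, -, hnorm⟩ := hC _ _ (hle₁.trans_lt hfin₁) (hle₂.trans_lt hfin₂)
  obtain ⟨χ, hχ⟩ := exists_isCutoff d
  -- Once the dilated cutoff is 1 on the ball containing both supports, the truncations no longer
  -- change anything: the defining sequence is eventually constant, which identifies `h`.
  have hF : ∀ φ : 𝓢(Rd d, ℂ), (𝓕 h) φ = ∫ ξ, φ ξ • prodSymbol B f₁ f₂ a b ξ := by
    intro φ
    refine tendsto_nhds_unique (hconv χ χ hχ hχ φ) (tendsto_const_nhds.congr' ?_)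
    filter_upwards [hχ.eventually_dilate_eq_one R] with n hn
    have hn' : ∀ c : 𝓢(Rd d, ℂ), (∀ y, R < ‖y‖ → c y = 0) → ∀ y, c y ≠ 0 → dilate χ n y = 1 :=
      fun c hc y hy => hn y (not_lt.1 fun hlt => hy (hc y hlt))
    simp only [fourierOfTruncation_mulDistribution f₁ (hn' a ha),
      fourierOfTruncation_mulDistribution f₂ (hn' b hb), prodSymbol]
  have hgiven : IsGivenBy (𝓕⁻ h) fun ξ => prodSymbol B f₁ f₂ a b (-ξ) := by
    refine ⟨((continuous_prodSymbol B f₁ f₂ a b).comp continuous_neg).aestronglyMeasurable,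
      fun φ => ?_⟩
    have hi := integrable_smul_prodSymbol B f₁ f₂ a b (reflect φ)
    simp only [reflect_apply] at hi
    constructor
    · simpa using hi.comp_neg
    · rw [TemperedDistribution.fourierInv_apply, ← fourier_reflect,
        ← TemperedDistribution.fourier_apply, hF, ← integral_neg_eq_self]
      simp [reflect_apply]
  have hlow : weightedLpNorm p₃ r₃ (fun ξ => ‖prodSymbol B f₁ f₂ a b ξ‖ₑ) ≤
      fourierLebesgueNorm p₃ r₃ h := by
    refine le_iInf₂ fun u hu => ?_
    rw [← weightedLpNorm_comp_neg p₃ r₃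
      (continuous_prodSymbol B f₁ f₂ a b).enorm.measurable.aemeasurable]
    refine le_of_eq (weightedLpNorm_congr_ae ?_)
    filter_upwards [hgiven.ae_eq hu] with ξ hξ
    rw [hξ]
  refine hlow.trans (hnorm.trans ?_)
  gcongr

end Local

/-! ### Pairings of localized pieces -/

section Pairing

variable {d : ℕ}

lemma fourier_charMul_apply (η : Rd d) (φ : 𝓢(Rd d, ℂ)) (s : Rd d) :
    (𝓕 (charMul η φ)) s = (𝓕 φ) (s + η) := by
  rw [fourier_schwartz_apply, fourier_schwartz_apply]
  refine integral_congr_ae (Eventually.of_forall fun y => ?_)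
  simp only [charMul_apply, character_add_left]
  ring

/-- Moving the Fourier transform from `c` onto `K` shows that only the values of `𝓕 K` on `t + supp
c` matter. -/
lemma fourier_mul_fourier_apply (K c : 𝓢(Rd d, ℂ)) (t : Rd d) :
    (𝓕 (mulSchwartz K (𝓕 c))) t = ∫ s, (𝓕 K) (s + t) * c s := by
  have h := SchwartzMap.integral_fourier_mul_eq (charMul t K) c
  simp only [fourier_charMul_apply] at h
  rw [h, fourier_schwartz_apply]
  refine integral_congr_ae (Eventually.of_forall fun ξ => ?_)
  simp only [charMul_apply, mulSchwartz_apply]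
  ring

lemma fourierInv_sub_eq_fourier_charMul (a : 𝓢(Rd d, ℂ)) (ζ ξ : Rd d) :
    (𝓕⁻ a) (ζ - ξ) = (𝓕 (charMul (-ζ) a)) ξ := by
  rw [fourier_charMul_apply, fourierInv_schwartz_eq_neg]
  congr 1
  abel

/-- A reproducing formula: `a a' = a`, and the product with `a'` is a convolution on the Fourier
side. -/
lemma apply_charMul_eq_integral {E : Type*} [NormedAddCommGroup E] [NormedSpace ℂ E]
    [CompleteSpace E] (f : 𝓢(Rd d, ℂ) →L[ℂ] E) {a a' : 𝓢(Rd d, ℂ)} (ha : ∀ y, a y ≠ 0 → a' y = 1)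
    (ξ : Rd d) : f (charMul ξ a) = ∫ ζ, (𝓕⁻ a') (ζ - ξ) • f (charMul ζ a) := by
  have e : mulSchwartz a a' = a := by
    ext y
    rw [mulSchwartz_apply]
    by_cases h : a y = 0
    · simp [h]
    · rw [ha y h, mul_one]
  have h := apply_charMul_mul f a a' ξ
  rw [e] at h
  have h2 := integral_add_left_eq_self (μ := volume) (fun ζ => (𝓕⁻ a') (ζ - ξ) • f (charMul ζ a)) ξ
  simp only [add_sub_cancel_left] at h2
  rw [h, h2]

variable {E₁ E₂ E₃ : Type*}
    [NormedAddCommGroup E₁] [NormedSpace ℂ E₁] [NormedAddCommGroup E₂] [NormedSpace ℂ E₂]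
    [NormedAddCommGroup E₃] [NormedSpace ℂ E₃] (B : E₁ →L[ℂ] E₂ →L[ℂ] E₃)
    (f₁ : 𝓢(Rd d, ℂ) →L[ℂ] E₁) (f₂ : 𝓢(Rd d, ℂ) →L[ℂ] E₂)

/-- The pairing of `φ` with the Fourier transform of the convolution of `a f₁` and `b f₂`. -/
def pairing (a b φ : 𝓢(Rd d, ℂ)) : E₃ := ∫ ξ, φ ξ • prodSymbol B f₁ f₂ a b ξ

/-- Licenses Fubini. The polynomial growth in `ζ` is split between `ξ` and `ζ - ξ` and absorbed by
the decay of `K` and `k`. -/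
lemma integrable_pairing_kernel (a b K k : 𝓢(Rd d, ℂ)) :
    Integrable (Function.uncurry fun ζ ξ : Rd d => K ξ •
      B (k (ζ - ξ) • f₁ (charMul ζ a)) (f₂ (charMul ξ b))) (volume.prod volume) := by
  obtain ⟨k₁, C₁, h₁⟩ := exists_norm_apply_charMul_le f₁ a
  obtain ⟨k₂, C₂, h₂⟩ := exists_norm_apply_charMul_le f₂ b
  have hdom := (integrable_schwartz_mul_pow K (k₁ + k₂)).convolution_integrand
    (ContinuousLinearMap.mul ℝ ℝ) (integrable_schwartz_mul_pow k k₁)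
  have hc₁ : Continuous fun p : Rd d × Rd d => f₁ (charMul p.1 a) :=
    (continuous_apply_charMul f₁ a).comp continuous_fst
  have hc₂ : Continuous fun p : Rd d × Rd d => f₂ (charMul p.2 b) :=
    (continuous_apply_charMul f₂ b).comp continuous_snd
  have hk : Continuous fun p : Rd d × Rd d => k (p.1 - p.2) :=
    k.continuous.comp (continuous_fst.sub continuous_snd)
  have hK : Continuous fun p : Rd d × Rd d => K p.2 := K.continuous.comp continuous_snd
  simp only [Function.uncurry_def]
  have hcont := hK.smul ((B.continuous.comp (hk.smul hc₁)).clm_apply hc₂)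
  refine (hdom.const_mul (‖B‖ * C₁ * C₂)).mono' hcont.aestronglyMeasurable
    (Eventually.of_forall fun p => ?_)
  simp only [ContinuousLinearMap.mul_apply']
  have h3 : (1 + ‖p.1‖) ^ k₁ ≤ (1 + ‖p.2‖) ^ k₁ * (1 + ‖p.1 - p.2‖) ^ k₁ := by
    rw [← mul_pow]
    have := one_add_norm_add_le p.2 (p.1 - p.2)
    rw [add_sub_cancel] at this
    exact pow_le_pow_left₀ (by positivity) this _
  have h4 : ‖B (k (p.1 - p.2) • f₁ (charMul p.1 a)) (f₂ (charMul p.2 b))‖ ≤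
      ‖B‖ * (‖k (p.1 - p.2)‖ * (C₁ * ((1 + ‖p.2‖) ^ k₁ * (1 + ‖p.1 - p.2‖) ^ k₁))) *
        (C₂ * (1 + ‖p.2‖) ^ k₂) := by
    refine (B.le_opNorm₂ _ _).trans ?_
    rw [norm_smul]
    have h5 := (h₁ p.1).trans (mul_le_mul_of_nonneg_left h3 C₁.2)
    have h6 := h₂ p.2
    gcongr
  rw [norm_smul]
  refine (mul_le_mul_of_nonneg_left h4 (norm_nonneg _)).trans (le_of_eq ?_)
  rw [pow_add]
  ring

lemma pairing_sub (a b φ φ' : 𝓢(Rd d, ℂ)) :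
    pairing B f₁ f₂ a b (φ - φ') = pairing B f₁ f₂ a b φ - pairing B f₁ f₂ a b φ' := by
  rw [pairing, pairing, pairing, ← integral_sub (integrable_smul_prodSymbol B f₁ f₂ a b φ)
    (integrable_smul_prodSymbol B f₁ f₂ a b φ')]
  simp [sub_smul]

section Complete

variable [CompleteSpace E₃]

lemma smul_prodSymbol_eq_integral [CompleteSpace E₁] {a a' : 𝓢(Rd d, ℂ)}
    (ha : ∀ y, a y ≠ 0 → a' y = 1) (b : 𝓢(Rd d, ℂ)) (c : ℂ) (ξ : Rd d) : c • prodSymbol B f₁ f₂ a b ξ =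
      ∫ ζ, c • B ((𝓕⁻ a') (ζ - ξ) • f₁ (charMul ζ a)) (f₂ (charMul ξ b)) := by
  have hi : Integrable fun ζ => (𝓕⁻ a') (ζ - ξ) • f₁ (charMul ζ a) :=
    integrable_smul_apply_charMul f₁ a (translate ξ (𝓕⁻ a'))
  have h2 := (B.flip (f₂ (charMul ξ b))).integral_comp_comm hi
  simp only [ContinuousLinearMap.flip_apply] at h2
  rw [integral_smul, h2, ← apply_charMul_eq_integral f₁ ha, prodSymbol]

/-- With the vector `e` frozen, the integral is `B e` applied to `f₂ (b · 𝓕 M)` for one Schwartz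
function `M`, and the support condition makes `𝓕 M` vanish wherever `b` does not. -/
lemma integral_smul_apply_eq_zero [CompleteSpace E₂] {a b K : 𝓢(Rd d, ℂ)}
    (hK : ∀ s t, a s ≠ 0 → b t ≠ 0 → (𝓕 K) (s + t) = 0) (e : E₁) (ζ : Rd d) :
    ∫ ξ, K ξ • B ((𝓕⁻ a) (ζ - ξ) • e) (f₂ (charMul ξ b)) = 0 := by
  set M := mulSchwartz K (𝓕 (charMul (-ζ) a)) with hM
  have h3 := (B e).integral_comp_comm (integrable_smul_apply_charMul f₂ b M)
  have h4 : mulSchwartz b (𝓕 M) = 0 := by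
    ext t
    rw [mulSchwartz_apply, hM, fourier_mul_fourier_apply]
    by_cases hb : b t = 0
    · rw [hb, zero_mul]; rfl
    have : ∀ s, (𝓕 K) (s + t) * charMul (-ζ) a s = 0 := by
      intro s
      by_cases hs : a s = 0
      · rw [charMul_apply, hs, mul_zero, mul_zero]
      · rw [hK s t hs hb, zero_mul]
    simp only [this, integral_zero, mul_zero]
    rfl
  rw [← apply_mul_fourier, h4, map_zero, map_zero] at h3
  rw [← h3]
  refine integral_congr_ae (Eventually.of_forall fun ξ => ?_)
  simp only [hM, mulSchwartz_apply, fourierInv_sub_eq_fourier_charMul, map_smul, smul_apply,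
    smul_smul]

variable [CompleteSpace E₁] [CompleteSpace E₂]

/-- The convolution of `a f₁` and `b f₂` is supported in the sum of the supports. -/
theorem pairing_eq_zero {a a' b K : 𝓢(Rd d, ℂ)} (ha : ∀ y, a y ≠ 0 → a' y = 1)
    (hK : ∀ s t, a' s ≠ 0 → b t ≠ 0 → (𝓕 K) (s + t) = 0) : pairing B f₁ f₂ a b K = 0 := by
  -- The reproducing formula for `a f₁` separates the variables: after exchanging the integrals, the
  -- value of `f₁` is constant in the inner integral, so only `f₂` has to be evaluated on a test
  -- function.
  have hInt := integrable_pairing_kernel B f₁ f₂ a b K (𝓕⁻ a')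
  have hswap := integral_integral_swap hInt
  rw [pairing, integral_congr_ae (Eventually.of_forall fun ξ =>
    smul_prodSymbol_eq_integral B f₁ f₂ ha b (K ξ) ξ), ← hswap,
    integral_congr_ae (Eventually.of_forall fun ζ => integral_smul_apply_eq_zero B f₂ hK _ ζ),
    integral_zero]

/-- The two test functions have Fourier transforms differing by `(1 - T_{x+y} ρ) 𝓕 φ`, which
vanishes on the sum of the relevant supports. This replaces an arbitrary `φ` by one concentrated
near `x + y` on the space side. -/
lemma pairing_eq_localized {ρ : 𝓢(Rd d, ℂ)} (hρ : ∀ y, ‖y‖ ≤ 5 → ρ y = 1) {a b : 𝓢(Rd d, ℂ)}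
    {x y : Rd d} (ha : ∀ t, 2 < ‖t - x‖ → a t = 0) (hb : ∀ t, 2 < ‖t - y‖ → b t = 0)
    (φ : 𝓢(Rd d, ℂ)) : pairing B f₁ f₂ a b φ =
      pairing B f₁ f₂ a b (𝓕⁻ (mulSchwartz (𝓕 φ) (translate (x + y) ρ))) := by
  -- `σ` is 1 on the ball of radius 2, which covers `a`, and vanishes outside radius 3. With radius
  -- 2 for `b` this explains the 5 required of `ρ`.
  obtain ⟨σ, hσ1, hσ0, -⟩ := exists_bump d (R := 2) two_pos
  rw [← sub_eq_zero, ← pairing_sub]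
  refine pairing_eq_zero B f₁ f₂ (a' := translate x σ) (fun t ht => ?_) fun s t hs ht => ?_
  · rw [SchwartzMap.compSubConstCLM_apply]
    exact hσ1 _ (not_lt.1 fun h => ht (ha t h))
  · have h1 : ‖s - x‖ < 3 := by
      refine not_le.1 fun h => hs ?_
      rw [SchwartzMap.compSubConstCLM_apply]
      exact hσ0 _ (by linarith)
    have h2 : ‖t - y‖ ≤ 2 := not_lt.1 fun h => ht (hb t h)
    have h3 : ρ (s + t - (x + y)) = 1 := by
      refine hρ _ ?_
      rw [add_sub_add_comm]
      linarith [norm_add_le (s - x) (t - y)]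
    have h4 : ∀ φ' : 𝓢(Rd d, ℂ), 𝓕 (φ - φ') = 𝓕 φ - 𝓕 φ' :=
      fun φ' => map_sub (FourierTransform.fourierCLM ℂ 𝓢(Rd d, ℂ)) φ φ'
    rw [h4, FourierTransform.fourier_fourierInv_eq, sub_apply,
      mulSchwartz_apply, SchwartzMap.compSubConstCLM_apply, h3, mul_one, sub_self]

end Complete

end Pairing

/-! ### Estimates for the pairings -/

section PairingBounds

variable {d : ℕ}

lemma exists_enorm_fourierInv_le (M : ℕ) : ∃ (m : ℕ) (C : ℝ≥0), ∀ (κ : 𝓢(Rd d, ℂ)) (η : Rd d),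
    ‖(𝓕⁻ κ) η‖ₑ ≤ C * ENNReal.ofReal (supSeminorm d m κ) * weight (-(M : ℝ)) η := by
  obtain ⟨m, C, h⟩ := exists_supSeminorm_fourierInv_le (d := d) M
  refine ⟨m, 2 ^ M * C, fun κ η => (enorm_apply_le M _ η).trans ?_⟩
  gcongr
  rw [← ENNReal.ofReal_coe_nnreal, ← ENNReal.ofReal_mul (by positivity)]
  refine ENNReal.ofReal_le_ofReal ?_
  push_cast
  rw [mul_assoc]
  exact mul_le_mul_of_nonneg_left (h κ) (by positivity)

/-- Decay of the inverse Fourier transform of a product of two translated functions. -/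
lemma exists_enorm_fourierInv_mul_translate_le (M N : ℕ) (ρ : 𝓢(Rd d, ℂ)) :
    ∃ (m : ℕ) (C : ℝ≥0), ∀ (φ : 𝓢(Rd d, ℂ)) (w η : Rd d),
      ‖(𝓕⁻ (mulSchwartz φ (translate w ρ))) η‖ₑ ≤
        C * ENNReal.ofReal (supSeminorm d m φ) * weight (-(N : ℝ)) w * weight (-(M : ℝ)) η := by
  obtain ⟨m, C, h⟩ := exists_enorm_fourierInv_le (d := d) M
  set c : ℝ≥0 := 2 ^ m * 2 ^ (m + N) * (2 ^ (m + N) * (supSeminorm d (m + N) ρ).toNNReal) with hc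
  refine ⟨m + N, C * c, fun φ w η => (h _ η).trans ?_⟩
  have key : ENNReal.ofReal (supSeminorm d m (mulSchwartz φ (translate w ρ))) ≤
      c * ENNReal.ofReal (supSeminorm d (m + N) φ) * weight (-(N : ℝ)) w := by
    refine (ofReal_le_mul_weight (supSeminorm_mul_translate_le m N φ ρ w)).trans (le_of_eq ?_)
    rw [← ENNReal.ofReal_coe_nnreal, ← ENNReal.ofReal_mul c.coe_nonneg, hc]
    push_cast
    rw [Real.coe_toNNReal _ (apply_nonneg _ _)]
    congr 2
    ring
  refine (mul_le_mul_left (mul_le_mul_right key _) _).trans (le_of_eq ?_)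
  push_cast
  ring

variable {E₁ E₂ E₃ : Type*}
    [NormedAddCommGroup E₁] [NormedSpace ℂ E₁] [NormedAddCommGroup E₂] [NormedSpace ℂ E₂]
    [NormedAddCommGroup E₃] [NormedSpace ℂ E₃]

lemma enorm_pairing_le (B : E₁ →L[ℂ] E₂ →L[ℂ] E₃) (f₁ : 𝓢(Rd d, ℂ) →L[ℂ] E₁)
    (f₂ : 𝓢(Rd d, ℂ) →L[ℂ] E₂) (a b φ : 𝓢(Rd d, ℂ)) :
    ‖pairing B f₁ f₂ a b φ‖ₑ ≤ ∫⁻ ξ, ‖φ ξ‖ₑ * ‖prodSymbol B f₁ f₂ a b ξ‖ₑ := by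
  refine (enorm_integral_le_lintegral_enorm _).trans (le_of_eq ?_)
  simp only [enorm_smul]

variable [CompleteSpace E₁] [CompleteSpace E₂] [CompleteSpace E₃]

/-- The pairing of a fixed test function with localized pieces near `x` and `y` decays in
`x + y`. -/
theorem FourierLebesgueConvEmbeds.exists_enorm_pairing_le {p₁ p₂ p₃ : ℝ≥0∞} {r₁ r₂ r₃ : ℝ}
    (hp₃ : 1 ≤ p₃) {B : E₁ →L[ℂ] E₂ →L[ℂ] E₃}
    (hloc : FourierLebesgueConvEmbeds d B p₁ p₂ p₃ r₁ r₂ r₃) (N : ℕ) :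
    ∃ (m : ℕ) (C : ℝ≥0), ∀ (f₁ : 𝓢(Rd d, ℂ) →L[ℂ] E₁) (f₂ : 𝓢(Rd d, ℂ) →L[ℂ] E₂)
      (a b φ : 𝓢(Rd d, ℂ)) (x y : Rd d),
      (∀ t, 2 < ‖t - x‖ → a t = 0) → (∀ t, 2 < ‖t - y‖ → b t = 0) →
      localNorm p₁ r₁ f₁ a < ∞ → localNorm p₂ r₂ f₂ b < ∞ →
      ‖pairing B f₁ f₂ a b φ‖ₑ ≤ C * ENNReal.ofReal (supSeminorm d m φ) *
        (weight (-(N : ℝ)) (x + y) * (localNorm p₁ r₁ f₁ a * localNorm p₂ r₂ f₂ b)) := by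
  obtain ⟨ρ, hρ, -⟩ := exists_bump d (R := 5) (by norm_num)
  -- The localized test function is `O(⟨x + y⟩^{-N} ⟨ξ⟩^{-M})`; this `M` makes its frequency part
  -- integrable against any function with finite weighted `L^{p₃}` norm.
  obtain ⟨M, hM⟩ := exists_nat_gt (d + |r₃|)
  obtain ⟨C₁, h₁⟩ := hloc.exists_prodSymbol_le
  obtain ⟨C₂, h₂⟩ := exists_lintegral_weight_mul_le (d := d) hp₃ r₃ hM
  obtain ⟨m', C₃, h₃⟩ := exists_enorm_fourierInv_mul_translate_le M N ρ
  obtain ⟨m, C₄, h₄⟩ := exists_supSeminorm_fourier_le (d := d) m'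
  refine ⟨m, C₃ * C₄ * C₂ * C₁, fun f₁ f₂ a b φ x y ha hb hfa hfb => ?_⟩
  have hR : ∀ (c : 𝓢(Rd d, ℂ)) (u : Rd d), (∀ t, 2 < ‖t - u‖ → c t = 0) →
      ∀ t, max (‖x‖) (‖y‖) + 2 < ‖t‖ → ‖u‖ ≤ max (‖x‖) (‖y‖) → c t = 0 := fun c u hc t ht hu =>
    hc t (by linarith [norm_sub_norm_le t u])
  have hps := h₁ f₁ f₂ a b _ (fun t ht => hR a x ha t ht (le_max_left _ _))
    (fun t ht => hR b y hb t ht (le_max_right _ _)) hfa hfb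
  set P : Rd d → ℝ≥0∞ := fun ξ => ‖prodSymbol B f₁ f₂ a b ξ‖ₑ
  have hP : Measurable P := (continuous_prodSymbol B f₁ f₂ a b).enorm.measurable
  rw [pairing_eq_localized B f₁ f₂ hρ ha hb]
  set c : ℝ≥0∞ := C₃ * ENNReal.ofReal (supSeminorm d m' (𝓕 φ)) * weight (-(N : ℝ)) (x + y)
  have hctop : c ≠ ∞ := ENNReal.mul_ne_top
    (ENNReal.mul_ne_top ENNReal.coe_ne_top ENNReal.ofReal_ne_top) (weight_ne_top _ _)
  have hc : c ≤ C₃ * (C₄ * ENNReal.ofReal (supSeminorm d m φ)) * weight (-(N : ℝ)) (x + y) := by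
    have : ENNReal.ofReal (supSeminorm d m' (𝓕 φ)) ≤ C₄ * ENNReal.ofReal (supSeminorm d m φ) := by
      rw [← ENNReal.ofReal_coe_nnreal, ← ENNReal.ofReal_mul C₄.coe_nonneg]
      exact ENNReal.ofReal_le_ofReal (h₄ φ)
    exact mul_le_mul_left (mul_le_mul_right this _) _
  calc _ ≤ ∫⁻ ξ, c * (weight (-(M : ℝ)) ξ * P ξ) := by
        refine (enorm_pairing_le _ _ _ _ _ _).trans (lintegral_mono fun ξ => ?_)
        rw [← mul_assoc]
        exact mul_le_mul_left (h₃ (𝓕 φ) (x + y) ξ) _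
    _ = c * ∫⁻ ξ, weight (-(M : ℝ)) ξ * P ξ := lintegral_const_mul' _ _ hctop
    _ ≤ (C₃ * (C₄ * ENNReal.ofReal (supSeminorm d m φ)) * weight (-(N : ℝ)) (x + y)) *
        (C₂ * (C₁ * localNorm p₁ r₁ f₁ a * localNorm p₂ r₂ f₂ b)) :=
        mul_le_mul' hc ((h₂ P hP).trans (mul_le_mul_right hps _))
    _ = _ := by push_cast; ring

/-- The short-time Fourier transform of the convolution of localized pieces near `x` and `y`. -/
lemma exists_enorm_pairing_window_le (M N : ℕ) (g : 𝓢(Rd d, ℂ)) :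
    ∃ C : ℝ≥0, ∀ (B : E₁ →L[ℂ] E₂ →L[ℂ] E₃) (f₁ : 𝓢(Rd d, ℂ) →L[ℂ] E₁)
      (f₂ : 𝓢(Rd d, ℂ) →L[ℂ] E₂) (a b : 𝓢(Rd d, ℂ)) (x y z ξ : Rd d),
      (∀ t, 2 < ‖t - x‖ → a t = 0) → (∀ t, 2 < ‖t - y‖ → b t = 0) →
      ‖pairing B f₁ f₂ a b (𝓕⁻ (charMul ξ (translate z g)))‖ₑ ≤
        C * weight (-(N : ℝ)) (z - (x + y)) *
          ∫⁻ η, weight (-(M : ℝ)) (ξ - η) * ‖prodSymbol B f₁ f₂ a b η‖ₑ := by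
  obtain ⟨ρ, hρ, -⟩ := exists_bump d (R := 5) (by norm_num)
  obtain ⟨m, C, h⟩ := exists_enorm_fourierInv_mul_translate_le M N g
  refine ⟨C * (supSeminorm d m ρ).toNNReal, fun B f₁ f₂ a b x y z ξ ha hb => ?_⟩
  rw [pairing_eq_localized B f₁ f₂ hρ ha hb, FourierTransform.fourier_fourierInv_eq]
  -- Recentring at `x + y`: under `𝓕⁻` the modulation becomes a shift by `ξ` and the translation a
  -- phase, leaving the product of `ρ` with a window displaced by `z - (x + y)`.
  have e : mulSchwartz (charMul ξ (translate z g)) (translate (x + y) ρ) =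
      charMul ξ (translate (x + y) (mulSchwartz ρ (translate (z - (x + y)) g))) := by
    ext t
    simp only [mulSchwartz_apply, charMul_apply, SchwartzMap.compSubConstCLM_apply]
    rw [show t - (x + y) - (z - (x + y)) = t - z by abel]
    ring
  have hctop : C * ENNReal.ofReal (supSeminorm d m ρ) * weight (-(N : ℝ)) (z - (x + y)) ≠ ∞ :=
    ENNReal.mul_ne_top (ENNReal.mul_ne_top ENNReal.coe_ne_top ENNReal.ofReal_ne_top)
      (weight_ne_top _ _)
  rw [e, fourierInv_charMul, ENNReal.coe_mul, ← ENNReal.ofReal,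
    ← lintegral_const_mul' _ _ hctop]
  refine (enorm_pairing_le _ _ _ _ _ _).trans (lintegral_mono fun η => ?_)
  rw [← mul_assoc, SchwartzMap.compSubConstCLM_apply, weight_sub_comm _ ξ η]
  refine mul_le_mul_left ?_ _
  rw [← ofReal_norm, norm_fourierInv_translate, ofReal_norm]
  exact h ρ _ _

end PairingBounds

/-! ### The global estimate -/

section Global

variable {d : ℕ}

lemma ae_lt_top_of_weightedLpNorm_lt_top {q : ℝ≥0∞} (hq : 1 ≤ q) {s : ℝ} {A : Rd d → ℝ≥0∞}
    (hA : Measurable A) (h : weightedLpNorm q s A < ∞) : ∀ᵐ x, A x < ∞ := by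
  obtain ⟨m, hm⟩ := exists_nat_gt (d + |s|)
  obtain ⟨C, hC⟩ := exists_lintegral_weight_mul_le (d := d) hq s hm
  have hfin := ((hC A hA).trans_lt (ENNReal.mul_lt_top ENNReal.coe_lt_top h)).ne
  filter_upwards [ae_lt_top ((measurable_weight _).mul hA) hfin] with x hx
  exact ENNReal.lt_top_of_mul_ne_top_right hx.ne (weight_ne_zero _ _)

lemma measurable_lintegral_conv {A₁ A₂ : Rd d → ℝ≥0∞} (hA₁ : Measurable A₁)
    (hA₂ : Measurable A₂) : Measurable fun z => ∫⁻ t, A₁ t * A₂ (z - t) :=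
  Measurable.lintegral_prod_right' (f := fun p : Rd d × Rd d => A₁ p.2 * A₂ (p.1 - p.2))
    ((hA₁.comp measurable_snd).mul (hA₂.comp (measurable_fst.sub measurable_snd)))

/-- Substituting `w = x + y` and applying Tonelli turns an integral over pairs of pieces into one
against the convolution of `A₁` and `A₂`. -/
lemma lintegral_prod_add_mul {K A₁ A₂ : Rd d → ℝ≥0∞} (hK : Measurable K) (hA₁ : Measurable A₁)
    (hA₂ : Measurable A₂) :
    ∫⁻ p : Rd d × Rd d, K (p.1 + p.2) * (A₁ p.1 * A₂ p.2) =
      ∫⁻ w, K w * ∫⁻ t, A₁ t * A₂ (w - t) := by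
  have h1 : Measurable fun p : Rd d × Rd d => K (p.1 + p.2) * (A₁ p.1 * A₂ p.2) :=
    (hK.comp (measurable_fst.add measurable_snd)).mul
      ((hA₁.comp measurable_fst).mul (hA₂.comp measurable_snd))
  have h2 : Measurable (Function.uncurry fun x w : Rd d => K w * (A₁ x * A₂ (w - x))) :=
    (hK.comp measurable_snd).mul
      ((hA₁.comp measurable_fst).mul (hA₂.comp (measurable_snd.sub measurable_fst)))
  rw [Measure.volume_eq_prod, lintegral_prod _ h1.aemeasurable]
  calc _ = ∫⁻ x, ∫⁻ w, K w * (A₁ x * A₂ (w - x)) := by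
        refine lintegral_congr fun x => ?_
        rw [← lintegral_add_left_eq_self (fun w => K w * (A₁ x * A₂ (w - x))) x]
        simp only [add_sub_cancel_left]
    _ = ∫⁻ w, ∫⁻ x, K w * (A₁ x * A₂ (w - x)) := lintegral_lintegral_swap h2.aemeasurable
    _ = _ := by
        refine lintegral_congr fun w => lintegral_const_mul _ ?_
        exact hA₁.mul (hA₂.comp (measurable_const.sub measurable_id))

lemma enorm_ofReal_toReal {a : ℝ≥0∞} (ha : a < ∞) : ‖((a.toReal : ℝ) : ℂ)‖ₑ = a := by
  rw [← ofReal_norm, Complex.norm_real, Real.norm_of_nonneg ENNReal.toReal_nonneg,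
    ENNReal.ofReal_toReal ha.ne]

/-- The convolution inequality for functions with values in `[0, ∞]`. -/
lemma LebesgueConvEmbeds.exists_lintegral_conv_le {q₁ q₂ q₃ : ℝ≥0∞} {s₁ s₂ s₃ : ℝ}
    (hq₁ : 1 ≤ q₁) (hq₂ : 1 ≤ q₂) (hglob : LebesgueConvEmbeds d q₁ q₂ q₃ s₁ s₂ s₃) :
    ∃ C : ℝ≥0, ∀ A₁ A₂ : Rd d → ℝ≥0∞, Measurable A₁ → Measurable A₂ →
      weightedLpNorm q₁ s₁ A₁ < ∞ → weightedLpNorm q₂ s₂ A₂ < ∞ →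
      weightedLpNorm q₃ s₃ (fun z => ∫⁻ t, A₁ t * A₂ (z - t)) ≤
        C * weightedLpNorm q₁ s₁ A₁ * weightedLpNorm q₂ s₂ A₂ := by
  obtain ⟨C, hC⟩ := hglob
  refine ⟨C, fun A₁ A₂ hA₁ hA₂ hfin₁ hfin₂ => ?_⟩
  have ht₁ := ae_lt_top_of_weightedLpNorm_lt_top hq₁ hA₁ hfin₁
  have ht₂ := ae_lt_top_of_weightedLpNorm_lt_top hq₂ hA₂ hfin₂
  -- The hypothesis concerns complex functions. As `A₁` and `A₂` are finite almost everywhere,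
  -- passing to `toReal` loses only null sets.
  set u : Rd d → ℂ := fun x => ((A₁ x).toReal : ℂ)
  set v : Rd d → ℂ := fun x => ((A₂ x).toReal : ℂ)
  have hu : ∀ᵐ x, ‖u x‖ₑ = A₁ x := ht₁.mono fun x hx => enorm_ofReal_toReal hx
  have hv : ∀ᵐ x, ‖v x‖ₑ = A₂ x := ht₂.mono fun x hx => enorm_ofReal_toReal hx
  have hun := weightedLpNorm_congr_ae (q := q₁) (s := s₁) hu
  have hvn := weightedLpNorm_congr_ae (q := q₂) (s := s₂) hv
  obtain ⟨hex, -, hle⟩ := hC u v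
    ⟨(Complex.measurable_ofReal.comp hA₁.ennreal_toReal).aestronglyMeasurable, by rwa [hun]⟩
    ⟨(Complex.measurable_ofReal.comp hA₂.ennreal_toReal).aestronglyMeasurable, by rwa [hvn]⟩
  rw [hun, hvn] at hle
  refine le_trans (le_of_eq (weightedLpNorm_congr_ae ?_)) hle
  filter_upwards [hex] with z hz
  have hInt : Integrable fun t => (A₁ t).toReal * (A₂ (z - t)).toReal := by
    have h1 : Integrable fun t => u t * v (z - t) := hz
    simpa [u, v] using h1.re
  have e : convolution u v (ContinuousLinearMap.mul ℂ ℂ) volume z =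
      ((∫ t, (A₁ t).toReal * (A₂ (z - t)).toReal : ℝ) : ℂ) := by
    rw [← integral_complex_ofReal, convolution]
    simp [u, v]
  have hnn : 0 ≤ ∫ t, (A₁ t).toReal * (A₂ (z - t)).toReal := integral_nonneg fun t => by positivity
  rw [e, ← ofReal_norm, Complex.norm_real, Real.norm_of_nonneg hnn,
    ofReal_integral_eq_lintegral_ofReal hInt (Eventually.of_forall fun t => by positivity)]
  refine lintegral_congr_ae ?_
  have hv' := (quasiMeasurePreserving_sub_left volume z).ae ht₂
  filter_upwards [ht₁, hv'] with t h1 h2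
  rw [ENNReal.ofReal_mul ENNReal.toReal_nonneg, ENNReal.ofReal_toReal h1.ne,
    ENNReal.ofReal_toReal h2.ne]

end Global

/-! ### Superposition of localized pieces -/

section Superposition

variable {d : ℕ} {E₁ E₂ E₃ : Type*}
    [NormedAddCommGroup E₁] [NormedSpace ℂ E₁] [NormedAddCommGroup E₂] [NormedSpace ℂ E₂]
    [NormedAddCommGroup E₃] [NormedSpace ℂ E₃] (B : E₁ →L[ℂ] E₂ →L[ℂ] E₃)
    (f₁ : 𝓢(Rd d, ℂ) →L[ℂ] E₁) (f₂ : 𝓢(Rd d, ℂ) →L[ℂ] E₂)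

lemma continuous_prodSymbol_prod {X : Type*} [TopologicalSpace X] {a b : X → 𝓢(Rd d, ℂ)}
    (ha : Continuous a) (hb : Continuous b) :
    Continuous (Function.uncurry fun x ξ => prodSymbol B f₁ f₂ (a x) (b x) ξ) :=
  (B.continuous.comp (continuous_apply_charMul_prod f₁ ha)).clm_apply
    (continuous_apply_charMul_prod f₂ hb)

lemma measurable_enorm_prodSymbol {X : Type*} [TopologicalSpace X] [MeasurableSpace X]
    [OpensMeasurableSpace X] [SecondCountableTopology X] {a b : X → 𝓢(Rd d, ℂ)}
    (ha : Continuous a) (hb : Continuous b) :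
    Measurable (Function.uncurry fun x ξ => ‖prodSymbol B f₁ f₂ (a x) (b x) ξ‖ₑ) :=
  (continuous_prodSymbol_prod B f₁ f₂ ha hb).enorm.measurable

lemma stronglyMeasurable_pairing {X : Type*} [TopologicalSpace X] [MeasurableSpace X]
    [OpensMeasurableSpace X] [SecondCountableTopology X] {a b : X → 𝓢(Rd d, ℂ)}
    (ha : Continuous a) (hb : Continuous b) (φ : 𝓢(Rd d, ℂ)) :
    StronglyMeasurable fun x => pairing B f₁ f₂ (a x) (b x) φ := by
  have hc : Continuous (Function.uncurry fun (x : X) ξ => φ ξ • prodSymbol B f₁ f₂ (a x) (b x) ξ) :=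
    (φ.continuous.comp continuous_snd).smul (continuous_prodSymbol_prod B f₁ f₂ ha hb)
  exact StronglyMeasurable.integral_prod_right (ν := volume) hc.stronglyMeasurable

lemma pairing_add (a b φ φ' : 𝓢(Rd d, ℂ)) :
    pairing B f₁ f₂ a b (φ + φ') = pairing B f₁ f₂ a b φ + pairing B f₁ f₂ a b φ' := by
  rw [pairing, pairing, pairing, ← integral_add (integrable_smul_prodSymbol B f₁ f₂ a b φ)
    (integrable_smul_prodSymbol B f₁ f₂ a b φ')]
  simp [add_smul]

lemma pairing_smul (a b φ : 𝓢(Rd d, ℂ)) (c : ℂ) :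
    pairing B f₁ f₂ a b (c • φ) = c • pairing B f₁ f₂ a b φ := by
  rw [pairing, pairing, ← integral_smul]
  simp [smul_smul]

lemma charMul_add (ξ : Rd d) (a b : 𝓢(Rd d, ℂ)) :
    charMul ξ (a + b) = charMul ξ a + charMul ξ b := map_add _ a b

lemma charMul_smul (ξ : Rd d) (c : ℂ) (a : 𝓢(Rd d, ℂ)) :
    charMul ξ (c • a) = c • charMul ξ a := map_smul _ c a

/-- The growth in `ξ` of both factors is polynomial and absorbed by `φ`. Continuity in `a` lets one
factor at a time be decomposed by `apply_eq_integral_translate`. -/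
lemma exists_norm_pairing_le_left (b φ : 𝓢(Rd d, ℂ)) : ∃ (m : ℕ) (C : ℝ≥0), ∀ a : 𝓢(Rd d, ℂ),
    ‖pairing B f₁ f₂ a b φ‖ ≤ C * supSeminorm d m a := by
  obtain ⟨m, C₁, h₁⟩ := exists_norm_le_supSeminorm f₁
  obtain ⟨k₁, m', C₁', h₁'⟩ := exists_supSeminorm_charMul_le (d := d) m
  obtain ⟨k₂, C₂, h₂⟩ := exists_norm_apply_charMul_le f₂ b
  set I : ℝ := ∫ ξ, ‖φ ξ‖ * (1 + ‖ξ‖) ^ (k₁ + k₂)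
  have hI : 0 ≤ I := integral_nonneg fun ξ => by positivity
  refine ⟨m', ‖B‖₊ * C₁ * C₁' * C₂ * I.toNNReal, fun a => ?_⟩
  have hle : ∀ ξ, ‖φ ξ • prodSymbol B f₁ f₂ a b ξ‖ ≤
      (‖B‖ * C₁ * C₁' * C₂ * supSeminorm d m' a) * (‖φ ξ‖ * (1 + ‖ξ‖) ^ (k₁ + k₂)) := by
    intro ξ
    have h3 := (h₁ (charMul ξ a)).trans (mul_le_mul_of_nonneg_left (h₁' ξ a) C₁.coe_nonneg)
    have h4 : ‖prodSymbol B f₁ f₂ a b ξ‖ ≤ ‖B‖ *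
        (C₁ * (C₁' * (1 + ‖ξ‖) ^ k₁ * supSeminorm d m' a)) * (C₂ * (1 + ‖ξ‖) ^ k₂) :=
      (B.le_opNorm₂ _ _).trans (mul_le_mul (mul_le_mul_of_nonneg_left h3 (norm_nonneg B)) (h₂ ξ)
        (norm_nonneg _) (by positivity))
    rw [norm_smul]
    refine (mul_le_mul_of_nonneg_left h4 (norm_nonneg _)).trans (le_of_eq ?_)
    rw [pow_add]
    ring
  have hInt := (integrable_schwartz_mul_pow φ (k₁ + k₂)).const_mul
    (‖B‖ * C₁ * C₁' * C₂ * supSeminorm d m' a)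
  refine (norm_integral_le_of_norm_le hInt (Eventually.of_forall hle)).trans (le_of_eq ?_)
  rw [integral_const_mul]
  push_cast
  rw [Real.coe_toNNReal _ hI]
  ring

/-- `a ↦ pairing B f₁ f₂ a b φ` as a continuous linear map. -/
def pairingLeft (b φ : 𝓢(Rd d, ℂ)) : 𝓢(Rd d, ℂ) →L[ℂ] E₃ :=
  SchwartzMap.mkCLMtoNormedSpace (σ := RingHom.id ℂ) (fun a => pairing B f₁ f₂ a b φ)
    (fun a a' => by
      rw [pairing, pairing, pairing, ← integral_add (integrable_smul_prodSymbol B f₁ f₂ a b φ)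
        (integrable_smul_prodSymbol B f₁ f₂ a' b φ)]
      simp only [prodSymbol, charMul_add, map_add, add_apply, smul_add])
    (fun c a => by
      rw [pairing, pairing, RingHom.id_apply, ← integral_smul]
      simp only [prodSymbol, charMul_smul, map_smul, smul_apply, smul_comm c])
    (by
      obtain ⟨m, C, h⟩ := exists_norm_pairing_le_left B f₁ f₂ b φ
      exact ⟨_, C, C.2, h⟩)

lemma pairingLeft_apply (a b φ : 𝓢(Rd d, ℂ)) :
    pairingLeft B f₁ f₂ b φ a = pairing B f₁ f₂ a b φ := rfl

lemma mulSchwartz_comm (a b : 𝓢(Rd d, ℂ)) : mulSchwartz a b = mulSchwartz b a := by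
  ext y
  rw [mulSchwartz_apply, mulSchwartz_apply, mul_comm]

/-- The superposition is a tempered distribution because `φ` enters the bound through one seminorm,
separated from the integrable `G`; the exceptional null set may depend on `φ`. -/
lemma exists_clm_eq_integral_pairing {X : Type*} [TopologicalSpace X] [MeasurableSpace X]
    [OpensMeasurableSpace X] [SecondCountableTopology X] {μ : Measure X} {a b : X → 𝓢(Rd d, ℂ)}
    (ha : Continuous a) (hb : Continuous b) {m : ℕ} {C : ℝ≥0} {G : X → ℝ≥0∞}
    (hG : ∫⁻ x, G x ∂μ < ∞)
    (h : ∀ φ, ∀ᵐ x ∂μ, ‖pairing B f₁ f₂ (a x) (b x) φ‖ₑ ≤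
      C * ENNReal.ofReal (supSeminorm d m φ) * G x) :
    ∃ H : 𝓢(Rd d, ℂ) →L[ℂ] E₃, ∀ φ, H φ = ∫ x, pairing B f₁ f₂ (a x) (b x) φ ∂μ := by
  have hfin : ∀ φ, ∫⁻ x, ‖pairing B f₁ f₂ (a x) (b x) φ‖ₑ ∂μ ≤
      C * ENNReal.ofReal (supSeminorm d m φ) * ∫⁻ x, G x ∂μ := fun φ => by
    rw [← lintegral_const_mul' _ _ (ENNReal.mul_ne_top ENNReal.coe_ne_top ENNReal.ofReal_ne_top)]
    exact lintegral_mono_ae (h φ)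
  have hInt : ∀ φ, Integrable (fun x => pairing B f₁ f₂ (a x) (b x) φ) μ := fun φ =>
    ⟨(stronglyMeasurable_pairing B f₁ f₂ ha hb φ).aestronglyMeasurable, (hfin φ).trans_lt
      (ENNReal.mul_lt_top (ENNReal.mul_lt_top ENNReal.coe_lt_top ENNReal.ofReal_lt_top) hG)⟩
  refine ⟨SchwartzMap.mkCLMtoNormedSpace (σ := RingHom.id ℂ)
    (fun φ => ∫ x, pairing B f₁ f₂ (a x) (b x) φ ∂μ) (fun φ φ' => ?_) (fun c φ => ?_)
    ⟨Finset.Iic (m, m), C * (∫⁻ x, G x ∂μ).toReal, by positivity, fun φ => ?_⟩, fun φ => rfl⟩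
  · simp only [pairing_add]
    exact integral_add (hInt φ) (hInt φ')
  · simp only [pairing_smul]
    exact integral_smul _ _
  · have h1 := (enorm_integral_le_lintegral_enorm _).trans (hfin φ)
    have h2 := ENNReal.toReal_mono (ENNReal.mul_ne_top (ENNReal.mul_ne_top ENNReal.coe_ne_top
      ENNReal.ofReal_ne_top) hG.ne) h1
    rw [toReal_enorm, ENNReal.toReal_mul, ENNReal.toReal_mul, ENNReal.coe_toReal,
      ENNReal.toReal_ofReal (apply_nonneg _ _)] at h2
    refine h2.trans (le_of_eq ?_)
    rw [supSeminorm]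
    ring

/-- Decomposition of the convolution of `a f₁` and `b f₂` into localized pieces. -/
lemma pairing_eq_integral_integral [CompleteSpace E₃] {ψ : 𝓢(Rd d, ℂ)} (hψ : ∫ x, ψ x = 1)
    (a b φ : 𝓢(Rd d, ℂ)) : pairing B f₁ f₂ a b φ = ∫ x, ∫ y,
      pairing B f₁ f₂ (mulSchwartz (translate x ψ) a) (mulSchwartz (translate y ψ) b) φ := by
  have h1 : ∀ a' : 𝓢(Rd d, ℂ), pairing B f₁ f₂ a' b φ =
      ∫ y, pairing B f₁ f₂ a' (mulSchwartz (translate y ψ) b) φ := fun a' => by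
    -- Flipping `B` exchanges the factors, so continuity in the first slot also serves the second.
    have h := apply_eq_integral_translate (pairingLeft B.flip f₂ f₁ a' φ) hψ b
    simp only [mulSchwartz_comm b] at h
    exact h
  have h2 := apply_eq_integral_translate (pairingLeft B f₁ f₂ b φ) hψ a
  simp only [mulSchwartz_comm a, pairingLeft_apply] at h2
  rw [h2]
  exact integral_congr_ae (Eventually.of_forall fun x => h1 _)

end Superposition

/-! ### Convolution of Wiener amalgam spaces -/

section Amalgam

variable {d : ℕ}

lemma ae_prod_lt_top {A₁ A₂ : Rd d → ℝ≥0∞} (h₁ : ∀ᵐ x, A₁ x < ∞) (h₂ : ∀ᵐ x, A₂ x < ∞) :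
    ∀ᵐ p : Rd d × Rd d, A₁ p.1 < ∞ ∧ A₂ p.2 < ∞ := by
  rw [Measure.volume_eq_prod]
  exact (Measure.quasiMeasurePreserving_fst.ae h₁).and (Measure.quasiMeasurePreserving_snd.ae h₂)

lemma weightedLpNorm_const_mul_le_of_ne_top (q : ℝ≥0∞) (s : ℝ) (F : Rd d → ℝ≥0∞) {c : ℝ≥0∞}
    (hc : c ≠ ∞) : weightedLpNorm q s (fun x => c * F x) ≤ c * weightedLpNorm q s F := by
  lift c to ℝ≥0 using hc
  exact weightedLpNorm_const_mul_le q s F c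

lemma measurable_lintegral_weight_conv {X : Type*} [MeasurableSpace X] (s : ℝ)
    {P : X → Rd d → ℝ≥0∞} (hP : Measurable (Function.uncurry P)) :
    Measurable (Function.uncurry fun x ξ => ∫⁻ η, weight s (ξ - η) * P x η) := by
  refine Measurable.lintegral_prod_right' (ν := volume)
    (f := fun q : (X × Rd d) × Rd d => weight s (q.1.2 - q.2) * P q.1.1 q.2) ?_
  have h : Measurable fun q : (X × Rd d) × Rd d => (q.1.1, q.2) := by fun_prop
  exact ((measurable_weight s).comp ((measurable_snd.comp measurable_fst).sub
    measurable_snd)).mul (hP.comp h)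

/-- Superposition of convolutions with a rapidly decaying kernel. -/
lemma exists_weightedLpNorm_superposition_le {X : Type*} [MeasurableSpace X] (μ : Measure X)
    [SigmaFinite μ] {p : ℝ≥0∞} (hp : 1 ≤ p) (r : ℝ) {m : ℝ} (hm : d + |r| < m) :
    ∃ C : ℝ≥0, ∀ (P : X → Rd d → ℝ≥0∞) (w A : X → ℝ≥0∞), Measurable (Function.uncurry P) →
      Measurable w → (∀ x, w x ≠ ∞) → (∀ᵐ x ∂μ, weightedLpNorm p r (P x) ≤ A x) →
      weightedLpNorm p r (fun ξ => ∫⁻ x, w x * (∫⁻ η, weight (-m) (ξ - η) * P x η) ∂μ) ≤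
        C * ∫⁻ x, w x * A x ∂μ := by
  obtain ⟨C, hC⟩ := exists_weightedLpNorm_conv_weight_le (d := d) hp r hm
  refine ⟨C, fun P w A hP hw hwtop hA => ?_⟩
  refine (weightedLpNorm_lintegral_le hp r ((hw.comp measurable_fst).mul
    (measurable_lintegral_weight_conv (-m) hP))).trans ?_
  rw [← lintegral_const_mul' _ _ ENNReal.coe_ne_top]
  refine lintegral_mono_ae (hA.mono fun x hx => ?_)
  refine (weightedLpNorm_const_mul_le_of_ne_top p r _ (hwtop x)).trans ?_
  have hPx : Measurable (P x) := hP.comp measurable_prodMk_left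
  refine (mul_le_mul_right ((hC (P x) hPx).trans (mul_le_mul_right hx _)) _).trans (le_of_eq ?_)
  ring

lemma eventually_mul_dilate_eq {χ ψ : 𝓢(Rd d, ℂ)} (hχ : IsCutoff χ) (hψ : ∀ y, 2 ≤ ‖y‖ → ψ y = 0)
    (x : Rd d) : ∀ᶠ n : ℕ in atTop, mulSchwartz (translate x ψ) (dilate χ n) = translate x ψ := by
  filter_upwards [hχ.eventually_dilate_eq_one (‖x‖ + 2)] with n hn
  ext y
  rw [mulSchwartz_apply, SchwartzMap.compSubConstCLM_apply]
  rcases le_or_gt 2 ‖y - x‖ with h | h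
  · rw [hψ _ h, zero_mul]
  · rw [hn y (by linarith [norm_sub_norm_le y x]), mul_one]

variable {E₁ E₂ E₃ : Type*}
    [NormedAddCommGroup E₁] [NormedSpace ℂ E₁] [NormedAddCommGroup E₂] [NormedSpace ℂ E₂]
    [NormedAddCommGroup E₃] [NormedSpace ℂ E₃]
    [CompleteSpace E₁] [CompleteSpace E₂] [CompleteSpace E₃]
    {B : E₁ →L[ℂ] E₂ →L[ℂ] E₃} {p₁ p₂ p₃ : ℝ≥0∞} {r₁ r₂ r₃ : ℝ}

/-- The convolution exists, and it is the superposition of the convolutions of localized pieces. -/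
theorem FourierLebesgueConvEmbeds.exists_isConvolution
    (hloc : FourierLebesgueConvEmbeds d B p₁ p₂ p₃ r₁ r₂ r₃)
    (hp₁ : 1 ≤ p₁) (hp₂ : 1 ≤ p₂) (hp₃ : 1 ≤ p₃) {ψ : 𝓢(Rd d, ℂ)} (hψ1 : ∫ x, ψ x = 1)
    (hψ0 : ∀ y, 2 ≤ ‖y‖ → ψ y = 0) (f₁ : 𝓢'(Rd d, E₁)) (f₂ : 𝓢'(Rd d, E₂))
    (hA₁ : ∀ᵐ x, localNorm p₁ r₁ f₁ (translate x ψ) < ∞)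
    (hA₂ : ∀ᵐ y, localNorm p₂ r₂ f₂ (translate y ψ) < ∞) {N : ℕ}
    (hfin : ∫⁻ p : Rd d × Rd d, weight (-(N : ℝ)) (p.1 + p.2) *
      (localNorm p₁ r₁ f₁ (translate p.1 ψ) * localNorm p₂ r₂ f₂ (translate p.2 ψ)) < ∞) :
    ∃ h : 𝓢'(Rd d, E₃), IsConvolution B f₁ f₂ h ∧ ∀ φ, h φ =
      ∫ p : Rd d × Rd d, pairing B f₁ f₂ (translate p.1 ψ) (translate p.2 ψ) (𝓕⁻ φ) := by
  set G : Rd d × Rd d → ℝ≥0∞ := fun p => weight (-(N : ℝ)) (p.1 + p.2) *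
    (localNorm p₁ r₁ f₁ (translate p.1 ψ) * localNorm p₂ r₂ f₂ (translate p.2 ψ)) with hG
  have hGm : Measurable G := ((measurable_weight _).comp (measurable_fst.add measurable_snd)).mul
    (((measurable_localNorm p₁ r₁ f₁ (continuous_translate_left ψ)).comp measurable_fst).mul
      ((measurable_localNorm p₂ r₂ f₂ (continuous_translate_left ψ)).comp measurable_snd))
  have hψx : ∀ (x t : Rd d), 2 < ‖t - x‖ → translate x ψ t = 0 := fun x t ht => by
    rw [SchwartzMap.compSubConstCLM_apply]; exact hψ0 _ ht.le
  obtain ⟨m, C, hC⟩ := hloc.exists_enorm_pairing_le hp₃ N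
  have hae := ae_prod_lt_top hA₁ hA₂
  have hc₁ : Continuous fun p : Rd d × Rd d => translate p.1 ψ :=
    (continuous_translate_left ψ).comp continuous_fst
  have hc₂ : Continuous fun p : Rd d × Rd d => translate p.2 ψ :=
    (continuous_translate_left ψ).comp continuous_snd
  obtain ⟨H, hH⟩ := exists_clm_eq_integral_pairing B f₁ f₂ hc₁ hc₂ hfin (m := m) (C := C)
    fun φ => hae.mono fun p hp => hC f₁ f₂ _ _ φ p.1 p.2 (hψx p.1) (hψx p.2) hp.1 hp.2
  -- The pairings are taken on the Fourier side, so the superposition `H` is the Fourier transform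
  -- of the convolution.
  let H' : 𝓢'(Rd d, E₃) := H
  refine ⟨𝓕⁻ H', fun χ₁ χ₂ hχ₁ hχ₂ φ => ?_, fun φ => hH _⟩
  rw [FourierTransform.fourier_fourierInv_eq]
  obtain ⟨ρ, hρ, -⟩ := exists_bump d (R := 2) two_pos
  have hρψ : ∀ y, ψ y ≠ 0 → ρ y = 1 := fun y hy => hρ y (not_lt.1 fun h => hy (hψ0 y h.le))
  obtain ⟨T₁, hT₁⟩ := exists_localNorm_truncation_le (E := E₁) hp₁ r₁ hρψ χ₁
  obtain ⟨T₂, hT₂⟩ := exists_localNorm_truncation_le (E := E₂) hp₂ r₂ hρψ χ₂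
  set F : ℕ → Rd d × Rd d → E₃ := fun n p => pairing B f₁ f₂
    (mulSchwartz (translate p.1 ψ) (dilate χ₁ n)) (mulSchwartz (translate p.2 ψ) (dilate χ₂ n)) φ
    with hF
  have hFm : ∀ n, AEStronglyMeasurable (F n) volume := fun n => by
    refine (stronglyMeasurable_pairing B f₁ f₂ ?_ ?_ φ).aestronglyMeasurable
    · simp only [mulSchwartz_comm _ (dilate χ₁ n)]
      exact (mulSchwartz (dilate χ₁ n)).continuous.comp hc₁
    · simp only [mulSchwartz_comm _ (dilate χ₂ n)]
      exact (mulSchwartz (dilate χ₂ n)).continuous.comp hc₂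
  -- The truncation constants `T₁`, `T₂` do not depend on `n`, so one dominating function serves the
  -- whole sequence.
  set c : ℝ≥0∞ := C * ENNReal.ofReal (supSeminorm d m φ) * (T₁ * T₂)
  have hctop : c ≠ ∞ := ENNReal.mul_ne_top (ENNReal.mul_ne_top ENNReal.coe_ne_top
    ENNReal.ofReal_ne_top) (ENNReal.mul_ne_top ENNReal.coe_ne_top ENNReal.coe_ne_top)
  have hbint : ∫⁻ p, c * G p ≠ ∞ := by
    rw [lintegral_const_mul' _ _ hctop]
    exact ENNReal.mul_ne_top hctop hfin.ne
  have hbm : Measurable fun p => c * G p := hGm.const_mul c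
  have hFle : ∀ n, ∀ᵐ p, ‖F n p‖ₑ ≤ c * G p := fun n => by
    filter_upwards [hae] with p hp
    have hz : ∀ (x : Rd d) (χ : 𝓢(Rd d, ℂ)) (t : Rd d), 2 < ‖t - x‖ →
        mulSchwartz (translate x ψ) χ t = 0 := fun x χ t ht => by
      rw [mulSchwartz_apply, hψx x t ht, zero_mul]
    have h1 := hT₁ f₁ n p.1
    have h2 := hT₂ f₂ n p.2
    refine (hC f₁ f₂ _ _ φ p.1 p.2 (hz p.1 _) (hz p.2 _)
      (h1.trans_lt (ENNReal.mul_lt_top ENNReal.coe_lt_top hp.1))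
      (h2.trans_lt (ENNReal.mul_lt_top ENNReal.coe_lt_top hp.2))).trans ?_
    refine (mul_le_mul_right (mul_le_mul_right (mul_le_mul' h1 h2) _) _).trans (le_of_eq ?_)
    simp only [c, hG]
    ring
  have hFle' : ∀ n, ∀ᵐ p, ‖F n p‖ ≤ (c * G p).toReal := fun n => by
    filter_upwards [hFle n, ae_lt_top hbm hbint] with p hp hpt
    rw [← toReal_enorm]
    exact ENNReal.toReal_mono hpt.ne hp
  have hbi := integrable_toReal_of_lintegral_ne_top hbm.aemeasurable hbint
  -- For fixed `p` the integrand is eventually constant in `n`, because the cutoffs become 1 on the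
  -- supports of both translates of `ψ`.
  have hlim : Tendsto (fun n => ∫ p, F n p) atTop (𝓝 (H φ)) := by
    rw [hH]
    refine tendsto_integral_of_dominated_convergence _ hFm hbi hFle'
      (Eventually.of_forall fun p => tendsto_const_nhds.congr' ?_)
    filter_upwards [eventually_mul_dilate_eq hχ₁ hψ0 p.1, eventually_mul_dilate_eq hχ₂ hψ0 p.2]
      with n h1 h2
    simp only [hF, h1, h2]
  -- The iterated integral of the truncated pieces reassembles the whole truncated convolution.
  refine hlim.congr fun n => ?_
  have hi : Integrable (F n) (volume.prod volume) := hbi.mono' (hFm n) (hFle' n)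
  rw [Measure.volume_eq_prod, integral_prod _ hi]
  exact (pairing_eq_integral_integral B f₁ f₂ hψ1 _ _ φ).symm

/-- The local norms of a superposition of convolutions of localized pieces. -/
theorem FourierLebesgueConvEmbeds.exists_localNorm_superposition_le
    (hloc : FourierLebesgueConvEmbeds d B p₁ p₂ p₃ r₁ r₂ r₃) (hp₃ : 1 ≤ p₃) {ψ : 𝓢(Rd d, ℂ)}
    (hψ0 : ∀ y, 2 ≤ ‖y‖ → ψ y = 0) (N : ℕ) (g : 𝓢(Rd d, ℂ)) :
    ∃ C : ℝ≥0, ∀ (f₁ : 𝓢(Rd d, ℂ) →L[ℂ] E₁) (f₂ : 𝓢(Rd d, ℂ) →L[ℂ] E₂)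
      (h : 𝓢(Rd d, ℂ) →L[ℂ] E₃) (z : Rd d),
      (∀ᵐ x, localNorm p₁ r₁ f₁ (translate x ψ) < ∞) →
      (∀ᵐ y, localNorm p₂ r₂ f₂ (translate y ψ) < ∞) →
      (∀ φ, h φ = ∫ p : Rd d × Rd d,
        pairing B f₁ f₂ (translate p.1 ψ) (translate p.2 ψ) (𝓕⁻ φ)) →
      localNorm p₃ r₃ h (translate z g) ≤ C * ∫⁻ p : Rd d × Rd d,
        weight (-(N : ℝ)) (z - (p.1 + p.2)) *
        (localNorm p₁ r₁ f₁ (translate p.1 ψ) * localNorm p₂ r₂ f₂ (translate p.2 ψ)) := by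
  have hψx : ∀ (x t : Rd d), 2 < ‖t - x‖ → translate x ψ t = 0 := fun x t ht => by
    rw [SchwartzMap.compSubConstCLM_apply]; exact hψ0 _ ht.le
  -- `M` governs the kernel in frequency, and so is tied to `r₃`; the spatial decay `N` stays free
  -- for the global step.
  obtain ⟨M, hM⟩ := exists_nat_gt (d + |r₃|)
  obtain ⟨C₁, h₁⟩ := exists_enorm_pairing_window_le (E₁ := E₁) (E₂ := E₂) (E₃ := E₃) M N g
  obtain ⟨C₂, h₂⟩ := exists_weightedLpNorm_superposition_le
    (volume : Measure (Rd d × Rd d)) hp₃ r₃ hM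
  obtain ⟨C₃, h₃⟩ := hloc.exists_prodSymbol_le
  refine ⟨C₂ * (C₁ * C₃), fun f₁ f₂ h z hA₁ hA₂ hh => ?_⟩
  have hc₁ : Continuous fun p : Rd d × Rd d => translate p.1 ψ :=
    (continuous_translate_left ψ).comp continuous_fst
  have hc₂ : Continuous fun p : Rd d × Rd d => translate p.2 ψ :=
    (continuous_translate_left ψ).comp continuous_snd
  have hw : Measurable fun p : Rd d × Rd d => C₁ * weight (-(N : ℝ)) (z - (p.1 + p.2)) :=
    ((measurable_weight _).comp
      (measurable_const.sub (measurable_fst.add measurable_snd))).const_mul _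
  have hae : ∀ᵐ p : Rd d × Rd d, weightedLpNorm p₃ r₃
      (fun η => ‖prodSymbol B f₁ f₂ (translate p.1 ψ) (translate p.2 ψ) η‖ₑ) ≤
      C₃ * localNorm p₁ r₁ f₁ (translate p.1 ψ) * localNorm p₂ r₂ f₂ (translate p.2 ψ) :=
    (ae_prod_lt_top hA₁ hA₂).mono fun p hp => h₃ f₁ f₂ _ _ (max (‖p.1‖) (‖p.2‖) + 2)
      (fun t ht => hψx _ _ (by linarith [norm_sub_norm_le t p.1, le_max_left ‖p.1‖ ‖p.2‖]))
      (fun t ht => hψx _ _ (by linarith [norm_sub_norm_le t p.2, le_max_right ‖p.1‖ ‖p.2‖]))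
      hp.1 hp.2
  have hmain := h₂ _ _ _ (measurable_enorm_prodSymbol B f₁ f₂ hc₁ hc₂) hw
    (fun p => ENNReal.mul_ne_top ENNReal.coe_ne_top (weight_ne_top _ _)) hae
  refine (weightedLpNorm_mono fun ξ => ?_).trans (hmain.trans (le_of_eq ?_))
  · rw [hh]
    refine (enorm_integral_le_lintegral_enorm _).trans (lintegral_mono fun p => ?_)
    exact h₁ B f₁ f₂ _ _ p.1 p.2 z ξ (hψx p.1) (hψx p.2)
  · rw [ENNReal.coe_mul, mul_assoc]
    congr 1
    rw [← lintegral_const_mul' _ _ ENNReal.coe_ne_top]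
    refine lintegral_congr fun p => ?_
    push_cast
    ring

/-- Wiener amalgam spaces inherit convolution relations from their local and global components. -/
theorem amalgamConvEmbeds {q₁ q₂ q₃ : ℝ≥0∞} {s₁ s₂ s₃ : ℝ}
    (hp₁ : 1 ≤ p₁) (hp₂ : 1 ≤ p₂) (hp₃ : 1 ≤ p₃) (hq₁ : 1 ≤ q₁) (hq₂ : 1 ≤ q₂) (hq₃ : 1 ≤ q₃)
    (hloc : FourierLebesgueConvEmbeds d B p₁ p₂ p₃ r₁ r₂ r₃)
    (hglob : LebesgueConvEmbeds d q₁ q₂ q₃ s₁ s₂ s₃) :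
    AmalgamConvEmbeds d B p₁ p₂ p₃ q₁ q₂ q₃ r₁ r₂ r₃ s₁ s₂ s₃ := by
  intro g₁ g₂ g₃ hg₁ hg₂ hg₃
  obtain ⟨ψ, hψ1, hψ0⟩ : ∃ ψ : 𝓢(Rd d, ℂ), ∫ x, ψ x = 1 ∧ ∀ y, 2 ≤ ‖y‖ → ψ y = 0 := by
    obtain ⟨ρ, -, h0, -, hI⟩ := exists_bump d one_pos
    refine ⟨(∫ y, ρ y)⁻¹ • ρ, ?_, fun y hy => ?_⟩
    · simp only [smul_apply, smul_eq_mul]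
      rw [integral_const_mul, inv_mul_cancel₀ hI]
    · rw [smul_apply, h0 y (by linarith), smul_zero]
  -- This one choice of `N` makes the kernel bounded on the target global space and embeds that
  -- space into weighted `L¹`.
  obtain ⟨N, hN⟩ := exists_nat_gt (d + |s₃|)
  obtain ⟨W₁, hW₁⟩ := exists_windowChange_le (E := E₁) hp₁ hq₁ r₁ s₁ (conjSchwartz_ne_zero hg₁) ψ
  obtain ⟨W₂, hW₂⟩ := exists_windowChange_le (E := E₂) hp₂ hq₂ r₂ s₂ (conjSchwartz_ne_zero hg₂) ψ
  obtain ⟨CL, hCL⟩ := hloc.exists_localNorm_superposition_le hp₃ hψ0 N (conjSchwartz g₃)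
  obtain ⟨CG, hCG⟩ := hglob.exists_lintegral_conv_le hq₁ hq₂
  obtain ⟨CY, hCY⟩ := exists_weightedLpNorm_conv_weight_le (d := d) hq₃ s₃ hN
  obtain ⟨CI, hCI⟩ := exists_lintegral_weight_mul_le (d := d) hq₃ s₃ hN
  refine ⟨CL * CY * CG * W₁ * W₂, fun f₁ f₂ hf₁ hf₂ => ?_⟩
  set A₁ : Rd d → ℝ≥0∞ := fun x => localNorm p₁ r₁ f₁ (translate x ψ)
  set A₂ : Rd d → ℝ≥0∞ := fun x => localNorm p₂ r₂ f₂ (translate x ψ)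
  have hA₁ : Measurable A₁ := measurable_localNorm p₁ r₁ f₁ (continuous_translate_left ψ)
  have hA₂ : Measurable A₂ := measurable_localNorm p₂ r₂ f₂ (continuous_translate_left ψ)
  -- Membership only provides some window, possibly not `g₁`; finiteness is therefore transferred
  -- from that window to `ψ`.
  have hfin₁ : weightedLpNorm q₁ s₁ A₁ < ∞ := by
    obtain ⟨g, hg, hgf⟩ := hf₁
    obtain ⟨W, hW⟩ := exists_windowChange_le (E := E₁) hp₁ hq₁ r₁ s₁ (conjSchwartz_ne_zero hg) ψ
    rw [amalgamNorm_eq] at hgf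
    exact (hW f₁).trans_lt (ENNReal.mul_lt_top ENNReal.coe_lt_top hgf)
  have hfin₂ : weightedLpNorm q₂ s₂ A₂ < ∞ := by
    obtain ⟨g, hg, hgf⟩ := hf₂
    obtain ⟨W, hW⟩ := exists_windowChange_le (E := E₂) hp₂ hq₂ r₂ s₂ (conjSchwartz_ne_zero hg) ψ
    rw [amalgamNorm_eq] at hgf
    exact (hW f₂).trans_lt (ENNReal.mul_lt_top ENNReal.coe_lt_top hgf)
  have ht₁ := ae_lt_top_of_weightedLpNorm_lt_top hq₁ hA₁ hfin₁
  have ht₂ := ae_lt_top_of_weightedLpNorm_lt_top hq₂ hA₂ hfin₂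
  set D : Rd d → ℝ≥0∞ := fun z => ∫⁻ t, A₁ t * A₂ (z - t)
  have hD : Measurable D := measurable_lintegral_conv hA₁ hA₂
  have hDle : weightedLpNorm q₃ s₃ D ≤ CG * weightedLpNorm q₁ s₁ A₁ * weightedLpNorm q₂ s₂ A₂ :=
    hCG A₁ A₂ hA₁ hA₂ hfin₁ hfin₂
  have hDfin : weightedLpNorm q₃ s₃ D < ∞ := hDle.trans_lt
    (ENNReal.mul_lt_top (ENNReal.mul_lt_top ENNReal.coe_lt_top hfin₁) hfin₂)
  -- The global hypothesis enters existence as well: finiteness of the norm of `D` gives the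
  -- dominating function for the truncations.
  have hfin : ∫⁻ p : Rd d × Rd d, weight (-(N : ℝ)) (p.1 + p.2) * (A₁ p.1 * A₂ p.2) < ∞ := by
    rw [lintegral_prod_add_mul (measurable_weight _) hA₁ hA₂]
    exact (hCI D hD).trans_lt (ENNReal.mul_lt_top ENNReal.coe_lt_top hDfin)
  obtain ⟨h, hconv, hh⟩ := hloc.exists_isConvolution hp₁ hp₂ hp₃ hψ1 hψ0 f₁ f₂ ht₁ ht₂ hfin
  have hle : amalgamNorm p₃ q₃ r₃ s₃ g₃ h ≤ CL * (CY * weightedLpNorm q₃ s₃ D) := by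
    rw [amalgamNorm_eq]
    refine (weightedLpNorm_mono fun z => ?_).trans ((weightedLpNorm_const_mul_le q₃ s₃
      (fun z => ∫⁻ w, weight (-(N : ℝ)) (z - w) * D w) CL).trans (mul_le_mul_right (hCY D hD) _))
    refine (hCL f₁ f₂ h z ht₁ ht₂ hh).trans (le_of_eq ?_)
    rw [← lintegral_prod_add_mul (K := fun w => weight (-(N : ℝ)) (z - w)) _ hA₁ hA₂]
    exact (measurable_weight _).comp (measurable_const.sub measurable_id)
  refine ⟨h, hconv, ⟨g₃, hg₃, hle.trans_lt (ENNReal.mul_lt_top ENNReal.coe_lt_top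
    (ENNReal.mul_lt_top ENNReal.coe_lt_top hDfin))⟩, hle.trans ?_⟩
  rw [amalgamNorm_eq, amalgamNorm_eq]
  have hD' := hDle.trans (mul_le_mul' (mul_le_mul_right (hW₁ f₁) _) (hW₂ f₂))
  refine (mul_le_mul_right (mul_le_mul_right hD' _) _).trans (le_of_eq ?_)
  push_cast
  ring

end Amalgam

end WienerAmalgam

end

theorem mainTheorem9 (d : ℕ) {E₁ E₂ E₃ : Type*}
    [NormedAddCommGroup E₁] [NormedSpace ℂ E₁] [CompleteSpace E₁]
    [NormedAddCommGroup E₂] [NormedSpace ℂ E₂] [CompleteSpace E₂]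
    [NormedAddCommGroup E₃] [NormedSpace ℂ E₃] [CompleteSpace E₃]
    (B : E₁ →L[ℂ] E₂ →L[ℂ] E₃) (hB : ‖B‖ ≤ 1)
    (p₁ p₂ p₃ q₁ q₂ q₃ : ENNReal)
    (hp₁ : 1 ≤ p₁) (hp₂ : 1 ≤ p₂) (hp₃ : 1 ≤ p₃)
    (hq₁ : 1 ≤ q₁) (hq₂ : 1 ≤ q₂) (hq₃ : 1 ≤ q₃)
    (r₁ r₂ r₃ s₁ s₂ s₃ : ℝ)
    (hlocal : WienerAmalgam.FourierLebesgueConvEmbeds d B p₁ p₂ p₃ r₁ r₂ r₃)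
    (hglobal : WienerAmalgam.LebesgueConvEmbeds d q₁ q₂ q₃ s₁ s₂ s₃) :
    WienerAmalgam.AmalgamConvEmbeds d B p₁ p₂ p₃ q₁ q₂ q₃ r₁ r₂ r₃ s₁ s₂ s₃ := by
  exact WienerAmalgam.amalgamConvEmbeds hp₁ hp₂ hp₃ hq₁ hq₂ hq₃ hlocal hglobal
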